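/- Let $\mathcal{C}$ be a fusion category over $\mathbb{C}$: a finite semisimple $\mathbb{C}$-linear abelian rigid monoidal category with bilinear tensor product and simple unit object $\mathbf 1$. Notation. $\mathrm{Inv}(\mathcal{C})$ is the category of invertible objects of $\mathcal{C}$ and isomorphisms between them, monoidal under $\otimes$; $\mathrm{Eq}(\mathcal{C})$ is the category of $\mathbb{C}$-linear tensor autoequivalences of $\mathcal{C}$ and monoidal natural isomorphisms, monoidal under composition. $\mathrm{Out}(\mathcal{C})$ is the full sub-2-group of the Brauer-Picard 2-group of $\mathcal{C}$ on the invertible (finite semisimple) $\mathcal{C}$-$\mathcal{C}$-bimodule categories that are equivalent to $\mathcal{C}$ as left module categories; its 1-morphisms are bimodule equivalences, its 2-morphisms are isomorphisms of bimodule functors, its product is $\boxtimes_{\mathcal{C}}$ (characterized by the universal property that linear functors out of $\mathcal M\boxtimes_{\mathcal C}\mathcal N$ are the bilinear $\mathcal C$-balanced functors on $\mathcal M\times\mathcal N$), and its unit object is the regular bimodule category $\mathcal{C}$. For $g\in\mathrm{Inv}(\mathcal{C})$ let $F_g(X)=g\otimes X\otimes g^{*}$, with tensor structure given by evaluation $g^*\otimes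 g\to\mathbf 1$; an isomorphism $\phi:g\to h$ is sent to the monoidal isomorphism $\phi\otimes\mathrm{id}\otimes(\phi^{-1})^{*}:F_g\to F_h$. For $F\in\mathrm{Eq}(\mathcal{C})$ let $M_F$ be the category $\mathcal{C}$ with the $\mathcal{C}$-$\mathcal{C}$-bimodule structure $X\otimes m\otimes Y:=X\otimes m\otimes F(Y)$; a monoidal isomorphism $\theta:F\to G$ is sent to the bimodule equivalence $M_F\to M_G$ which is the identity functor, with $\theta$ applied before tensoring on the right. Theorem. $\mathrm{Inv}(\mathcal{C})$ and $\mathrm{Eq}(\mathcal{C})$ are categorical groups, and the regular bimodule category and all $M_F$ are objects of $\mathrm{Out}(\mathcal{C})$. The functor $F_-$ is a homomorphism of categorical groups, through the canonical isomorphisms $F_{g\otimes h}\cong F_g\circ F_h$. The functor $M_-$ is a homomorphism of categorical 2-groups ($\mathrm{Eq}(\mathcal{C})$ being regarded as a categorical 2-group with only identity 2-morphisms), through the equivalences $M_F\boxtimes_{\mathcal{C}}M_G\simeq M_{F\circ G}$ induced by $(m,n)\mapsto m\otimes F(n)$. The sequence $$\mathrm{Inv}(\mathcal{C})\xrightarrow{\;F_-\;}\mathrm{Eq}(\mathcal{C})\xrightarrow{\;M_-\;}\mathrm{Out}(\mathcal{C})$$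 is a homotopy fiber sequence in the following sense: the bimodule equivalences $$\Phi_g:\mathcal{C}\to M_{F_g},\qquad X\mapsto X\otimes g^{*},$$ whose compatibility with the right actions is given by evaluation, underlie a monoidal pseudonatural equivalence from the constant homomorphism at the unit object $\mathcal{C}$ to $M_{F_-}$, such that the resulting functor $g\mapsto(F_g,\Phi_g)$ is an equivalence from $\mathrm{Inv}(\mathcal{C})$ to the homotopy fiber of $M_-$ over $\mathcal{C}$. Here the homotopy fiber is the category whose objects are the pairs $(F,\varphi)$ of some $F\in\mathrm{Eq}(\mathcal{C})$ and a bimodule equivalence $\varphi:\mathcal{C}\to M_F$, and whose morphisms $(F,\varphi)\to(F',\varphi')$ are the pairs of a monoidal isomorphism $\theta:F\to F'$ and an isomorphism $M_\theta\circ\varphi\cong\varphi'$ of bimodule functors. -/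

import Mathlib

open CategoryTheory MonoidalCategory Category

universe v u

namespace FusionFiber

section Fusion

attribute [local instance] Abelian.hasFiniteBiproducts

/-- A `ℂ`-linear abelian category is finite semisimple if its Hom spaces are finite dimensional and
there are finitely many simple objects such that every object is a finite direct sum of them. -/
class FiniteSemisimple (A : Type u) [Category.{v} A] [Abelian A] [Linear ℂ A] : Prop where
  finiteDimensional_hom : ∀ X Y : A, FiniteDimensional ℂ (X ⟶ Y)
  exists_simples : ∃ (n : ℕ) (S : Fin n → A), (∀ i, Simple (S i)) ∧
    ∀ X : A, ∃ (m : ℕ) (f : Fin m → Fin n), Nonempty (X ≅ ⨁ fun j => S (f j))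

/-- A fusion category over `ℂ`: a finite semisimple `ℂ`-linear rigid monoidal category with
bilinear tensor product and simple unit object. -/
class FusionCategory (C : Type u) [Category.{v} C] [Abelian C] [Linear ℂ C] [MonoidalCategory C]
    [MonoidalPreadditive C] [MonoidalLinear ℂ C] [RigidCategory C] : Prop
    extends FiniteSemisimple C where
  simple_unit : Simple (𝟙_ C)

/-- A categorical (1-)group: a monoidal groupoid all of whose objects are invertible. -/
structure IsCategoricalGroup (G : Type*) [Category G] [MonoidalCategory G] : Prop where
  isGroupoid : IsGroupoid G
  exists_inverse : ∀ g : G, ∃ h : G, Nonempty (g ⊗ h ≅ 𝟙_ G) ∧ Nonempty (h ⊗ g ≅ 𝟙_ G)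

end Fusion

section InvObj

variable (C : Type u) [Category.{v} C] [MonoidalCategory C]

/-- The objects of the categorical group of invertible objects of `C`. -/
structure InvObj where
  obj : C
  invertible : ∃ h : C, Nonempty (obj ⊗ h ≅ 𝟙_ C) ∧ Nonempty (h ⊗ obj ≅ 𝟙_ C)

namespace InvObj

variable {C}

/-- A morphism of invertible objects is an isomorphism in `C`. -/
@[ext]
structure Hom (g h : InvObj C) where
  iso : g.obj ≅ h.obj

instance : Category (InvObj C) where
  Hom := Hom
  id g := ⟨Iso.refl _⟩
  comp f g := ⟨f.iso ≪≫ g.iso⟩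

@[simp] lemma id_iso (g : InvObj C) : Hom.iso (𝟙 g) = Iso.refl _ := rfl
@[simp] lemma comp_iso {g h k : InvObj C} (a : g ⟶ h) (b : h ⟶ k) :
    Hom.iso (a ≫ b) = Hom.iso a ≪≫ Hom.iso b := rfl

@[ext] lemma hom_ext {g h : InvObj C} {a b : g ⟶ h} (w : (Hom.iso a).hom = (Hom.iso b).hom) :
    a = b := Hom.ext (Iso.ext w)

/-- An isomorphism in `C` as an isomorphism of invertible objects. -/
@[simps] def mkIso {g h : InvObj C} (e : g.obj ≅ h.obj) : g ≅ h where
  hom := ⟨e⟩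
  inv := ⟨e.symm⟩

/-- The tensor product of invertible objects. -/
@[simps] def tensor (g h : InvObj C) : InvObj C where
  obj := g.obj ⊗ h.obj
  invertible := by
    obtain ⟨g', ⟨a⟩, ⟨b⟩⟩ := g.invertible
    obtain ⟨h', ⟨c⟩, ⟨d⟩⟩ := h.invertible
    exact ⟨h' ⊗ g',
      ⟨α_ _ _ _ ≪≫ whiskerLeftIso _ ((α_ _ _ _).symm ≪≫ whiskerRightIso c _ ≪≫ λ_ _) ≪≫ a⟩,
      ⟨α_ _ _ _ ≪≫ whiskerLeftIso _ ((α_ _ _ _).symm ≪≫ whiskerRightIso b _ ≪≫ λ_ _) ≪≫ d⟩⟩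

/-- The unit object. -/
@[simps] def unit : InvObj C := ⟨𝟙_ C, 𝟙_ C, ⟨λ_ _⟩, ⟨λ_ _⟩⟩

instance : MonoidalCategoryStruct (InvObj C) where
  tensorObj := tensor
  whiskerLeft g _ _ f := ⟨whiskerLeftIso g.obj (Hom.iso f)⟩
  whiskerRight f h := ⟨whiskerRightIso (Hom.iso f) h.obj⟩
  tensorHom f g := ⟨Hom.iso f ⊗ᵢ Hom.iso g⟩
  tensorUnit := unit
  associator g h k := mkIso (α_ g.obj h.obj k.obj)
  leftUnitor g := mkIso (λ_ g.obj)
  rightUnitor g := mkIso (ρ_ g.obj)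

section lemmas
variable (g h k l : InvObj C)
@[simp] lemma tensor_obj' : (g ⊗ h).obj = g.obj ⊗ h.obj := rfl
@[simp] lemma unit_obj' : (𝟙_ (InvObj C)).obj = 𝟙_ C := rfl
@[simp] lemma whiskerLeft_iso (f : h ⟶ k) : Hom.iso (g ◁ f) = whiskerLeftIso g.obj (Hom.iso f) :=
  rfl
@[simp] lemma whiskerRight_iso (f : h ⟶ k) : Hom.iso (f ▷ g) = whiskerRightIso (Hom.iso f) g.obj :=
  rfl
@[simp] lemma tensorHom_iso (f : g ⟶ h) (f' : k ⟶ l) :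
    Hom.iso (f ⊗ₘ f') = (Hom.iso f ⊗ᵢ Hom.iso f') := rfl
@[simp] lemma associator_hom_iso : Hom.iso (α_ g h k).hom = α_ g.obj h.obj k.obj := rfl
@[simp] lemma leftUnitor_hom_iso : Hom.iso (λ_ g).hom = λ_ g.obj := rfl
@[simp] lemma rightUnitor_hom_iso : Hom.iso (ρ_ g).hom = ρ_ g.obj := rfl
end lemmas

instance : MonoidalCategory (InvObj C) where
  tensorHom_def _ _ := by ext; simp [MonoidalCategory.tensorHom_def]
  id_tensorHom_id _ _ := by ext; simp
  tensorHom_comp_tensorHom _ _ _ _ := by ext; simp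
  whiskerLeft_id _ _ := by ext; simp
  id_whiskerRight _ _ := by ext; simp
  associator_naturality _ _ _ := by ext; simp
  leftUnitor_naturality _ := by ext; simp
  rightUnitor_naturality _ := by ext; simp
  pentagon _ _ _ _ := by ext; simp
  triangle _ _ := by ext; simp

end InvObj

end InvObj

section TensorAut

variable (C : Type u) [Category.{v} C] [Abelian C] [Linear ℂ C] [MonoidalCategory C]

/-- A tensor autoequivalence of `C`: a `ℂ`-linear monoidal functor `C ⥤ C` which is an
equivalence of categories. -/
structure TensorAut where
  functor : C ⥤ C
  [monoidal : functor.Monoidal]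
  [additive : functor.Additive]
  [linear : functor.Linear ℂ]
  [isEquivalence : functor.IsEquivalence]

namespace TensorAut

attribute [instance] monoidal additive linear isEquivalence

variable {C}

/-- A morphism of tensor autoequivalences is a monoidal natural isomorphism. -/
structure Hom (F G : TensorAut C) where
  iso : F.functor ≅ G.functor
  [isMonoidal : NatTrans.IsMonoidal iso.hom]

attribute [instance] Hom.isMonoidal

instance : Category (TensorAut C) where
  Hom := Hom
  id F := { iso := Iso.refl _, isMonoidal := inferInstanceAs (NatTrans.IsMonoidal (𝟙 F.functor)) }
  comp a b :=
    { iso := a.iso ≪≫ b.iso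
      isMonoidal := inferInstanceAs (NatTrans.IsMonoidal (a.iso.hom ≫ b.iso.hom)) }

/-- The component of a monoidal natural isomorphism at an object. -/
abbrev app {F G : TensorAut C} (θ : F ⟶ G) (X : C) : F.functor.obj X ≅ G.functor.obj X :=
  (Hom.iso θ).app X

@[simp] lemma id_app (F : TensorAut C) (X : C) : (Hom.iso (𝟙 F)).hom.app X = 𝟙 _ := rfl
@[simp] lemma comp_app {F G H : TensorAut C} (a : F ⟶ G) (b : G ⟶ H) (X : C) :
    (Hom.iso (a ≫ b)).hom.app X = (Hom.iso a).hom.app X ≫ (Hom.iso b).hom.app X := rfl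

@[ext] lemma hom_ext {F G : TensorAut C} {a b : F ⟶ G}
    (w : ∀ X, (Hom.iso a).hom.app X = (Hom.iso b).hom.app X) : a = b := by
  obtain ⟨a⟩ : Hom F G := a
  obtain ⟨b⟩ : Hom F G := b
  obtain rfl : a = b := by ext X; exact w X
  rfl

/-- A monoidal natural isomorphism as an isomorphism of tensor autoequivalences. -/
@[simps] def mkIso {F G : TensorAut C} (e : F.functor ≅ G.functor)
    (he : NatTrans.IsMonoidal e.hom) : F ≅ G where
  hom := { iso := e }
  inv := { iso := e.symm, isMonoidal := inferInstanceAs (NatTrans.IsMonoidal e.inv) }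
  hom_inv_id := by ext; simp [CategoryStruct.comp, CategoryStruct.id]
  inv_hom_id := by ext; simp [CategoryStruct.comp, CategoryStruct.id]

/-- Composition of tensor autoequivalences, `(F ∘ G)(X) = F (G X)`. -/
@[simps] def tensor (F G : TensorAut C) : TensorAut C where
  functor := G.functor ⋙ F.functor
  isEquivalence := inferInstance

/-- The identity autoequivalence. -/
@[simps] def unit : TensorAut C where
  functor := 𝟭 C

instance : MonoidalCategoryStruct (TensorAut C) where
  tensorObj := tensor
  whiskerLeft F _ _ θ :=
    { iso := Functor.isoWhiskerRight (Hom.iso θ) F.functor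
      isMonoidal :=
        inferInstanceAs (NatTrans.IsMonoidal (Functor.whiskerRight (Hom.iso θ).hom F.functor)) }
  whiskerRight θ G :=
    { iso := Functor.isoWhiskerLeft G.functor (Hom.iso θ)
      isMonoidal :=
        inferInstanceAs (NatTrans.IsMonoidal (Functor.whiskerLeft G.functor (Hom.iso θ).hom)) }
  tensorHom θ η :=
    { iso := NatIso.hcomp (Hom.iso η) (Hom.iso θ)
      isMonoidal := inferInstanceAs (NatTrans.IsMonoidal ((Hom.iso η).hom ◫ (Hom.iso θ).hom)) }
  tensorUnit := unit
  associator F G H :=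
    mkIso (F := tensor (tensor F G) H) (G := tensor F (tensor G H))
      (Functor.associator H.functor G.functor F.functor).symm
      (inferInstanceAs
        (NatTrans.IsMonoidal (Functor.associator H.functor G.functor F.functor).inv))
  leftUnitor F := mkIso (F := tensor unit F) (Functor.rightUnitor F.functor)
    (inferInstanceAs (NatTrans.IsMonoidal F.functor.rightUnitor.hom))
  rightUnitor F := mkIso (F := tensor F unit) (Functor.leftUnitor F.functor)
    (inferInstanceAs (NatTrans.IsMonoidal F.functor.leftUnitor.hom))

section lemmas
variable (F G H K : TensorAut C)
@[simp] lemma tensor_functor' : (F ⊗ G).functor = G.functor ⋙ F.functor := rfl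
@[simp] lemma unit_functor' : (𝟙_ (TensorAut C)).functor = 𝟭 C := rfl
@[simp] lemma whiskerLeft_app (θ : G ⟶ H) (X : C) :
    (Hom.iso (F ◁ θ)).hom.app X = F.functor.map ((Hom.iso θ).hom.app X) := rfl
@[simp] lemma whiskerRight_app (θ : G ⟶ H) (X : C) :
    (Hom.iso (θ ▷ F)).hom.app X = (Hom.iso θ).hom.app (F.functor.obj X) := rfl
@[simp] lemma tensorHom_app (θ : F ⟶ G) (η : H ⟶ K) (X : C) :
    (Hom.iso (θ ⊗ₘ η)).hom.app X =
      (Hom.iso θ).hom.app (H.functor.obj X) ≫ G.functor.map ((Hom.iso η).hom.app X) := by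
  rfl
@[simp] lemma associator_hom_app (X : C) : (Hom.iso (α_ F G H).hom).hom.app X = 𝟙 _ := rfl
@[simp] lemma leftUnitor_hom_app (X : C) : (Hom.iso (λ_ F).hom).hom.app X = 𝟙 _ := rfl
@[simp] lemma rightUnitor_hom_app (X : C) : (Hom.iso (ρ_ F).hom).hom.app X = 𝟙 _ := rfl
end lemmas

instance : MonoidalCategory (TensorAut C) where
  tensorHom_def _ _ := by ext; simp
  id_tensorHom_id _ _ := by ext; simp
  tensorHom_comp_tensorHom _ _ _ _ := by ext; simp
  whiskerLeft_id _ _ := by ext; simp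
  id_whiskerRight _ _ := by ext; simp
  associator_naturality _ _ _ := by ext; simp
  leftUnitor_naturality _ := by ext; simp
  rightUnitor_naturality _ := by ext; simp
  pentagon _ _ _ _ := by ext; simp
  triangle _ _ := by ext; simp

end TensorAut

end TensorAut

section Conjugation

variable {C : Type u} [Category.{v} C] [MonoidalCategory C]

namespace InvObj

variable (g : InvObj C)

lemma isEquivalence_tensorLeft : (tensorLeft g.obj).IsEquivalence := by
  obtain ⟨h, ⟨a⟩, ⟨b⟩⟩ := g.invertible
  let e : C ≌ C := CategoryTheory.Equivalence.mk (tensorLeft g.obj) (tensorLeft h)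
    ((leftUnitorNatIso C).symm ≪≫ (tensoringLeft C).mapIso b.symm ≪≫ tensorLeftTensor _ _)
    ((tensorLeftTensor _ _).symm ≪≫ (tensoringLeft C).mapIso a ≪≫ leftUnitorNatIso C)
  exact e.isEquivalence_functor

variable [RightRigidCategory C]

instance isIso_evaluation : IsIso (ε_ g.obj g.objᘁ) := by
  have := g.isEquivalence_tensorLeft
  have h : IsIso ((tensorLeftAdjunction g.obj g.objᘁ).counit.app (𝟙_ C)) := inferInstance
  have e : (tensorLeftAdjunction g.obj g.objᘁ).counit.app (𝟙_ C) =
      (α_ _ _ _).inv ≫ ε_ g.obj g.objᘁ ▷ 𝟙_ C ≫ (λ_ (𝟙_ C)).hom := by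
    simp [tensorLeftAdjunction, tensorLeftHomEquiv]
  rw [e] at h
  have h2 : ε_ g.obj g.objᘁ = (ρ_ _).inv ≫ (α_ _ _ _).hom ≫ ((α_ _ _ _).inv ≫
      ε_ g.obj g.objᘁ ▷ 𝟙_ C ≫ (λ_ (𝟙_ C)).hom) := by
    simp [unitors_equal]
  rw [h2]
  infer_instance

instance isIso_coevaluation : IsIso (η_ g.obj g.objᘁ) := by
  have := g.isEquivalence_tensorLeft
  have := (tensorLeftAdjunction g.obj g.objᘁ).isEquivalence_left_of_isEquivalence_right
  have h : IsIso ((tensorLeftAdjunction g.obj g.objᘁ).unit.app (𝟙_ C)) := inferInstance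
  have e : (tensorLeftAdjunction g.obj g.objᘁ).unit.app (𝟙_ C) =
      (λ_ _).inv ≫ η_ g.obj g.objᘁ ▷ 𝟙_ C ≫ (α_ _ _ _).hom := by
    simp [tensorLeftAdjunction, tensorLeftHomEquiv]
  rw [e] at h
  have h2 : η_ g.obj g.objᘁ = ((λ_ _).inv ≫ η_ g.obj g.objᘁ ▷ 𝟙_ C ≫ (α_ _ _ _).hom) ≫
      (α_ _ _ _).inv ≫ (ρ_ _).hom := by
    simp [unitors_inv_equal]
  rw [h2]
  infer_instance

/-- The functor `X ↦ g ⊗ X ⊗ g*`. -/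
@[simps] def conjFunctor : C ⥤ C where
  obj X := g.obj ⊗ (X ⊗ g.objᘁ)
  map f := g.obj ◁ (f ▷ g.objᘁ)

/-- The tensor structure of `X ↦ g ⊗ X ⊗ g*`, given by evaluation
`g ⊗ X ⊗ g* ⊗ g ⊗ Y ⊗ g* ⟶ g ⊗ X ⊗ Y ⊗ g*`. -/
def conjMu (X Y : C) :
    (g.obj ⊗ (X ⊗ g.objᘁ)) ⊗ (g.obj ⊗ (Y ⊗ g.objᘁ)) ⟶ g.obj ⊗ ((X ⊗ Y) ⊗ g.objᘁ) :=
  𝟙 _ ⊗≫ (g.obj ⊗ X) ◁ ε_ g.obj g.objᘁ ▷ (Y ⊗ g.objᘁ) ⊗≫ 𝟙 _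

instance isIso_conjMu (X Y : C) : IsIso (g.conjMu X Y) := by
  dsimp only [conjMu, monoidalComp]; infer_instance

/-- The unit constraint of `X ↦ g ⊗ X ⊗ g*`, given by coevaluation. -/
def conjEps : 𝟙_ C ⟶ g.obj ⊗ (𝟙_ C ⊗ g.objᘁ) := η_ g.obj g.objᘁ ⊗≫ 𝟙 _

instance isIso_conjEps : IsIso g.conjEps := by
  dsimp only [conjEps, monoidalComp]; infer_instance

lemma conj_associativity (X Y Z : C) :
    g.conjMu X Y ▷ (g.obj ⊗ (Z ⊗ g.objᘁ)) ≫ g.conjMu (X ⊗ Y) Z ≫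
      g.obj ◁ ((α_ X Y Z).hom ▷ g.objᘁ) =
    (α_ _ _ _).hom ≫ (g.obj ⊗ (X ⊗ g.objᘁ)) ◁ g.conjMu Y Z ≫ g.conjMu X (Y ⊗ Z) := by
  let a := g.obj
  let b := g.objᘁ
  calc
    _ = 𝟙 _ ⊗≫ (a ⊗ X) ◁ (ε_ a b ▷ (Y ⊗ b ⊗ a) ≫ 𝟙_ C ◁ (Y ◁ ε_ a b)) ▷ (Z ⊗ b) ⊗≫ 𝟙 _ := by
      dsimp only [conjMu, a, b]; monoidal
    _ = 𝟙 _ ⊗≫ (a ⊗ X) ◁ ((b ⊗ a) ◁ (Y ◁ ε_ a b) ≫ ε_ a b ▷ (Y ⊗ 𝟙_ C)) ▷ (Z ⊗ b) ⊗≫ 𝟙 _ := by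
      rw [whisker_exchange]
    _ = _ := by
      dsimp only [conjMu, a, b]; monoidal

lemma conj_left_unitality (X : C) :
    (λ_ (g.obj ⊗ (X ⊗ g.objᘁ))).hom =
      g.conjEps ▷ (g.obj ⊗ (X ⊗ g.objᘁ)) ≫ g.conjMu (𝟙_ C) X ≫
        g.obj ◁ ((λ_ X).hom ▷ g.objᘁ) := by
  let a := g.obj
  let b := g.objᘁ
  symm
  calc
    _ = 𝟙 _ ⊗≫ (η_ a b ▷ a ⊗≫ a ◁ ε_ a b) ▷ (X ⊗ b) ⊗≫ 𝟙 _ := by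
      dsimp only [conjMu, conjEps, a, b]; monoidal
    _ = _ := by
      rw [ExactPairing.evaluation_coevaluation'']; dsimp only [a, b]; monoidal

lemma conj_right_unitality (X : C) :
    (ρ_ (g.obj ⊗ (X ⊗ g.objᘁ))).hom =
      (g.obj ⊗ (X ⊗ g.objᘁ)) ◁ g.conjEps ≫ g.conjMu X (𝟙_ C) ≫
        g.obj ◁ ((ρ_ X).hom ▷ g.objᘁ) := by
  let a := g.obj
  let b := g.objᘁ
  symm
  calc
    _ = 𝟙 _ ⊗≫ (a ⊗ X) ◁ (b ◁ η_ a b ⊗≫ ε_ a b ▷ b) ⊗≫ 𝟙 _ := by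
      dsimp only [conjMu, conjEps, a, b]; monoidal
    _ = _ := by
      rw [ExactPairing.coevaluation_evaluation'']; dsimp only [a, b]; monoidal

lemma conjMu_natural_left {X Y : C} (f : X ⟶ Y) (Z : C) :
    (g.obj ◁ (f ▷ g.objᘁ)) ▷ (g.obj ⊗ (Z ⊗ g.objᘁ)) ≫ g.conjMu Y Z =
      g.conjMu X Z ≫ g.obj ◁ ((f ▷ Z) ▷ g.objᘁ) := by
  let a := g.obj
  let b := g.objᘁ
  calc
    _ = 𝟙 _ ⊗≫ a ◁ (f ▷ (b ⊗ a) ≫ Y ◁ ε_ a b) ▷ (Z ⊗ b) ⊗≫ 𝟙 _ := by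
      dsimp only [conjMu, a, b]; monoidal
    _ = 𝟙 _ ⊗≫ a ◁ (X ◁ ε_ a b ≫ f ▷ (𝟙_ C)) ▷ (Z ⊗ b) ⊗≫ 𝟙 _ := by
      rw [whisker_exchange]
    _ = _ := by
      dsimp only [conjMu, a, b]; monoidal

lemma conjMu_natural_right (Z : C) {X Y : C} (f : X ⟶ Y) :
    (g.obj ⊗ (Z ⊗ g.objᘁ)) ◁ (g.obj ◁ (f ▷ g.objᘁ)) ≫ g.conjMu Z Y =
      g.conjMu Z X ≫ g.obj ◁ ((Z ◁ f) ▷ g.objᘁ) := by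
  let a := g.obj
  let b := g.objᘁ
  calc
    _ = 𝟙 _ ⊗≫ (a ⊗ Z) ◁ ((b ⊗ a) ◁ f ≫ ε_ a b ▷ Y) ▷ b ⊗≫ 𝟙 _ := by
      dsimp only [conjMu, a, b]; monoidal
    _ = 𝟙 _ ⊗≫ (a ⊗ Z) ◁ (ε_ a b ▷ X ≫ 𝟙_ C ◁ f) ▷ b ⊗≫ 𝟙 _ := by
      rw [whisker_exchange]
    _ = _ := by
      dsimp only [conjMu, a, b]; monoidal

/-- The monoidal structure of `X ↦ g ⊗ X ⊗ g*`. -/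
noncomputable def conjCore : (g.conjFunctor).CoreMonoidal where
  εIso := @asIso _ _ _ _ g.conjEps g.isIso_conjEps
  μIso X Y := @asIso _ _ _ _ (g.conjMu X Y) (g.isIso_conjMu X Y)
  μIso_hom_natural_left f Z := g.conjMu_natural_left f Z
  μIso_hom_natural_right Z f := g.conjMu_natural_right Z f
  associativity := g.conj_associativity
  left_unitality := g.conj_left_unitality
  right_unitality := g.conj_right_unitality

noncomputable instance : (g.conjFunctor).Monoidal := g.conjCore.toMonoidal

lemma conjFunctor_μ (X Y : C) : Functor.LaxMonoidal.μ g.conjFunctor X Y = g.conjMu X Y := by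
  rfl

lemma conjFunctor_ε : Functor.LaxMonoidal.ε g.conjFunctor = g.conjEps := by
  rfl

instance isEquivalence_conjFunctor : (g.conjFunctor).IsEquivalence := by
  have := g.isEquivalence_tensorLeft
  have : (tensorRight g.objᘁ).IsEquivalence := by
    let e : C ≌ C := CategoryTheory.Equivalence.mk (tensorRight g.objᘁ) (tensorRight g.obj)
      ((rightUnitorNatIso C).symm ≪≫
        (tensoringRight C).mapIso (asIso (ε_ g.obj g.objᘁ)).symm ≪≫ tensorRightTensor _ _)
      ((tensorRightTensor _ _).symm ≪≫
        (tensoringRight C).mapIso (asIso (η_ g.obj g.objᘁ)).symm ≪≫ rightUnitorNatIso C)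
    exact e.isEquivalence_functor
  exact inferInstanceAs ((tensorRight g.objᘁ ⋙ tensorLeft g.obj).IsEquivalence)

/-- The isomorphism `(φ⁻¹)* : g* ≅ h*` attached to an isomorphism `φ : g ≅ h`. -/
@[simps] def dualIso {g h : InvObj C} (φ : g.obj ≅ h.obj) : g.objᘁ ≅ h.objᘁ where
  hom := (φ.inv)ᘁ
  inv := (φ.hom)ᘁ
  hom_inv_id := by rw [← comp_rightAdjointMate]; simp
  inv_hom_id := by rw [← comp_rightAdjointMate]; simp

/-- The natural isomorphism `F_g ≅ F_h` attached to an isomorphism `φ : g ≅ h`, with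
components `φ ⊗ id ⊗ (φ⁻¹)*`. -/
def conjMap {g h : InvObj C} (φ : g.obj ≅ h.obj) :
    g.conjFunctor ≅ h.conjFunctor :=
  NatIso.ofComponents
    (fun X => (φ ⊗ᵢ whiskerLeftIso X (dualIso φ) : g.obj ⊗ (X ⊗ g.objᘁ) ≅ h.obj ⊗ (X ⊗ h.objᘁ)))
    (fun {X Y} f => by
      change g.obj ◁ (f ▷ g.objᘁ) ≫ (φ.hom ⊗ₘ (Y ◁ (φ.inv)ᘁ)) =
        (φ.hom ⊗ₘ (X ◁ (φ.inv)ᘁ)) ≫ h.obj ◁ (f ▷ h.objᘁ)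
      rw [MonoidalCategory.tensorHom_def', MonoidalCategory.tensorHom_def',
        ← MonoidalCategory.whiskerLeft_comp_assoc, Category.assoc, ← whisker_exchange,
        ← whisker_exchange, MonoidalCategory.whiskerLeft_comp, Category.assoc])

lemma conjMap_hom_app {g h : InvObj C} (φ : g.obj ≅ h.obj) (X : C) :
    (conjMap φ).hom.app X = (φ.hom ⊗ₘ (X ◁ (φ.inv)ᘁ)) := rfl

lemma conjEps_conjMap {g h : InvObj C} (φ : g.obj ≅ h.obj) :
    g.conjEps ≫ (φ.hom ⊗ₘ (𝟙_ C ◁ (φ.inv)ᘁ)) = h.conjEps := by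
  have e := coevaluation_comp_rightAdjointMate φ.inv
  calc
    _ = (η_ g.obj g.objᘁ ≫ g.obj ◁ (φ.inv)ᘁ) ≫ φ.hom ▷ h.objᘁ ⊗≫
        𝟙 (h.obj ⊗ (𝟙_ C ⊗ h.objᘁ)) := by
      rw [MonoidalCategory.tensorHom_def']
      dsimp only [conjEps]; monoidal
    _ = _ := by
      rw [e]
      simp [conjEps, monoidalComp, ← comp_whiskerRight_assoc]

lemma conjMu_conjMap {g h : InvObj C} (φ : g.obj ≅ h.obj) (X Y : C) :
    g.conjMu X Y ≫ (φ.hom ⊗ₘ ((X ⊗ Y) ◁ (φ.inv)ᘁ)) =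
      ((φ.hom ⊗ₘ (X ◁ (φ.inv)ᘁ)) ⊗ₘ (φ.hom ⊗ₘ (Y ◁ (φ.inv)ᘁ))) ≫ h.conjMu X Y := by
  have e := rightAdjointMate_comp_evaluation φ.inv
  have e' : g.objᘁ ◁ φ.hom ≫ (φ.inv)ᘁ ▷ h.obj ≫ ε_ h.obj h.objᘁ = ε_ g.obj g.objᘁ := by
    rw [e, ← MonoidalCategory.whiskerLeft_comp_assoc]; simp
  symm
  let b := h.objᘁ
  let c := (φ.inv)ᘁ
  calc
    ((φ.hom ⊗ₘ (X ◁ (φ.inv)ᘁ)) ⊗ₘ (φ.hom ⊗ₘ (Y ◁ (φ.inv)ᘁ))) ≫ h.conjMu X Y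
      = 𝟙 _ ⊗≫ φ.hom ▷ ((X ⊗ g.objᘁ) ⊗ g.obj ⊗ Y ⊗ g.objᘁ)
        ⊗≫ (h.obj ⊗ X) ◁ (c ▷ g.obj ≫ b ◁ φ.hom) ▷ (Y ⊗ g.objᘁ)
        ⊗≫ (h.obj ⊗ X) ◁ ((b ⊗ h.obj) ◁ (Y ◁ c) ≫ ε_ h.obj b ▷ (Y ⊗ b))
        ⊗≫ 𝟙 (h.obj ⊗ ((X ⊗ Y) ⊗ h.objᘁ)) := by
      rw [MonoidalCategory.tensorHom_def (φ.hom ⊗ₘ (X ◁ (φ.inv)ᘁ)),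
        MonoidalCategory.tensorHom_def φ.hom, MonoidalCategory.tensorHom_def φ.hom]
      dsimp only [conjMu, b, c]; monoidal
    _ = 𝟙 _ ⊗≫ φ.hom ▷ ((X ⊗ g.objᘁ) ⊗ g.obj ⊗ Y ⊗ g.objᘁ)
        ⊗≫ (h.obj ⊗ X) ◁ (g.objᘁ ◁ φ.hom ≫ c ▷ h.obj ≫ ε_ h.obj b) ▷ (Y ⊗ g.objᘁ)
        ⊗≫ (h.obj ⊗ X) ◁ (Y ◁ c) ⊗≫ 𝟙 (h.obj ⊗ ((X ⊗ Y) ⊗ h.objᘁ)) := by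
      rw [whisker_exchange _ (Y ◁ c), ← whisker_exchange c φ.hom]; monoidal
    _ = 𝟙 _ ⊗≫ φ.hom ▷ ((X ⊗ g.objᘁ) ⊗ g.obj ⊗ Y ⊗ g.objᘁ)
        ⊗≫ (h.obj ⊗ X) ◁ ε_ g.obj g.objᘁ ▷ (Y ⊗ g.objᘁ)
        ⊗≫ (h.obj ⊗ X) ◁ (Y ◁ c) ⊗≫ 𝟙 (h.obj ⊗ ((X ⊗ Y) ⊗ h.objᘁ)) := by
      dsimp only [b, c]
      rw [e']
    _ = 𝟙 _ ⊗≫ (φ.hom ▷ (X ⊗ (g.objᘁ ⊗ g.obj)) ≫ h.obj ◁ (X ◁ ε_ g.obj g.objᘁ)) ▷ (Y ⊗ g.objᘁ)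
        ⊗≫ (h.obj ⊗ X) ◁ (Y ◁ c) ⊗≫ 𝟙 (h.obj ⊗ ((X ⊗ Y) ⊗ h.objᘁ)) := by
      monoidal
    _ = _ := by
      rw [← whisker_exchange, MonoidalCategory.tensorHom_def]
      dsimp only [conjMu, b, c]; monoidal

lemma isMonoidal_conjMap {g h : InvObj C} (φ : g.obj ≅ h.obj) :
    NatTrans.IsMonoidal (conjMap φ).hom where
  unit := conjEps_conjMap φ
  tensor X Y := conjMu_conjMap φ X Y

end InvObj

end Conjugation

section ConjugationFunctor

variable {C : Type u} [Category.{v} C] [Abelian C] [Linear ℂ C] [MonoidalCategory C]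
  [MonoidalPreadditive C] [MonoidalLinear ℂ C] [RightRigidCategory C]

/-- The tensor autoequivalence `F_g(X) = g ⊗ X ⊗ g*` attached to an invertible object `g`. -/
@[simps functor] noncomputable def InvObj.conj (g : InvObj C) : TensorAut C where
  functor := g.conjFunctor
  additive :=
    { map_add := fun {X Y f f'} => by
        change g.obj ◁ ((f + f') ▷ g.objᘁ) = g.obj ◁ (f ▷ g.objᘁ) + g.obj ◁ (f' ▷ g.objᘁ)
        rw [MonoidalPreadditive.add_whiskerRight, MonoidalPreadditive.whiskerLeft_add] }
  linear :=
    { map_smul := fun f r => by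
        change g.obj ◁ ((r • f) ▷ g.objᘁ) = r • (g.obj ◁ (f ▷ g.objᘁ))
        rw [MonoidalLinear.smul_whiskerRight, MonoidalLinear.whiskerLeft_smul] }

variable (C) in
/-- The functor `g ↦ F_g` from invertible objects to tensor autoequivalences. -/
noncomputable def conjugation : InvObj C ⥤ TensorAut C where
  obj g := g.conj
  map {g h} φ := (
    { iso := InvObj.conjMap (InvObj.Hom.iso φ), isMonoidal := InvObj.isMonoidal_conjMap _ } :
      TensorAut.Hom g.conj h.conj)
  map_id g := by
    ext X
    change (𝟙 g.obj ⊗ₘ (X ◁ ((𝟙 g.obj)ᘁ))) = 𝟙 _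
    rw [rightAdjointMate_id]
    simp
  map_comp φ ψ := by
    ext X
    change ((InvObj.Hom.iso φ).hom ≫ (InvObj.Hom.iso ψ).hom ⊗ₘ
      (X ◁ (((InvObj.Hom.iso ψ).inv ≫ (InvObj.Hom.iso φ).inv)ᘁ))) = (_ ⊗ₘ _) ≫ (_ ⊗ₘ _)
    rw [comp_rightAdjointMate, MonoidalCategory.whiskerLeft_comp,
      MonoidalCategory.tensorHom_comp_tensorHom]
    rfl

end ConjugationFunctor

open scoped MonoidalLeftAction MonoidalRightAction

section Bilinear

/-- A functor `A ⥤ B ⥤ D` between `ℂ`-linear categories which is `ℂ`-linear in each variable. -/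
structure IsBilinear {A B D : Type*} [Category A] [Category B] [Category D]
    [Preadditive A] [Preadditive B] [Preadditive D] [Linear ℂ A] [Linear ℂ B] [Linear ℂ D]
    (T : A ⥤ B ⥤ D) : Prop where
  additive_right : ∀ a, (T.obj a).Additive
  linear_right : ∀ a, (T.obj a).Linear ℂ
  additive_left : ∀ b, (T.flip.obj b).Additive
  linear_left : ∀ b, (T.flip.obj b).Linear ℂ

end Bilinear

section Bimodules

variable (C : Type u) [Category.{v} C] [Abelian C] [Linear ℂ C] [MonoidalCategory C]

/-- A (finite semisimple) `C`-`C`-bimodule category: a finite semisimple `ℂ`-linear category with a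
left and a right action of `C`, both bilinear, and a coherent natural isomorphism
`(X ⊗ m) ⊗ Y ≅ X ⊗ (m ⊗ Y)` between the two ways of acting on both sides. -/
structure Bimod where
  carrier : Type u
  [category : Category.{v} carrier]
  [abelian : Abelian carrier]
  [linear : Linear ℂ carrier]
  [semisimple : FiniteSemisimple carrier]
  [left : MonoidalLeftAction C carrier]
  [right : MonoidalRightAction C carrier]
  left_bilinear : IsBilinear (MonoidalLeftAction.curriedAction C carrier)
  right_bilinear : IsBilinear (MonoidalRightAction.curriedAction C carrier)
  middle (X : C) (m : carrier) (Y : C) : (X ⊙ₗ m) ⊙ᵣ Y ≅ X ⊙ₗ (m ⊙ᵣ Y)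
  middle_natural_left {X X' : C} (f : X ⟶ X') (m : carrier) (Y : C) :
    (f ⊵ₗ m) ⊵ᵣ Y ≫ (middle X' m Y).hom = (middle X m Y).hom ≫ f ⊵ₗ (m ⊙ᵣ Y)
  middle_natural (X : C) {m m' : carrier} (f : m ⟶ m') (Y : C) :
    (X ⊴ₗ f) ⊵ᵣ Y ≫ (middle X m' Y).hom = (middle X m Y).hom ≫ X ⊴ₗ (f ⊵ᵣ Y)
  middle_natural_right (X : C) (m : carrier) {Y Y' : C} (f : Y ⟶ Y') :
    (X ⊙ₗ m) ⊴ᵣ f ≫ (middle X m Y').hom = (middle X m Y).hom ≫ X ⊴ₗ (m ⊴ᵣ f)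
  middle_left_assoc (X X' : C) (m : carrier) (Y : C) :
    (middle (X ⊗ X') m Y).hom ≫ (αₗ X X' (m ⊙ᵣ Y)).hom =
      (αₗ X X' m).hom ⊵ᵣ Y ≫ (middle X (X' ⊙ₗ m) Y).hom ≫ X ⊴ₗ (middle X' m Y).hom
  middle_right_assoc (X : C) (m : carrier) (Y Y' : C) :
    (middle X m (Y ⊗ Y')).hom ≫ X ⊴ₗ (αᵣ m Y Y').hom =
      (αᵣ (X ⊙ₗ m) Y Y').hom ≫ (middle X m Y).hom ⊵ᵣ Y' ≫ (middle X (m ⊙ᵣ Y) Y').hom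
  middle_left_unit (m : carrier) (Y : C) :
    (middle (𝟙_ C) m Y).hom ≫ (λₗ (m ⊙ᵣ Y)).hom = (λₗ m).hom ⊵ᵣ Y
  middle_right_unit (X : C) (m : carrier) :
    (middle X m (𝟙_ C)).hom ≫ X ⊴ₗ (ρᵣ m).hom = (ρᵣ (X ⊙ₗ m)).hom

namespace Bimod

attribute [instance] category abelian linear semisimple left right

variable {C}

/-- An equivalence of `C`-`C`-bimodule categories: a `ℂ`-linear equivalence of categories together
with isomorphisms `F (X ⊗ m) ≅ X ⊗ F m` and `F (m ⊗ Y) ≅ F m ⊗ Y`, natural in all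
variables and compatible with the associativity and unit isomorphisms of the left action, of the
right action, and with the isomorphisms `(X ⊗ m) ⊗ Y ≅ X ⊗ (m ⊗ Y)`. -/
structure Hom (M N : Bimod.{v, u} C) where
  functor : M.carrier ⥤ N.carrier
  [additive : functor.Additive]
  [linear : functor.Linear ℂ]
  [isEquivalence : functor.IsEquivalence]
  left (X : C) (m : M.carrier) : functor.obj (X ⊙ₗ m) ≅ X ⊙ₗ functor.obj m
  right (m : M.carrier) (Y : C) : functor.obj (m ⊙ᵣ Y) ≅ functor.obj m ⊙ᵣ Y
  left_natural_left {X X' : C} (f : X ⟶ X') (m : M.carrier) :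
    functor.map (f ⊵ₗ m) ≫ (left X' m).hom = (left X m).hom ≫ f ⊵ₗ functor.obj m
  left_natural (X : C) {m m' : M.carrier} (f : m ⟶ m') :
    functor.map (X ⊴ₗ f) ≫ (left X m').hom = (left X m).hom ≫ X ⊴ₗ functor.map f
  right_natural {m m' : M.carrier} (f : m ⟶ m') (Y : C) :
    functor.map (f ⊵ᵣ Y) ≫ (right m' Y).hom = (right m Y).hom ≫ functor.map f ⊵ᵣ Y
  right_natural_right (m : M.carrier) {Y Y' : C} (f : Y ⟶ Y') :
    functor.map (m ⊴ᵣ f) ≫ (right m Y').hom = (right m Y).hom ≫ functor.obj m ⊴ᵣ f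
  left_assoc (X X' : C) (m : M.carrier) :
    functor.map (αₗ X X' m).hom ≫ (left X (X' ⊙ₗ m)).hom ≫ X ⊴ₗ (left X' m).hom =
      (left (X ⊗ X') m).hom ≫ (αₗ X X' (functor.obj m)).hom
  right_assoc (m : M.carrier) (Y Y' : C) :
    functor.map (αᵣ m Y Y').hom ≫ (right (m ⊙ᵣ Y) Y').hom ≫ (right m Y).hom ⊵ᵣ Y' =
      (right m (Y ⊗ Y')).hom ≫ (αᵣ (functor.obj m) Y Y').hom
  left_unit (m : M.carrier) :
    (left (𝟙_ C) m).hom ≫ (λₗ (functor.obj m)).hom = functor.map (λₗ m).hom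
  right_unit (m : M.carrier) :
    (right m (𝟙_ C)).hom ≫ (ρᵣ (functor.obj m)).hom = functor.map (ρᵣ m).hom
  middle (X : C) (m : M.carrier) (Y : C) :
    functor.map (M.middle X m Y).hom ≫ (left X (m ⊙ᵣ Y)).hom ≫ X ⊴ₗ (right m Y).hom =
      (right (X ⊙ₗ m) Y).hom ≫ (left X m).hom ⊵ᵣ Y ≫ (N.middle X (functor.obj m) Y).hom

attribute [instance] Hom.additive Hom.linear Hom.isEquivalence

/-- An isomorphism of equivalences of bimodule categories: a natural isomorphism compatible with the
left and right actions. -/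
structure Hom₂ {M N : Bimod.{v, u} C} (F G : Hom M N) where
  iso : F.functor ≅ G.functor
  left (X : C) (m : M.carrier) :
    iso.hom.app (X ⊙ₗ m) ≫ (G.left X m).hom = (F.left X m).hom ≫ X ⊴ₗ iso.hom.app m
  right (m : M.carrier) (Y : C) :
    iso.hom.app (m ⊙ᵣ Y) ≫ (G.right m Y).hom = (F.right m Y).hom ≫ iso.hom.app m ⊵ᵣ Y

@[ext] lemma Hom₂.ext' {M N : Bimod.{v, u} C} {F G : Hom M N} {a b : Hom₂ F G}
    (w : ∀ m, a.iso.hom.app m = b.iso.hom.app m) : a = b := by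
  obtain ⟨a, _, _⟩ := a
  obtain ⟨b, _, _⟩ := b
  obtain rfl : a = b := by ext m; exact w m
  rfl

instance homCategory (M N : Bimod.{v, u} C) : Category (Hom M N) where
  Hom := Hom₂
  id F := { iso := Iso.refl _, left := by simp, right := by simp }
  comp a b :=
    { iso := a.iso ≪≫ b.iso
      left X m := by
        have h₁ := a.left X m
        have h₂ := b.left X m
        simp only [Iso.trans_hom, NatTrans.comp_app, Category.assoc,
          MonoidalLeftAction.actionHomRight_comp, h₂]
        rw [← Category.assoc, h₁, Category.assoc]
      right m Y := by
        have h₁ := a.right m Y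
        have h₂ := b.right m Y
        simp only [Iso.trans_hom, NatTrans.comp_app, Category.assoc,
          MonoidalRightAction.comp_actionHomLeft, h₂]
        rw [← Category.assoc, h₁, Category.assoc] }

@[simp] lemma id₂_app {M N : Bimod.{v, u} C} (F : Hom M N) (m : M.carrier) :
    (Hom₂.iso (𝟙 F)).hom.app m = 𝟙 _ := rfl

@[simp] lemma comp₂_app {M N : Bimod.{v, u} C} {F G H : Hom M N} (a : F ⟶ G) (b : G ⟶ H)
    (m : M.carrier) :
    (Hom₂.iso (a ≫ b)).hom.app m = (Hom₂.iso a).hom.app m ≫ (Hom₂.iso b).hom.app m := rfl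

@[ext] lemma hom₂_ext {M N : Bimod.{v, u} C} {F G : Hom M N} {a b : F ⟶ G}
    (w : ∀ m, (Hom₂.iso a).hom.app m = (Hom₂.iso b).hom.app m) : a = b :=
  Hom₂.ext' w

/-- The inverse of an isomorphism of equivalences of bimodule categories. -/
def Hom₂.symm {M N : Bimod.{v, u} C} {F G : Hom M N} (a : Hom₂ F G) : Hom₂ G F where
  iso := a.iso.symm
  left X m := by
    have h := a.left X m
    change a.iso.inv.app _ ≫ _ = _ ≫ X ⊴ₗ a.iso.inv.app _
    rw [← cancel_epi (a.iso.hom.app (X ⊙ₗ m)), reassoc_of% h, Iso.hom_inv_id_app_assoc,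
      ← MonoidalLeftAction.actionHomRight_comp]
    simp
  right m Y := by
    have h := a.right m Y
    change a.iso.inv.app _ ≫ _ = _ ≫ a.iso.inv.app _ ⊵ᵣ Y
    rw [← cancel_epi (a.iso.hom.app (m ⊙ᵣ Y)), reassoc_of% h, Iso.hom_inv_id_app_assoc,
      ← MonoidalRightAction.comp_actionHomLeft]
    simp

/-- An isomorphism of equivalences of bimodule categories is invertible. -/
def Hom₂.toIso {M N : Bimod.{v, u} C} {F G : Hom M N} (a : Hom₂ F G) : F ≅ G where
  hom := a
  inv := a.symm
  hom_inv_id := by ext m; exact a.iso.hom_inv_id_app m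
  inv_hom_id := by ext m; exact a.iso.inv_hom_id_app m

/-- The identity bimodule equivalence. -/
def Hom.id (M : Bimod.{v, u} C) : Hom M M where
  functor := 𝟭 _
  left _ _ := Iso.refl _
  right _ _ := Iso.refl _
  left_natural_left := by simp
  left_natural := by simp
  right_natural := by simp
  right_natural_right := by simp
  left_assoc := by simp
  right_assoc := by simp
  left_unit := by simp
  right_unit := by simp
  middle := by simp

/-- The composition of bimodule equivalences. -/
def Hom.comp {M N P : Bimod.{v, u} C} (F : Hom M N) (G : Hom N P) :
    Hom M P where
  functor := F.functor ⋙ G.functor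
  isEquivalence := inferInstance
  left X m := G.functor.mapIso (F.left X m) ≪≫ G.left X _
  right m Y := G.functor.mapIso (F.right m Y) ≪≫ G.right _ Y
  left_natural_left {X X'} f m := by
    have h := F.left_natural_left f m
    simp only [Functor.comp_obj, Functor.comp_map, Iso.trans_hom, Functor.mapIso_hom,
      Category.assoc, ← G.left_natural_left, ← Functor.map_comp_assoc, h]
  left_natural X m m' f := by
    have h := F.left_natural X f
    simp only [Functor.comp_obj, Functor.comp_map, Iso.trans_hom, Functor.mapIso_hom,
      Category.assoc, ← G.left_natural, ← Functor.map_comp_assoc, h]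
  right_natural {m m'} f Y := by
    have h := F.right_natural f Y
    simp only [Functor.comp_obj, Functor.comp_map, Iso.trans_hom, Functor.mapIso_hom,
      Category.assoc, ← G.right_natural, ← Functor.map_comp_assoc, h]
  right_natural_right m Y Y' f := by
    have h := F.right_natural_right m f
    simp only [Functor.comp_obj, Functor.comp_map, Iso.trans_hom, Functor.mapIso_hom,
      Category.assoc, ← G.right_natural_right, ← Functor.map_comp_assoc, h]
  left_assoc X X' m := by
    have h := F.left_assoc X X' m
    have h' := G.left_assoc X X' (F.functor.obj m)
    have h'' := G.left_natural X (F.left X' m).hom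
    simp only [Functor.comp_obj, Functor.comp_map, Iso.trans_hom, Functor.mapIso_hom,
      Category.assoc, MonoidalLeftAction.actionHomRight_comp, ← h', ← reassoc_of% h'',
      ← Functor.map_comp_assoc, ← h]
  right_assoc m Y Y' := by
    have h := F.right_assoc m Y Y'
    have h' := G.right_assoc (F.functor.obj m) Y Y'
    have h'' := G.right_natural (F.right m Y).hom Y'
    simp only [Functor.comp_obj, Functor.comp_map, Iso.trans_hom, Functor.mapIso_hom,
      Category.assoc, MonoidalRightAction.comp_actionHomLeft, ← h', ← reassoc_of% h'',
      ← Functor.map_comp_assoc, ← h]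
  left_unit m := by
    simp only [Functor.comp_obj, Functor.comp_map, Iso.trans_hom, Functor.mapIso_hom,
      Category.assoc, G.left_unit, ← Functor.map_comp, F.left_unit]
  right_unit m := by
    simp only [Functor.comp_obj, Functor.comp_map, Iso.trans_hom, Functor.mapIso_hom,
      Category.assoc, G.right_unit, ← Functor.map_comp, F.right_unit]
  middle X m Y := by
    have h := F.middle X m Y
    have h' := G.middle X (F.functor.obj m) Y
    have h₁ := G.left_natural X (F.right m Y).hom
    have h₂ := G.right_natural (F.left X m).hom Y
    simp only [Functor.comp_obj, Functor.comp_map, Iso.trans_hom, Functor.mapIso_hom,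
      Category.assoc, MonoidalRightAction.comp_actionHomLeft,
      MonoidalLeftAction.actionHomRight_comp]
    rw [← reassoc_of% h₁, ← reassoc_of% h₂, ← h']
    simp only [← Functor.map_comp_assoc, h]

/-- Left whiskering of isomorphisms of bimodule equivalences. -/
def whiskerLeft {M N P : Bimod.{v, u} C} (F : Hom M N) {G H : Hom N P} (a : Hom₂ G H) :
    Hom₂ (F.comp G) (F.comp H) where
  iso := Functor.isoWhiskerLeft F.functor a.iso
  left X m := by
    change a.iso.hom.app _ ≫ H.functor.map _ ≫ (H.left _ _).hom =
      (G.functor.map _ ≫ (G.left _ _).hom) ≫ _ ⊴ₗ a.iso.hom.app _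
    rw [Category.assoc, ← a.left, NatTrans.naturality_assoc]
  right m Y := by
    change a.iso.hom.app _ ≫ H.functor.map _ ≫ (H.right _ _).hom =
      (G.functor.map _ ≫ (G.right _ _).hom) ≫ a.iso.hom.app _ ⊵ᵣ _
    rw [Category.assoc, ← a.right, NatTrans.naturality_assoc]

/-- Right whiskering of isomorphisms of bimodule equivalences. -/
def whiskerRight {M N P : Bimod.{v, u} C} {F G : Hom M N} (a : Hom₂ F G) (H : Hom N P) :
    Hom₂ (F.comp H) (G.comp H) where
  iso := Functor.isoWhiskerRight a.iso H.functor
  left X m := by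
    change H.functor.map (a.iso.hom.app _) ≫ H.functor.map _ ≫ (H.left _ _).hom =
      (H.functor.map _ ≫ (H.left _ _).hom) ≫ _ ⊴ₗ H.functor.map (a.iso.hom.app _)
    rw [Category.assoc, ← H.left_natural, ← Functor.map_comp_assoc, ← Functor.map_comp_assoc,
      a.left]
  right m Y := by
    change H.functor.map (a.iso.hom.app _) ≫ H.functor.map _ ≫ (H.right _ _).hom =
      (H.functor.map _ ≫ (H.right _ _).hom) ≫ H.functor.map (a.iso.hom.app _) ⊵ᵣ _
    rw [Category.assoc, ← H.right_natural, ← Functor.map_comp_assoc, ← Functor.map_comp_assoc,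
      a.right]

/-- The associativity isomorphism for the composition of bimodule equivalences. -/
def associator {M N P Q : Bimod.{v, u} C} (F : Hom M N) (G : Hom N P) (H : Hom P Q) :
    Hom₂ ((F.comp G).comp H) (F.comp (G.comp H)) where
  iso := Functor.associator F.functor G.functor H.functor
  left X m := by simp [Hom.comp]
  right m Y := by simp [Hom.comp]

/-- The left unit isomorphism for the composition of bimodule equivalences. -/
def leftUnitor {M N : Bimod.{v, u} C} (F : Hom M N) : Hom₂ ((Hom.id M).comp F) F where
  iso := Functor.leftUnitor F.functor
  left X m := by simp [Hom.comp, Hom.id]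
  right m Y := by simp [Hom.comp, Hom.id]

/-- The right unit isomorphism for the composition of bimodule equivalences. -/
def rightUnitor {M N : Bimod.{v, u} C} (F : Hom M N) : Hom₂ (F.comp (Hom.id N)) F where
  iso := Functor.rightUnitor F.functor
  left X m := by simp [Hom.comp, Hom.id]
  right m Y := by simp [Hom.comp, Hom.id]

/-- The bicategory of bimodule categories, bimodule equivalences and isomorphisms of these. -/
instance : Bicategory (Bimod.{v, u} C) where
  Hom := Hom
  id := Hom.id
  comp := Hom.comp
  homCategory := homCategory
  whiskerLeft F _ _ a := whiskerLeft F a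
  whiskerRight a H := whiskerRight a H
  associator F G H := (associator F G H).toIso
  leftUnitor F := (leftUnitor F).toIso
  rightUnitor F := (rightUnitor F).toIso
  whiskerLeft_id _ _ := by ext m; rfl
  whiskerLeft_comp _ _ _ _ _ _ := by ext m; rfl
  id_whiskerLeft _ := by
    ext m; exact ((Category.id_comp _).trans (Category.comp_id _)).symm
  comp_whiskerLeft _ _ _ _ _ := by
    ext m; exact ((Category.id_comp _).trans (Category.comp_id _)).symm
  id_whiskerRight F G := by ext m; exact G.functor.map_id _
  comp_whiskerRight _ _ H := by ext m; exact H.functor.map_comp _ _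
  whiskerRight_id _ := by
    ext m; exact ((Category.id_comp _).trans (Category.comp_id _)).symm
  whiskerRight_comp _ _ _ := by
    ext m; exact ((Category.id_comp _).trans (Category.comp_id _)).symm
  whisker_assoc _ _ _ _ _ := by
    ext m; exact ((Category.id_comp _).trans (Category.comp_id _)).symm
  whisker_exchange a b := by
    ext m; exact (b.iso.hom.naturality _).symm
  pentagon F G H K := by
    ext m
    refine (congrArg (fun t => t ≫ (𝟙 _ ≫ 𝟙 _)) (K.functor.map_id _)).trans ?_
    exact (Category.id_comp _)
  triangle F G := by
    ext m
    refine (Category.id_comp _).trans ?_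
    exact (G.functor.map_id _).symm

section lemmas

variable {M N P : Bimod.{v, u} C} (F : M ⟶ N) (G : N ⟶ P)

@[simp] lemma id_functor : Hom.functor (𝟙 M) = 𝟭 _ := rfl
@[simp] lemma comp_functor : Hom.functor (F ≫ G) = Hom.functor F ⋙ Hom.functor G := rfl
@[simp] lemma id_left (X : C) (m : M.carrier) : Hom.left (𝟙 M) X m = Iso.refl _ := rfl
@[simp] lemma id_right (m : M.carrier) (Y : C) : Hom.right (𝟙 M) m Y = Iso.refl _ := rfl
@[simp] lemma comp_left (X : C) (m : M.carrier) :
    Hom.left (F ≫ G) X m = (Hom.functor G).mapIso (Hom.left F X m) ≪≫ Hom.left G X _ := rfl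
@[simp] lemma comp_right (m : M.carrier) (Y : C) :
    Hom.right (F ≫ G) m Y = (Hom.functor G).mapIso (Hom.right F m Y) ≪≫ Hom.right G _ Y := rfl

end lemmas

section lemmas₂

variable {M N P Q : Bimod.{v, u} C}

@[simp] lemma whiskerLeft_app (F : M ⟶ N) {G H : N ⟶ P} (a : G ⟶ H) (m : M.carrier) :
    (Hom₂.iso (Bicategory.whiskerLeft F a)).hom.app m =
      (Hom₂.iso a).hom.app ((Hom.functor F).obj m) := rfl
@[simp] lemma whiskerRight_app {F G : M ⟶ N} (a : F ⟶ G) (H : N ⟶ P) (m : M.carrier) :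
    (Hom₂.iso (Bicategory.whiskerRight a H)).hom.app m =
      (Hom.functor H).map ((Hom₂.iso a).hom.app m) := rfl
@[simp] lemma associator_hom_app (F : M ⟶ N) (G : N ⟶ P) (H : P ⟶ Q) (m : M.carrier) :
    (Hom₂.iso (Bicategory.associator F G H).hom).hom.app m = 𝟙 _ := rfl
@[simp] lemma leftUnitor_hom_app (F : M ⟶ N) (m : M.carrier) :
    (Hom₂.iso (Bicategory.leftUnitor F).hom).hom.app m = 𝟙 _ := rfl
@[simp] lemma rightUnitor_hom_app (F : M ⟶ N) (m : M.carrier) :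
    (Hom₂.iso (Bicategory.rightUnitor F).hom).hom.app m = 𝟙 _ := rfl

end lemmas₂

end Bimod

end Bimodules

section TensorProducts

variable {C : Type u} [Category.{v} C] [Abelian C] [Linear ℂ C] [MonoidalCategory C]

/-- A `C`-balanced functor from `M × N` to a `ℂ`-linear category `A`: a bilinear functor together
with coherent natural isomorphisms `B (m ⊗ X, n) ≅ B (m, X ⊗ n)`. -/
structure Balanced (M N : Bimod.{v, u} C) (A : Type u) [Category.{v} A] [Preadditive A]
    [Linear ℂ A] where
  bifunctor : M.carrier ⥤ N.carrier ⥤ A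
  bilinear : IsBilinear bifunctor
  bal (m : M.carrier) (X : C) (n : N.carrier) :
    (bifunctor.obj (m ⊙ᵣ X)).obj n ≅ (bifunctor.obj m).obj (X ⊙ₗ n)
  bal_natural_left {m m' : M.carrier} (f : m ⟶ m') (X : C) (n : N.carrier) :
    (bifunctor.map (f ⊵ᵣ X)).app n ≫ (bal m' X n).hom =
      (bal m X n).hom ≫ (bifunctor.map f).app (X ⊙ₗ n)
  bal_natural (m : M.carrier) {X X' : C} (f : X ⟶ X') (n : N.carrier) :
    (bifunctor.map (m ⊴ᵣ f)).app n ≫ (bal m X' n).hom =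
      (bal m X n).hom ≫ (bifunctor.obj m).map (f ⊵ₗ n)
  bal_natural_right (m : M.carrier) (X : C) {n n' : N.carrier} (f : n ⟶ n') :
    (bifunctor.obj (m ⊙ᵣ X)).map f ≫ (bal m X n').hom =
      (bal m X n).hom ≫ (bifunctor.obj m).map (X ⊴ₗ f)
  bal_assoc (m : M.carrier) (X Y : C) (n : N.carrier) :
    (bal m (X ⊗ Y) n).hom ≫ (bifunctor.obj m).map (αₗ X Y n).hom =
      (bifunctor.map (αᵣ m X Y).hom).app n ≫ (bal (m ⊙ᵣ X) Y n).hom ≫ (bal m X (Y ⊙ₗ n)).hom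
  bal_unit (m : M.carrier) (n : N.carrier) :
    (bal m (𝟙_ C) n).hom ≫ (bifunctor.obj m).map (λₗ n).hom =
      (bifunctor.map (ρᵣ m).hom).app n

namespace Balanced

variable {M N : Bimod.{v, u} C}

section

variable {A : Type u} [Category.{v} A] [Preadditive A] [Linear ℂ A]

/-- The value `B (m, n)`. -/
abbrev val (B : Balanced M N A) (m : M.carrier) (n : N.carrier) : A := (B.bifunctor.obj m).obj n

/-- The morphism `B (f, n)`. -/
abbrev mapL (B : Balanced M N A) {m m' : M.carrier} (f : m ⟶ m') (n : N.carrier) :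
    B.val m n ⟶ B.val m' n := (B.bifunctor.map f).app n

/-- The morphism `B (m, f)`. -/
abbrev mapR (B : Balanced M N A) (m : M.carrier) {n n' : N.carrier} (f : n ⟶ n') :
    B.val m n ⟶ B.val m n' := (B.bifunctor.obj m).map f

/-- A morphism of balanced functors: a natural transformation compatible with the balancings. -/
structure Hom (S T : Balanced M N A) where
  trans : S.bifunctor ⟶ T.bifunctor
  bal (m : M.carrier) (X : C) (n : N.carrier) :
    (trans.app (m ⊙ᵣ X)).app n ≫ (T.bal m X n).hom =
      (S.bal m X n).hom ≫ (trans.app m).app (X ⊙ₗ n)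

instance : Category (Balanced M N A) where
  Hom := Hom
  id S := { trans := 𝟙 _, bal := by simp }
  comp a b :=
    { trans := a.trans ≫ b.trans
      bal m X n := by
        have h₁ := a.bal m X n
        have h₂ := b.bal m X n
        simp only [NatTrans.comp_app, Category.assoc, h₂]
        rw [← Category.assoc, h₁, Category.assoc] }

@[ext] lemma hom_ext {S T : Balanced M N A} {a b : S ⟶ T}
    (w : ∀ m n, ((Hom.trans a).app m).app n = ((Hom.trans b).app m).app n) : a = b := by
  obtain ⟨a, _⟩ : Hom S T := a
  obtain ⟨b, _⟩ : Hom S T := b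
  obtain rfl : a = b := by ext m n; exact w m n
  rfl

end

/-- The category of `ℂ`-linear functors. -/
abbrev LinearFunctors (A D : Type u) [Category.{v} A] [Preadditive A] [Linear ℂ A]
    [Category.{v} D] [Preadditive D] [Linear ℂ D] :=
  ObjectProperty.FullSubcategory (fun G : A ⥤ D => G.Additive ∧ G.Linear ℂ)

/-- Composition of a balanced functor `M × N ⥤ A` with linear functors `A ⥤ D`. -/
def postcomp {A : Type u} [Category.{v} A] [Preadditive A] [Linear ℂ A] (B : Balanced M N A)
    (D : Type u) [Category.{v} D] [Preadditive D] [Linear ℂ D] :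
    LinearFunctors A D ⥤ Balanced M N D where
  obj G :=
    { bifunctor := B.bifunctor ⋙ (Functor.whiskeringRight _ _ _).obj G.obj
      bilinear := by
        have := G.property.1
        have := G.property.2
        refine ⟨fun a => ?_, fun a => ?_, fun b => ?_, fun b => ?_⟩
        · have := B.bilinear.additive_right a
          exact inferInstanceAs ((B.bifunctor.obj a ⋙ G.obj).Additive)
        · have := B.bilinear.additive_right a
          have := B.bilinear.linear_right a
          exact inferInstanceAs ((B.bifunctor.obj a ⋙ G.obj).Linear ℂ)
        · have := B.bilinear.additive_left b
          exact inferInstanceAs ((B.bifunctor.flip.obj b ⋙ G.obj).Additive)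
        · have := B.bilinear.additive_left b
          have := B.bilinear.linear_left b
          exact inferInstanceAs ((B.bifunctor.flip.obj b ⋙ G.obj).Linear ℂ)
      bal m X n := G.obj.mapIso (B.bal m X n)
      bal_natural_left f X n := by
        simpa using congrArg G.obj.map (B.bal_natural_left f X n)
      bal_natural m X X' f n := by
        simpa using congrArg G.obj.map (B.bal_natural m f n)
      bal_natural_right m X n n' f := by
        simpa using congrArg G.obj.map (B.bal_natural_right m X f)
      bal_assoc m X Y n := by
        simpa using congrArg G.obj.map (B.bal_assoc m X Y n)
      bal_unit m n := by
        simpa using congrArg G.obj.map (B.bal_unit m n) }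
  map σ :=
    { trans := Functor.whiskerLeft B.bifunctor ((Functor.whiskeringRight _ _ _).map σ.hom)
      bal m X n := by simp }

/-- A balanced functor `M × N ⥤ A` exhibits the abelian category `A` as the tensor product
`M ⊠_C N` if composition with it is an equivalence from linear functors `A ⥤ D` to balanced functors
`M × N ⥤ D`, for all `ℂ`-linear abelian categories `D`. -/
def IsUniversal {A : Type u} [Category.{v} A] [Preadditive A] [Linear ℂ A]
    (B : Balanced M N A) : Prop :=
  ∀ (D : Type u) [Category.{v} D] [Abelian D] [Linear ℂ D], (B.postcomp D).IsEquivalence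

end Balanced

/-- A balanced bimodule functor `M × N ⥤ P`: a balanced functor together with coherent natural
isomorphisms `B (X ⊗ m, n) ≅ X ⊗ B (m, n)` and `B (m, n ⊗ Y) ≅ B (m, n) ⊗ Y`; equivalently, a
bimodule functor `M ⊠_C N ⥤ P`. -/
structure Pairing (M N P : Bimod.{v, u} C) extends Balanced M N P.carrier where
  left (X : C) (m : M.carrier) (n : N.carrier) :
    toBalanced.val (X ⊙ₗ m) n ≅ X ⊙ₗ toBalanced.val m n
  right (m : M.carrier) (n : N.carrier) (Y : C) :
    toBalanced.val m (n ⊙ᵣ Y) ≅ toBalanced.val m n ⊙ᵣ Y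
  left_natural_left {X X' : C} (f : X ⟶ X') (m : M.carrier) (n : N.carrier) :
    toBalanced.mapL (f ⊵ₗ m) n ≫ (left X' m n).hom = (left X m n).hom ≫ f ⊵ₗ toBalanced.val m n
  left_natural (X : C) {m m' : M.carrier} (f : m ⟶ m') (n : N.carrier) :
    toBalanced.mapL (X ⊴ₗ f) n ≫ (left X m' n).hom = (left X m n).hom ≫ X ⊴ₗ toBalanced.mapL f n
  left_natural_right (X : C) (m : M.carrier) {n n' : N.carrier} (f : n ⟶ n') :
    toBalanced.mapR (X ⊙ₗ m) f ≫ (left X m n').hom = (left X m n).hom ≫ X ⊴ₗ toBalanced.mapR m f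
  right_natural_left {m m' : M.carrier} (f : m ⟶ m') (n : N.carrier) (Y : C) :
    toBalanced.mapL f (n ⊙ᵣ Y) ≫ (right m' n Y).hom = (right m n Y).hom ≫ toBalanced.mapL f n ⊵ᵣ Y
  right_natural (m : M.carrier) {n n' : N.carrier} (f : n ⟶ n') (Y : C) :
    toBalanced.mapR m (f ⊵ᵣ Y) ≫ (right m n' Y).hom = (right m n Y).hom ≫ toBalanced.mapR m f ⊵ᵣ Y
  right_natural_right (m : M.carrier) (n : N.carrier) {Y Y' : C} (f : Y ⟶ Y') :
    toBalanced.mapR m (n ⊴ᵣ f) ≫ (right m n Y').hom = (right m n Y).hom ≫ toBalanced.val m n ⊴ᵣ f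
  left_assoc (X X' : C) (m : M.carrier) (n : N.carrier) :
    toBalanced.mapL (αₗ X X' m).hom n ≫ (left X (X' ⊙ₗ m) n).hom ≫ X ⊴ₗ (left X' m n).hom =
      (left (X ⊗ X') m n).hom ≫ (αₗ X X' (toBalanced.val m n)).hom
  right_assoc (m : M.carrier) (n : N.carrier) (Y Y' : C) :
    toBalanced.mapR m (αᵣ n Y Y').hom ≫ (right m (n ⊙ᵣ Y) Y').hom ≫ (right m n Y).hom ⊵ᵣ Y' =
      (right m n (Y ⊗ Y')).hom ≫ (αᵣ (toBalanced.val m n) Y Y').hom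
  left_unit (m : M.carrier) (n : N.carrier) :
    (left (𝟙_ C) m n).hom ≫ (λₗ (toBalanced.val m n)).hom = toBalanced.mapL (λₗ m).hom n
  right_unit (m : M.carrier) (n : N.carrier) :
    (right m n (𝟙_ C)).hom ≫ (ρᵣ (toBalanced.val m n)).hom = toBalanced.mapR m (ρᵣ n).hom
  middle (X : C) (m : M.carrier) (n : N.carrier) (Y : C) :
    (right (X ⊙ₗ m) n Y).hom ≫ (left X m n).hom ⊵ᵣ Y ≫ (P.middle X (toBalanced.val m n) Y).hom =
      (left X m (n ⊙ᵣ Y)).hom ≫ X ⊴ₗ (right m n Y).hom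
  left_bal (X : C) (m : M.carrier) (Y : C) (n : N.carrier) :
    toBalanced.mapL (M.middle X m Y).hom n ≫ (left X (m ⊙ᵣ Y) n).hom ≫
        X ⊴ₗ (toBalanced.bal m Y n).hom =
      (toBalanced.bal (X ⊙ₗ m) Y n).hom ≫ (left X m (Y ⊙ₗ n)).hom
  right_bal (m : M.carrier) (X : C) (n : N.carrier) (Y : C) :
    (right (m ⊙ᵣ X) n Y).hom ≫ (toBalanced.bal m X n).hom ⊵ᵣ Y ≫ (right m (X ⊙ₗ n) Y).inv =
      (toBalanced.bal m X (n ⊙ᵣ Y)).hom ≫ toBalanced.mapR m (N.middle X n Y).inv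

/-- An isomorphism `h (B (m, n)) ≅ B' (f m, g n)` of balanced bimodule functors, where `f`, `g`, `h`
are bimodule equivalences. -/
structure Square {M N P M' N' P' : Bimod.{v, u} C} (f : M ⟶ M') (g : N ⟶ N') (h : P ⟶ P')
    (B : Pairing M N P) (B' : Pairing M' N' P') where
  iso (m : M.carrier) (n : N.carrier) :
    (Bimod.Hom.functor h).obj (B.val m n) ≅
      B'.val ((Bimod.Hom.functor f).obj m) ((Bimod.Hom.functor g).obj n)
  natural_left {m m' : M.carrier} (a : m ⟶ m') (n : N.carrier) :
    (Bimod.Hom.functor h).map (B.mapL a n) ≫ (iso m' n).hom =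
      (iso m n).hom ≫ B'.mapL ((Bimod.Hom.functor f).map a) _
  natural_right (m : M.carrier) {n n' : N.carrier} (a : n ⟶ n') :
    (Bimod.Hom.functor h).map (B.mapR m a) ≫ (iso m n').hom =
      (iso m n).hom ≫ B'.mapR _ ((Bimod.Hom.functor g).map a)
  bal (m : M.carrier) (X : C) (n : N.carrier) :
    (Bimod.Hom.functor h).map (B.bal m X n).hom ≫ (iso m (X ⊙ₗ n)).hom ≫
        B'.mapR _ (Bimod.Hom.left g X n).hom =
      (iso (m ⊙ᵣ X) n).hom ≫ B'.mapL (Bimod.Hom.right f m X).hom _ ≫ (B'.bal _ X _).hom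
  left (X : C) (m : M.carrier) (n : N.carrier) :
    (Bimod.Hom.functor h).map (B.left X m n).hom ≫ (Bimod.Hom.left h X _).hom ≫
        X ⊴ₗ (iso m n).hom =
      (iso (X ⊙ₗ m) n).hom ≫ B'.mapL (Bimod.Hom.left f X m).hom _ ≫ (B'.left X _ _).hom
  right (m : M.carrier) (n : N.carrier) (Y : C) :
    (Bimod.Hom.functor h).map (B.right m n Y).hom ≫ (Bimod.Hom.right h _ Y).hom ≫
        (iso m n).hom ⊵ᵣ Y =
      (iso m (n ⊙ᵣ Y)).hom ≫ B'.mapR _ (Bimod.Hom.right g n Y).hom ≫ (B'.right _ _ Y).hom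

/-- An isomorphism `h ((l · m) · n) ≅ l · (m · n)` of functors of three variables which are balanced
in the two inner positions and compatible with the outer actions. -/
structure Assoc {L M N LM MN P P' : Bimod.{v, u} C} (B₁₂ : Pairing L M LM) (B₁₂₃ : Pairing LM N P)
    (B₂₃ : Pairing M N MN) (B₁₂₃' : Pairing L MN P') (h : P ⟶ P') where
  iso (l : L.carrier) (m : M.carrier) (n : N.carrier) :
    (Bimod.Hom.functor h).obj (B₁₂₃.val (B₁₂.val l m) n) ≅ B₁₂₃'.val l (B₂₃.val m n)
  natural_left {l l' : L.carrier} (f : l ⟶ l') (m : M.carrier) (n : N.carrier) :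
    (Bimod.Hom.functor h).map (B₁₂₃.mapL (B₁₂.mapL f m) n) ≫ (iso l' m n).hom =
      (iso l m n).hom ≫ B₁₂₃'.mapL f _
  natural_middle (l : L.carrier) {m m' : M.carrier} (f : m ⟶ m') (n : N.carrier) :
    (Bimod.Hom.functor h).map (B₁₂₃.mapL (B₁₂.mapR l f) n) ≫ (iso l m' n).hom =
      (iso l m n).hom ≫ B₁₂₃'.mapR l (B₂₃.mapL f n)
  natural_right (l : L.carrier) (m : M.carrier) {n n' : N.carrier} (f : n ⟶ n') :
    (Bimod.Hom.functor h).map (B₁₂₃.mapR _ f) ≫ (iso l m n').hom =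
      (iso l m n).hom ≫ B₁₂₃'.mapR l (B₂₃.mapR m f)
  bal₁ (l : L.carrier) (X : C) (m : M.carrier) (n : N.carrier) :
    (Bimod.Hom.functor h).map (B₁₂₃.mapL (B₁₂.bal l X m).hom n) ≫ (iso l (X ⊙ₗ m) n).hom ≫
        B₁₂₃'.mapR l (B₂₃.left X m n).hom =
      (iso (l ⊙ᵣ X) m n).hom ≫ (B₁₂₃'.bal l X _).hom
  bal₂ (l : L.carrier) (m : M.carrier) (X : C) (n : N.carrier) :
    (Bimod.Hom.functor h).map (B₁₂₃.mapL (B₁₂.right l m X).hom n ≫ (B₁₂₃.bal _ X n).hom) ≫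
        (iso l m (X ⊙ₗ n)).hom =
      (iso l (m ⊙ᵣ X) n).hom ≫ B₁₂₃'.mapR l (B₂₃.bal m X n).hom
  left (X : C) (l : L.carrier) (m : M.carrier) (n : N.carrier) :
    (Bimod.Hom.functor h).map (B₁₂₃.mapL (B₁₂.left X l m).hom n ≫ (B₁₂₃.left X _ n).hom) ≫
        (Bimod.Hom.left h X _).hom ≫ X ⊴ₗ (iso l m n).hom =
      (iso (X ⊙ₗ l) m n).hom ≫ (B₁₂₃'.left X l _).hom
  right (l : L.carrier) (m : M.carrier) (n : N.carrier) (Y : C) :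
    (Bimod.Hom.functor h).map (B₁₂₃.right _ n Y).hom ≫ (Bimod.Hom.right h _ Y).hom ≫
        (iso l m n).hom ⊵ᵣ Y =
      (iso l m (n ⊙ᵣ Y)).hom ≫ B₁₂₃'.mapR l (B₂₃.right m n Y).hom ≫ (B₁₂₃'.right l _ Y).hom

end TensorProducts

section Regular

variable (C : Type u) [Category.{v} C] [Abelian C] [Linear ℂ C] [MonoidalCategory C]
  [MonoidalPreadditive C] [MonoidalLinear ℂ C] [FiniteSemisimple C]

/-- The regular bimodule category `C`, with left and right action given by the tensor product. -/
def regular : Bimod.{v, u} C where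
  carrier := C
  left := MonoidalCategory.selfLeftAction C
  right := MonoidalCategory.selRightfAction C
  left_bilinear :=
    { additive_right := fun a => { map_add := MonoidalPreadditive.whiskerLeft_add _ _ }
      linear_right := fun a => { map_smul := fun f r => MonoidalLinear.whiskerLeft_smul a r f }
      additive_left := fun b => { map_add := MonoidalPreadditive.add_whiskerRight _ _ }
      linear_left := fun b => { map_smul := fun f r => MonoidalLinear.smul_whiskerRight r f b } }
  right_bilinear :=
    { additive_left := fun a => { map_add := MonoidalPreadditive.whiskerLeft_add _ _ }
      linear_left := fun a => { map_smul := fun f r => MonoidalLinear.whiskerLeft_smul a r f }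
      additive_right := fun b => { map_add := MonoidalPreadditive.add_whiskerRight _ _ }
      linear_right := fun b => { map_smul := fun f r => MonoidalLinear.smul_whiskerRight r f b } }
  middle X m Y := α_ X m Y
  middle_natural_left := by simp
  middle_natural := by simp
  middle_natural_right := by simp
  middle_left_assoc := by simp
  middle_right_assoc := by simp
  middle_left_unit := by simp
  middle_right_unit := by simp

variable {C}

section

open MonoidalLeftAction MonoidalRightAction

variable (M : Bimod.{v, u} C)

/-- The canonical balanced bimodule functor `C × M ⥤ M`, `(X, m) ↦ X ⊗ m`. -/
def actL : Pairing (regular C) M M where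
  bifunctor := MonoidalLeftAction.curriedAction C M.carrier
  bilinear := M.left_bilinear
  bal (X : C) (Y : C) (m : M.carrier) := αₗ X Y m
  bal_natural_left {X X' : C} (f : X ⟶ X') Y m :=
    (by simp : (f ▷ Y) ⊵ₗ m ≫ (αₗ X' Y m).hom = (αₗ X Y m).hom ≫ f ⊵ₗ (Y ⊙ₗ m))
  bal_natural (X : C) Y Y' f m :=
    (by simp : (X ◁ f) ⊵ₗ m ≫ (αₗ X Y' m).hom = (αₗ X Y m).hom ≫ X ⊴ₗ f ⊵ₗ m)
  bal_natural_right (X : C) Y m m' f :=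
    (by simp : (X ⊗ Y) ⊴ₗ f ≫ (αₗ X Y m').hom = (αₗ X Y m).hom ≫ X ⊴ₗ Y ⊴ₗ f)
  bal_assoc (X : C) Y Z m := by
    change (αₗ X (Y ⊗ Z) m).hom ≫ X ⊴ₗ (αₗ Y Z m).hom =
      (α_ X Y Z).inv ⊵ₗ m ≫ (αₗ (X ⊗ Y) Z m).hom ≫ (αₗ X Y (Z ⊙ₗ m)).hom
    rw [← associator_actionHom, ← MonoidalLeftAction.comp_actionHomLeft_assoc]
    simp
  bal_unit (X : C) m := (rightUnitor_actionHom X m).symm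
  left (X : C) (Y : C) (m : M.carrier) := αₗ X Y m
  right (X : C) (m : M.carrier) (Y : C) := (M.middle X m Y).symm
  left_natural_left {X X'} f (Y : C) m :=
    (by simp : (f ▷ Y) ⊵ₗ m ≫ (αₗ X' Y m).hom = (αₗ X Y m).hom ≫ f ⊵ₗ (Y ⊙ₗ m))
  left_natural X {Y Y' : C} (f : Y ⟶ Y') m :=
    (by simp : (X ◁ f) ⊵ₗ m ≫ (αₗ X Y' m).hom = (αₗ X Y m).hom ≫ X ⊴ₗ f ⊵ₗ m)
  left_natural_right X (Y : C) m m' f :=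
    (by simp : (X ⊗ Y) ⊴ₗ f ≫ (αₗ X Y m').hom = (αₗ X Y m).hom ≫ X ⊴ₗ Y ⊴ₗ f)
  right_natural_left {X X' : C} (f : X ⟶ X') m Y := by
    change f ⊵ₗ (m ⊙ᵣ Y) ≫ (M.middle X' m Y).inv = (M.middle X m Y).inv ≫ (f ⊵ₗ m) ⊵ᵣ Y
    rw [Iso.comp_inv_eq, Category.assoc, M.middle_natural_left, Iso.inv_hom_id_assoc]
  right_natural (X : C) {m m'} f Y := by
    change X ⊴ₗ (f ⊵ᵣ Y) ≫ (M.middle X m' Y).inv = (M.middle X m Y).inv ≫ (X ⊴ₗ f) ⊵ᵣ Y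
    rw [Iso.comp_inv_eq, Category.assoc, M.middle_natural, Iso.inv_hom_id_assoc]
  right_natural_right (X : C) m {Y Y'} f := by
    change X ⊴ₗ (m ⊴ᵣ f) ≫ (M.middle X m Y').inv = (M.middle X m Y).inv ≫ (X ⊙ₗ m) ⊴ᵣ f
    rw [Iso.comp_inv_eq, Category.assoc, M.middle_natural_right, Iso.inv_hom_id_assoc]
  left_assoc X X' (Y : C) m := associator_actionHom X X' Y m
  right_assoc (X : C) m Y Y' := by
    change X ⊴ₗ (αᵣ m Y Y').hom ≫ (M.middle X (m ⊙ᵣ Y) Y').inv ≫ (M.middle X m Y).inv ⊵ᵣ Y' =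
      (M.middle X m (Y ⊗ Y')).inv ≫ (αᵣ (X ⊙ₗ m) Y Y').hom
    rw [Iso.eq_inv_comp, ← Category.assoc, M.middle_right_assoc]
    simp [← MonoidalRightAction.comp_actionHomLeft]
  left_unit (X : C) m := (leftUnitor_actionHom X m).symm
  right_unit (X : C) m := by
    change (M.middle X m (𝟙_ C)).inv ≫ (ρᵣ (X ⊙ₗ m)).hom = X ⊴ₗ (ρᵣ m).hom
    rw [Iso.inv_comp_eq, M.middle_right_unit]
  middle X (X' : C) m Y := by
    change (M.middle (X ⊗ X') m Y).inv ≫ (αₗ X X' m).hom ⊵ᵣ Y ≫ (M.middle X (X' ⊙ₗ m) Y).hom =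
      (αₗ X X' (m ⊙ᵣ Y)).hom ≫ X ⊴ₗ (M.middle X' m Y).inv
    rw [Iso.inv_comp_eq, ← Category.assoc, M.middle_left_assoc]
    simp [← MonoidalLeftAction.actionHomRight_comp]
  left_bal X (X' : C) Y m := associator_actionHom X X' Y m
  right_bal (X : C) X' m Y := by
    change (M.middle (X ⊗ X') m Y).inv ≫ (αₗ X X' m).hom ⊵ᵣ Y ≫ (M.middle X (X' ⊙ₗ m) Y).hom =
      (αₗ X X' (m ⊙ᵣ Y)).hom ≫ X ⊴ₗ (M.middle X' m Y).inv
    rw [Iso.inv_comp_eq, ← Category.assoc, M.middle_left_assoc]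
    simp [← MonoidalLeftAction.actionHomRight_comp]

/-- The canonical balanced bimodule functor `M × C ⥤ M`, `(m, X) ↦ m ⊗ X`. -/
def actR : Pairing M (regular C) M where
  bifunctor := (MonoidalRightAction.curriedAction C M.carrier).flip
  bilinear :=
    ⟨M.right_bilinear.additive_left, M.right_bilinear.linear_left,
      M.right_bilinear.additive_right, M.right_bilinear.linear_right⟩
  bal (m : M.carrier) (X : C) (Y : C) := (αᵣ m X Y).symm
  bal_natural_left {m m'} f X (Y : C) := by
    change (f ⊵ᵣ X) ⊵ᵣ Y ≫ (αᵣ m' X Y).inv = (αᵣ m X Y).inv ≫ f ⊵ᵣ (X ⊗ Y)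
    simp
  bal_natural m {X X'} f (Y : C) := by
    change (m ⊴ᵣ f) ⊵ᵣ Y ≫ (αᵣ m X' Y).inv = (αᵣ m X Y).inv ≫ m ⊴ᵣ (f ▷ Y)
    simp
  bal_natural_right m X {Y Y' : C} (f : Y ⟶ Y') := by
    change (m ⊙ᵣ X) ⊴ᵣ f ≫ (αᵣ m X Y').inv = (αᵣ m X Y).inv ≫ m ⊴ᵣ (X ◁ f)
    simp
  bal_assoc m X Y (Z : C) := by
    change (αᵣ m (X ⊗ Y) Z).inv ≫ m ⊴ᵣ (α_ X Y Z).hom =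
      (αᵣ m X Y).hom ⊵ᵣ Z ≫ (αᵣ (m ⊙ᵣ X) Y Z).inv ≫ (αᵣ m X (Y ⊗ Z)).inv
    rw [Iso.inv_comp_eq, ← reassoc_of% actionHom_associator X Y Z m]
    simp
  bal_unit m (X : C) := by
    change (αᵣ m (𝟙_ C) X).inv ≫ m ⊴ᵣ (λ_ X).hom = (ρᵣ m).hom ⊵ᵣ X
    simp
  left (X : C) (m : M.carrier) (Y : C) := M.middle X m Y
  right (m : M.carrier) (X : C) (Y : C) := αᵣ m X Y
  left_natural_left f m (Y : C) := M.middle_natural_left f m Y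
  left_natural X {m m'} f (Y : C) := M.middle_natural X f Y
  left_natural_right X m {Y Y' : C} (f : Y ⟶ Y') := M.middle_natural_right X m f
  right_natural_left {m m'} f (X : C) Y :=
    (by simp : f ⊵ᵣ (X ⊗ Y) ≫ (αᵣ m' X Y).hom = (αᵣ m X Y).hom ≫ (f ⊵ᵣ X) ⊵ᵣ Y)
  right_natural m {X X' : C} (f : X ⟶ X') Y :=
    (by simp : m ⊴ᵣ (f ▷ Y) ≫ (αᵣ m X' Y).hom = (αᵣ m X Y).hom ≫ (m ⊴ᵣ f) ⊵ᵣ Y)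
  right_natural_right m (X : C) {Y Y'} f :=
    (by simp : m ⊴ᵣ (X ◁ f) ≫ (αᵣ m X Y').hom = (αᵣ m X Y).hom ≫ (m ⊙ᵣ X) ⊴ᵣ f)
  left_assoc X X' m (Y : C) := (M.middle_left_assoc X X' m Y).symm
  right_assoc m (X : C) Y Y' := by
    change m ⊴ᵣ (α_ X Y Y').inv ≫ (αᵣ m (X ⊗ Y) Y').hom ≫ (αᵣ m X Y).hom ⊵ᵣ Y' =
      (αᵣ m X (Y ⊗ Y')).hom ≫ (αᵣ (m ⊙ᵣ X) Y Y').hom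
    rw [← actionHom_associator, ← MonoidalRightAction.actionHomRight_comp_assoc]
    simp
  left_unit m (X : C) := M.middle_left_unit m X
  right_unit m (X : C) := (actionHom_rightUnitor X m).symm
  middle X m (Y : C) Y' := (M.middle_right_assoc X m Y Y').symm
  left_bal X m Y (Y' : C) := by
    change (M.middle X m Y).hom ⊵ᵣ Y' ≫ (M.middle X (m ⊙ᵣ Y) Y').hom ≫ X ⊴ₗ (αᵣ m Y Y').inv =
      (αᵣ (X ⊙ₗ m) Y Y').inv ≫ (M.middle X m (Y ⊗ Y')).hom
    rw [Iso.eq_inv_comp, ← reassoc_of% M.middle_right_assoc X m Y Y',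
      ← MonoidalLeftAction.actionHomRight_comp]
    simp
  right_bal m X (Y : C) Y' := by
    change (αᵣ (m ⊙ᵣ X) Y Y').hom ≫ (αᵣ m X Y).inv ⊵ᵣ Y' ≫ (αᵣ m (X ⊗ Y) Y').inv =
      (αᵣ m X (Y ⊗ Y')).inv ≫ m ⊴ᵣ (α_ X Y Y').inv
    have h : (αᵣ m X (Y ⊗ Y')).hom ≫ (αᵣ (m ⊙ᵣ X) Y Y').hom =
        m ⊴ᵣ (α_ X Y Y').inv ≫ (αᵣ m (X ⊗ Y) Y').hom ≫ (αᵣ m X Y).hom ⊵ᵣ Y' := by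
      rw [← actionHom_associator, ← MonoidalRightAction.actionHomRight_comp_assoc]
      simp
    rw [Iso.eq_inv_comp, reassoc_of% h, ← MonoidalRightAction.comp_actionHomLeft_assoc]
    simp

end

section

/-- The underlying left module category of `M` is equivalent to the regular one: there is a
`ℂ`-linear equivalence `C ⥤ M` with the structure of a left module functor. -/
def Bimod.IsLeftTrivial (M : Bimod.{v, u} C) : Prop :=
  ∃ E : C ⥤ M.carrier, E.IsEquivalence ∧ E.Additive ∧ E.Linear ℂ ∧ Nonempty (E.LeftLinear C)

/-- A bimodule category `M` is invertible if there is `N` with `M ⊠_C N ≃ C ≃ N ⊠_C M` as bimodule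
categories. -/
def Bimod.IsInvertible (M : Bimod.{v, u} C) : Prop :=
  ∃ N : Bimod.{v, u} C,
    (∃ B : Pairing M N (regular C), B.toBalanced.IsUniversal) ∧
      ∃ B : Pairing N M (regular C), B.toBalanced.IsUniversal

/-- The condition for a bimodule category to be an object of `Out(C)`, the full sub-2-groupoid of
the bicategory of bimodule categories, their equivalences and isomorphisms of these: it is invertible
and equivalent to `C` as a left module category. -/
structure Bimod.IsOuter (M : Bimod.{v, u} C) : Prop where
  isInvertible : M.IsInvertible
  isLeftTrivial : M.IsLeftTrivial

end

end Regular

section Twist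

open Functor.LaxMonoidal Functor.OplaxMonoidal Functor.Monoidal

variable {C : Type u} [Category.{v} C] [MonoidalCategory C]

/-- The right action `m ⊗ Y = m ⊗ F Y` of `C` on itself twisted by a monoidal functor `F`. -/
abbrev twistedRightAction (F : C ⥤ C) [F.Monoidal] : MonoidalRightAction C C where
  actionObj m Y := m ⊗ F.obj Y
  actionHom f g := f ⊗ₘ F.map g
  actionHomLeft f Y := f ▷ F.obj Y
  actionHomRight m _ _ f := m ◁ F.map f
  actionAssocIso m Y Y' := whiskerLeftIso m (μIso F Y Y').symm ≪≫ (α_ _ _ _).symm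
  actionUnitIso m := whiskerLeftIso m (εIso F).symm ≪≫ ρ_ m
  actionHom_def f g := MonoidalCategory.tensorHom_def _ _
  actionHomRight_id := by simp
  id_actionHomLeft := by simp
  actionHom_comp := by simp
  actionAssocIso_hom_naturality {d₁ d₂ c₁ c₂ c₃ c₄} f g h := by
    change (f ⊗ₘ F.map (g ⊗ₘ h)) ≫ d₂ ◁ δ F c₂ c₄ ≫ (α_ d₂ (F.obj c₂) (F.obj c₄)).inv =
      (d₁ ◁ δ F c₁ c₃ ≫ (α_ d₁ (F.obj c₁) (F.obj c₃)).inv) ≫ ((f ⊗ₘ F.map g) ⊗ₘ F.map h)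
    rw [Category.assoc, ← associator_inv_naturality, ← Category.assoc, ← Category.assoc]
    congr 1
    rw [← id_tensorHom, ← id_tensorHom, MonoidalCategory.tensorHom_comp_tensorHom,
      MonoidalCategory.tensorHom_comp_tensorHom, Functor.OplaxMonoidal.δ_natural]
    simp
  actionUnitIso_hom_naturality f := by
    simp [← whisker_exchange_assoc]
  actionHomRight_whiskerRight {c' c''} f c d := by
    change d ◁ F.map (f ▷ c) = (d ◁ δ F c' c ≫ (α_ _ _ _).inv) ≫ (d ◁ F.map f) ▷ F.obj c ≫
      (α_ _ _ _).hom ≫ d ◁ μ F c'' c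
    rw [Functor.Monoidal.map_whiskerRight]
    simp only [MonoidalCategory.whiskerLeft_comp, Category.assoc, whisker_assoc,
      Iso.inv_hom_id_assoc]
  whiskerRight_actionHomLeft c c' c'' f d := by
    change d ◁ F.map (c ◁ f) = (d ◁ δ F c c' ≫ (α_ _ _ _).inv) ≫ (d ⊗ F.obj c) ◁ F.map f ≫
      (α_ _ _ _).hom ≫ d ◁ μ F c c''
    rw [Functor.Monoidal.map_whiskerLeft]
    simp only [MonoidalCategory.whiskerLeft_comp, Category.assoc, tensor_whiskerLeft,
      Iso.inv_hom_id_assoc]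
  actionHom_associator c₁ c₂ c₃ d := by
    change d ◁ F.map (α_ c₁ c₂ c₃).hom ≫ (d ◁ δ F c₁ (c₂ ⊗ c₃) ≫ (α_ _ _ _).inv) ≫
      (d ⊗ F.obj c₁) ◁ δ F c₂ c₃ ≫ (α_ _ _ _).inv =
      (d ◁ δ F (c₁ ⊗ c₂) c₃ ≫ (α_ _ _ _).inv) ≫ (d ◁ δ F c₁ c₂ ≫ (α_ _ _ _).inv) ▷ F.obj c₃
    have h := congrArg (d ◁ ·) (Functor.OplaxMonoidal.associativity F c₁ c₂ c₃)
    simp only [MonoidalCategory.whiskerLeft_comp] at h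
    simp [← reassoc_of% h]
  actionHom_leftUnitor c d := by
    change d ◁ F.map (λ_ c).hom = (d ◁ δ F (𝟙_ C) c ≫ (α_ _ _ _).inv) ≫
      (d ◁ η F ≫ (ρ_ d).hom) ▷ F.obj c
    rw [Functor.Monoidal.map_leftUnitor]
    simp only [MonoidalCategory.whiskerLeft_comp, Category.assoc, comp_whiskerRight,
      whisker_assoc, Iso.inv_hom_id_assoc, triangle_assoc_comp_right]
  actionHom_rightUnitor c d := by
    change d ◁ F.map (ρ_ c).hom = (d ◁ δ F c (𝟙_ C) ≫ (α_ _ _ _).inv) ≫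
      (d ⊗ F.obj c) ◁ η F ≫ (ρ_ _).hom
    rw [Functor.Monoidal.map_rightUnitor]
    simp only [MonoidalCategory.whiskerLeft_comp, Category.assoc, tensor_whiskerLeft,
      Iso.inv_hom_id_assoc, whiskerLeft_rightUnitor]

end Twist

section TwistedBimodule

open Functor.LaxMonoidal Functor.OplaxMonoidal Functor.Monoidal

variable {C : Type u} [Category.{v} C] [Abelian C] [Linear ℂ C] [MonoidalCategory C]
  [MonoidalPreadditive C] [MonoidalLinear ℂ C] [FiniteSemisimple C]

/-- The bimodule category `M_F`: the category `C` with `X ⊗ m ⊗ Y := X ⊗ m ⊗ F Y`. -/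
def twist (F : TensorAut C) : Bimod.{v, u} C where
  carrier := C
  left := MonoidalCategory.selfLeftAction C
  right := twistedRightAction F.functor
  left_bilinear :=
    { additive_right := fun a => { map_add := MonoidalPreadditive.whiskerLeft_add _ _ }
      linear_right := fun a => { map_smul := fun f r => MonoidalLinear.whiskerLeft_smul a r f }
      additive_left := fun b => { map_add := MonoidalPreadditive.add_whiskerRight _ _ }
      linear_left := fun b => { map_smul := fun f r => MonoidalLinear.smul_whiskerRight r f b } }
  right_bilinear :=
    { additive_left := fun m =>
        { map_add := fun {X Y f g} => by
            change m ◁ F.functor.map (f + g) = m ◁ F.functor.map f + m ◁ F.functor.map g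
            rw [Functor.map_add, MonoidalPreadditive.whiskerLeft_add] }
      linear_left := fun m =>
        { map_smul := fun f r => by
            change m ◁ F.functor.map (r • f) = r • (m ◁ F.functor.map f)
            rw [Functor.map_smul, MonoidalLinear.whiskerLeft_smul] }
      additive_right := fun b => { map_add := MonoidalPreadditive.add_whiskerRight _ _ }
      linear_right := fun b => { map_smul := fun f r => MonoidalLinear.smul_whiskerRight r f _ } }
  middle X m Y := α_ X m (F.functor.obj Y)
  middle_natural_left f m Y := associator_naturality_left f m (F.functor.obj Y)
  middle_natural X m m' f Y := associator_naturality_middle X f (F.functor.obj Y)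
  middle_natural_right X m Y Y' f := associator_naturality_right X m (F.functor.map f)
  middle_left_assoc X X' m Y := (pentagon X X' m (F.functor.obj Y)).symm
  middle_right_assoc X m Y Y' := by
    change (α_ _ _ _).hom ≫ X ◁ (m ◁ δ F.functor Y Y' ≫ (α_ _ _ _).inv) =
      ((X ⊗ m) ◁ δ F.functor Y Y' ≫ (α_ _ _ _).inv) ≫ (α_ _ _ _).hom ▷ _ ≫ (α_ _ _ _).hom
    simp
  middle_left_unit m Y := by
    change (α_ _ _ _).hom ≫ (λ_ _).hom = (λ_ m).hom ▷ F.functor.obj Y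
    simp
  middle_right_unit X m := by
    change (α_ _ _ _).hom ≫ X ◁ (m ◁ η F.functor ≫ (ρ_ _).hom) =
      (X ⊗ m) ◁ η F.functor ≫ (ρ_ _).hom
    simp

end TwistedBimodule

section TwistedBimoduleMaps

open Functor.LaxMonoidal Functor.OplaxMonoidal Functor.Monoidal

variable {C : Type u} [Category.{v} C] [Abelian C] [Linear ℂ C] [MonoidalCategory C]
  [MonoidalPreadditive C] [MonoidalLinear ℂ C] [FiniteSemisimple C]

/-- The bimodule equivalence `M_F ⟶ M_G` attached to a monoidal natural isomorphism `θ : F ≅ G`: the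
identity functor, with `θ` applied before tensoring on the right. -/
def twistMap {F G : TensorAut C} (θ : F ⟶ G) : twist F ⟶ twist G where
  functor := 𝟭 C
  additive := inferInstanceAs (𝟭 C).Additive
  linear := inferInstanceAs ((𝟭 C).Linear ℂ)
  isEquivalence := inferInstanceAs (𝟭 C).IsEquivalence
  left (X : C) (m : C) := Iso.refl (X ⊗ m)
  right (m : C) Y := whiskerLeftIso m (TensorAut.app θ Y)
  left_natural_left {X X'} f (m : C) := (by simp : f ▷ m ≫ 𝟙 (X' ⊗ m) = 𝟙 (X ⊗ m) ≫ f ▷ m)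
  left_natural (X : C) {m m' : C} (f : m ⟶ m') :=
    (by simp : X ◁ f ≫ 𝟙 (X ⊗ m') = 𝟙 (X ⊗ m) ≫ X ◁ f)
  right_natural {m m' : C} (f : m ⟶ m') Y := (whisker_exchange f _).symm
  right_natural_right (m : C) {Y Y'} f := by
    change m ◁ F.functor.map f ≫ m ◁ (TensorAut.Hom.iso θ).hom.app Y' =
      m ◁ (TensorAut.Hom.iso θ).hom.app Y ≫ m ◁ G.functor.map f
    rw [← MonoidalCategory.whiskerLeft_comp, NatTrans.naturality,
      MonoidalCategory.whiskerLeft_comp]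
  left_assoc X X' (m : C) := by
    change (α_ X X' m).hom ≫ 𝟙 _ ≫ X ◁ 𝟙 _ = 𝟙 _ ≫ (α_ X X' m).hom
    simp
  right_assoc (m : C) Y Y' := by
    change (m ◁ δ F.functor Y Y' ≫ (α_ _ _ _).inv) ≫ (m ⊗ F.functor.obj Y) ◁
      (TensorAut.Hom.iso θ).hom.app Y' ≫ (m ◁ (TensorAut.Hom.iso θ).hom.app Y) ▷ _ =
      m ◁ (TensorAut.Hom.iso θ).hom.app (Y ⊗ Y') ≫ (m ◁ δ G.functor Y Y' ≫ (α_ _ _ _).inv)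
    have h : δ F.functor Y Y' ≫ F.functor.obj Y ◁ (TensorAut.Hom.iso θ).hom.app Y' ≫
        (TensorAut.Hom.iso θ).hom.app Y ▷ G.functor.obj Y' =
        (TensorAut.Hom.iso θ).hom.app (Y ⊗ Y') ≫ δ G.functor Y Y' := by
      rw [← cancel_epi (μ F.functor Y Y'), Functor.Monoidal.μ_δ_assoc,
        NatTrans.IsMonoidal.tensor_assoc, Functor.Monoidal.μ_δ, Category.comp_id,
        MonoidalCategory.tensorHom_def']
    rw [← MonoidalCategory.whiskerLeft_comp_assoc, ← h]
    simp
  left_unit (m : C) := (by simp : 𝟙 _ ≫ (λ_ m).hom = (λ_ m).hom)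
  right_unit (m : C) := by
    change m ◁ (TensorAut.Hom.iso θ).hom.app (𝟙_ C) ≫ (m ◁ η G.functor ≫ (ρ_ m).hom) =
      m ◁ η F.functor ≫ (ρ_ m).hom
    have h : (TensorAut.Hom.iso θ).hom.app (𝟙_ C) ≫ η G.functor = η F.functor := by
      rw [← cancel_epi (ε F.functor), NatTrans.IsMonoidal.unit_assoc, Functor.Monoidal.ε_η,
        Functor.Monoidal.ε_η]
    rw [← MonoidalCategory.whiskerLeft_comp_assoc, h]
  middle X (m : C) Y := by
    change (α_ _ _ _).hom ≫ 𝟙 _ ≫ X ◁ (m ◁ (TensorAut.Hom.iso θ).hom.app Y) =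
      (X ⊗ m) ◁ (TensorAut.Hom.iso θ).hom.app Y ≫ 𝟙 _ ▷ _ ≫ (α_ _ _ _).hom
    simp

/-- The canonical balanced bimodule functor `M_F × M_G ⥤ M_{F ∘ G}`, `(m, n) ↦ m ⊗ F n`. -/
def twistPairing (F G : TensorAut C) : Pairing (twist F) (twist G) (twist (F ⊗ G)) where
  bifunctor := (actR (twist F)).bifunctor
  bilinear := (actR (twist F)).bilinear
  bal (m : C) X (n : C) :=
    show (m ⊗ F.functor.obj X) ⊗ F.functor.obj n ≅ m ⊗ F.functor.obj (X ⊗ n) from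
      α_ m _ _ ≪≫ whiskerLeftIso m (μIso F.functor X n)
  left X (m : C) (n : C) :=
    show (X ⊗ m) ⊗ F.functor.obj n ≅ X ⊗ (m ⊗ F.functor.obj n) from α_ X m (F.functor.obj n)
  right (m : C) (n : C) Y :=
    show m ⊗ F.functor.obj (n ⊗ G.functor.obj Y) ≅
        (m ⊗ F.functor.obj n) ⊗ F.functor.obj (G.functor.obj Y) from
      whiskerLeftIso m (μIso F.functor n (G.functor.obj Y)).symm ≪≫ (α_ m _ _).symm
  bal_natural_left := (actR (twist F)).bal_natural_left
  bal_natural := (actR (twist F)).bal_natural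
  bal_natural_right := (actR (twist F)).bal_natural_right
  bal_assoc := (actR (twist F)).bal_assoc
  bal_unit := (actR (twist F)).bal_unit
  left_natural_left := (actR (twist F)).left_natural_left
  left_natural := (actR (twist F)).left_natural
  left_natural_right := (actR (twist F)).left_natural_right
  left_assoc := (actR (twist F)).left_assoc
  left_unit := (actR (twist F)).left_unit
  left_bal := (actR (twist F)).left_bal
  right_natural_left f n Y := (actR (twist F)).right_natural_left f n (G.functor.obj Y)
  right_natural m _ _ f Y := (actR (twist F)).right_natural m f (G.functor.obj Y)
  right_natural_right m n Y Y' f := (actR (twist F)).right_natural_right m n (G.functor.map f)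
  middle X m n Y := (actR (twist F)).middle X m n (G.functor.obj Y)
  right_bal m X n Y := (actR (twist F)).right_bal m X n (G.functor.obj Y)
  right_assoc (m : C) (n : C) Y Y' := by
    change m ◁ F.functor.map (n ◁ δ G.functor Y Y' ≫ (α_ _ _ _).inv) ≫
      (m ◁ δ F.functor _ _ ≫ (α_ _ _ _).inv) ≫
        (m ◁ δ F.functor _ _ ≫ (α_ _ _ _).inv) ▷ F.functor.obj (G.functor.obj Y') =
      (m ◁ δ F.functor _ _ ≫ (α_ _ _ _).inv) ≫
        _ ◁ (F.functor.map (δ G.functor Y Y') ≫ δ F.functor _ _) ≫ (α_ _ _ _).inv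
    have h : m ◁ F.functor.map (α_ n (G.functor.obj Y) (G.functor.obj Y')).inv ≫
        (m ◁ δ F.functor _ _ ≫ (α_ _ _ _).inv) ≫
          (m ◁ δ F.functor _ _ ≫ (α_ _ _ _).inv) ▷ F.functor.obj (G.functor.obj Y') =
        (m ◁ δ F.functor _ _ ≫ (α_ _ _ _).inv) ≫
          (m ⊗ F.functor.obj n) ◁ δ F.functor _ _ ≫ (α_ _ _ _).inv :=
      (actR (twist F)).right_assoc m n (G.functor.obj Y) (G.functor.obj Y')
    rw [Functor.map_comp, MonoidalCategory.whiskerLeft_comp, Category.assoc, h]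
    simp only [MonoidalCategory.whiskerLeft_comp, Category.assoc, tensor_whiskerLeft,
      Iso.inv_hom_id_assoc]
    rw [← MonoidalCategory.whiskerLeft_comp_assoc, ← Functor.OplaxMonoidal.δ_natural_right,
      MonoidalCategory.whiskerLeft_comp_assoc]
  right_unit (m : C) (n : C) := by
    change (m ◁ δ F.functor n (G.functor.obj (𝟙_ C)) ≫ (α_ _ _ _).inv) ≫
      _ ◁ (F.functor.map (η G.functor) ≫ η F.functor) ≫ (ρ_ _).hom =
      m ◁ F.functor.map (n ◁ η G.functor ≫ (ρ_ n).hom)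
    rw [Functor.map_comp, Functor.Monoidal.map_rightUnitor,
      ← Functor.OplaxMonoidal.δ_natural_right_assoc]
    simp only [MonoidalCategory.whiskerLeft_comp, Category.assoc, tensor_whiskerLeft,
      Iso.inv_hom_id_assoc, whiskerLeft_rightUnitor]

end TwistedBimoduleMaps

section ConjugationEquivalence

variable {C : Type u} [Category.{v} C] [MonoidalCategory C] [RightRigidCategory C]

namespace InvObj

variable (g : InvObj C)

/-- The morphism `X ⊗ g* ⊗ g ⊗ Y ⊗ g* ⟶ X ⊗ Y ⊗ g*` given by evaluation. -/
def conjAct (X Y : C) : (X ⊗ g.objᘁ) ⊗ (g.obj ⊗ (Y ⊗ g.objᘁ)) ⟶ (X ⊗ Y) ⊗ g.objᘁ :=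
  𝟙 _ ⊗≫ X ◁ ε_ g.obj g.objᘁ ▷ (Y ⊗ g.objᘁ) ⊗≫ 𝟙 _

instance isIso_conjAct (X Y : C) : IsIso (g.conjAct X Y) := by
  dsimp only [conjAct, monoidalComp]; infer_instance

lemma conjAct_assoc (X Y Z : C) :
    g.conjAct X Y ▷ (g.obj ⊗ (Z ⊗ g.objᘁ)) ≫ g.conjAct (X ⊗ Y) Z ≫ (α_ X Y Z).hom ▷ g.objᘁ =
    (α_ _ _ _).hom ≫ (X ⊗ g.objᘁ) ◁ g.conjMu Y Z ≫ g.conjAct X (Y ⊗ Z) := by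
  let a := g.obj
  let b := g.objᘁ
  calc
    _ = 𝟙 _ ⊗≫ X ◁ (ε_ a b ▷ (Y ⊗ b ⊗ a) ≫ 𝟙_ C ◁ (Y ◁ ε_ a b)) ▷ (Z ⊗ b) ⊗≫ 𝟙 _ := by
      dsimp only [conjAct, a, b]; monoidal
    _ = 𝟙 _ ⊗≫ X ◁ ((b ⊗ a) ◁ (Y ◁ ε_ a b) ≫ ε_ a b ▷ (Y ⊗ 𝟙_ C)) ▷ (Z ⊗ b) ⊗≫ 𝟙 _ := by
      rw [whisker_exchange]
    _ = _ := by
      dsimp only [conjAct, conjMu, a, b]; monoidal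

lemma conjAct_unit (X : C) :
    (ρ_ (X ⊗ g.objᘁ)).hom =
      (X ⊗ g.objᘁ) ◁ g.conjEps ≫ g.conjAct X (𝟙_ C) ≫ (ρ_ X).hom ▷ g.objᘁ := by
  let a := g.obj
  let b := g.objᘁ
  symm
  calc
    _ = 𝟙 _ ⊗≫ X ◁ (b ◁ η_ a b ⊗≫ ε_ a b ▷ b) ⊗≫ 𝟙 _ := by
      dsimp only [conjAct, conjEps, a, b]; monoidal
    _ = _ := by
      rw [ExactPairing.coevaluation_evaluation'']; dsimp only [a, b]; monoidal

lemma conjAct_left (X Y Z : C) :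
    (α_ X Y g.objᘁ).hom ▷ (g.obj ⊗ (Z ⊗ g.objᘁ)) ≫ (α_ X _ _).hom ≫ X ◁ g.conjAct Y Z =
      g.conjAct (X ⊗ Y) Z ≫ (α_ X Y Z).hom ▷ g.objᘁ ≫ (α_ X (Y ⊗ Z) g.objᘁ).hom := by
  dsimp only [conjAct]; monoidal

lemma conjAct_natural_left {X Y : C} (f : X ⟶ Y) (Z : C) :
    (f ▷ g.objᘁ) ▷ (g.obj ⊗ (Z ⊗ g.objᘁ)) ≫ g.conjAct Y Z =
      g.conjAct X Z ≫ (f ▷ Z) ▷ g.objᘁ := by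
  let a := g.obj
  let b := g.objᘁ
  calc
    _ = 𝟙 _ ⊗≫ (f ▷ (b ⊗ a) ≫ Y ◁ ε_ a b) ▷ (Z ⊗ b) ⊗≫ 𝟙 _ := by
      dsimp only [conjAct, a, b]; monoidal
    _ = 𝟙 _ ⊗≫ (X ◁ ε_ a b ≫ f ▷ (𝟙_ C)) ▷ (Z ⊗ b) ⊗≫ 𝟙 _ := by
      rw [whisker_exchange]
    _ = _ := by
      dsimp only [conjAct, a, b]; monoidal

lemma conjAct_natural_right (Z : C) {X Y : C} (f : X ⟶ Y) :
    (Z ⊗ g.objᘁ) ◁ (g.obj ◁ (f ▷ g.objᘁ)) ≫ g.conjAct Z Y =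
      g.conjAct Z X ≫ (Z ◁ f) ▷ g.objᘁ := by
  let a := g.obj
  let b := g.objᘁ
  calc
    _ = 𝟙 _ ⊗≫ Z ◁ ((b ⊗ a) ◁ f ≫ ε_ a b ▷ Y) ▷ b ⊗≫ 𝟙 _ := by
      dsimp only [conjAct, a, b]; monoidal
    _ = 𝟙 _ ⊗≫ Z ◁ (ε_ a b ▷ X ≫ 𝟙_ C ◁ f) ▷ b ⊗≫ 𝟙 _ := by
      rw [whisker_exchange]
    _ = _ := by
      dsimp only [conjAct, a, b]; monoidal

lemma isEquivalence_tensorRight_dual : (tensorRight g.objᘁ).IsEquivalence := by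
  let e : C ≌ C := CategoryTheory.Equivalence.mk (tensorRight g.objᘁ) (tensorRight g.obj)
    ((rightUnitorNatIso C).symm ≪≫
      (tensoringRight C).mapIso (asIso (ε_ g.obj g.objᘁ)).symm ≪≫ tensorRightTensor _ _)
    ((tensorRightTensor _ _).symm ≪≫
      (tensoringRight C).mapIso (asIso (η_ g.obj g.objᘁ)).symm ≪≫ rightUnitorNatIso C)
  exact e.isEquivalence_functor

end InvObj

end ConjugationEquivalence

section ConjugationEquivalence

open Functor.LaxMonoidal Functor.OplaxMonoidal Functor.Monoidal

variable {C : Type u} [Category.{v} C] [Abelian C] [Linear ℂ C] [MonoidalCategory C]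
  [MonoidalPreadditive C] [MonoidalLinear ℂ C] [RightRigidCategory C] [FiniteSemisimple C]

/-- The bimodule equivalence `Φ_g : C ⟶ M_{F_g}`, `X ↦ X ⊗ g*`, whose compatibility with the right
actions is given by evaluation. -/
noncomputable def conjEquiv (g : InvObj C) : regular C ⟶ twist g.conj where
  functor := show C ⥤ C from tensorRight g.objᘁ
  additive :=
    { map_add := fun {X Y : C} {f f' : X ⟶ Y} => by
        change (f + f') ▷ g.objᘁ = f ▷ g.objᘁ + f' ▷ g.objᘁ
        rw [MonoidalPreadditive.add_whiskerRight] }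
  linear :=
    { map_smul := fun {X Y : C} (f : X ⟶ Y) r => by
        change (r • f) ▷ g.objᘁ = r • (f ▷ g.objᘁ)
        rw [MonoidalLinear.smul_whiskerRight] }
  isEquivalence := g.isEquivalence_tensorRight_dual
  left (X : C) (m : C) := show (X ⊗ m) ⊗ g.objᘁ ≅ X ⊗ (m ⊗ g.objᘁ) from α_ X m g.objᘁ
  right (m : C) Y := (asIso (g.conjAct m Y)).symm
  left_natural_left {X X'} (f : X ⟶ X') (m : C) := associator_naturality_left f m g.objᘁ
  left_natural (X : C) {m m' : C} (f : m ⟶ m') := associator_naturality_middle X f g.objᘁ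
  right_natural {m m' : C} (f : m ⟶ m') Y := by
    change (f ▷ Y) ▷ g.objᘁ ≫ inv (g.conjAct m' Y) =
      inv (g.conjAct m Y) ≫ (f ▷ g.objᘁ) ▷ (g.obj ⊗ (Y ⊗ g.objᘁ))
    rw [IsIso.comp_inv_eq, Category.assoc, g.conjAct_natural_left, IsIso.inv_hom_id_assoc]
  right_natural_right (m : C) {Y Y'} f := by
    change (m ◁ f) ▷ g.objᘁ ≫ inv (g.conjAct m Y') =
      inv (g.conjAct m Y) ≫ (m ⊗ g.objᘁ) ◁ (g.obj ◁ (f ▷ g.objᘁ))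
    rw [IsIso.comp_inv_eq, Category.assoc, g.conjAct_natural_right, IsIso.inv_hom_id_assoc]
  left_assoc X X' (m : C) := pentagon X X' m g.objᘁ
  right_assoc (m : C) Y Y' := by
    change (α_ m Y Y').inv ▷ g.objᘁ ≫ inv (g.conjAct (m ⊗ Y) Y') ≫
      inv (g.conjAct m Y) ▷ (g.obj ⊗ (Y' ⊗ g.objᘁ)) =
      inv (g.conjAct m (Y ⊗ Y')) ≫ (m ⊗ g.objᘁ) ◁ inv (g.conjMu Y Y') ≫ (α_ _ _ _).inv
    rw [← cancel_epi (g.conjAct m (Y ⊗ Y')), ← cancel_epi ((m ⊗ g.objᘁ) ◁ g.conjMu Y Y'),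
      ← cancel_epi (α_ _ _ _).hom]
    have h := g.conjAct_assoc m Y Y'
    rw [← reassoc_of% h]
    simp [← comp_whiskerRight, ← MonoidalCategory.whiskerLeft_comp_assoc,
      ← comp_whiskerRight_assoc]
  left_unit (m : C) := by
    change (α_ _ _ _).hom ≫ (λ_ _).hom = (λ_ m).hom ▷ g.objᘁ
    simp
  right_unit (m : C) := by
    change inv (g.conjAct m (𝟙_ C)) ≫ (m ⊗ g.objᘁ) ◁ inv g.conjEps ≫ (ρ_ _).hom =
      (ρ_ m).hom ▷ g.objᘁ
    rw [g.conjAct_unit]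
    simp [← MonoidalCategory.whiskerLeft_comp_assoc]
  middle X (m : C) Y := by
    change (α_ X m Y).hom ▷ g.objᘁ ≫ (α_ _ _ _).hom ≫ X ◁ inv (g.conjAct m Y) =
      inv (g.conjAct (X ⊗ m) Y) ≫ (α_ _ _ _).hom ▷ (g.obj ⊗ (Y ⊗ g.objᘁ)) ≫ (α_ _ _ _).hom
    rw [← cancel_epi (g.conjAct (X ⊗ m) Y), IsIso.hom_inv_id_assoc]
    have h := g.conjAct_left X m Y
    rw [← reassoc_of% h, ← MonoidalCategory.whiskerLeft_comp]
    simp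

end ConjugationEquivalence

section TwistPseudofunctor

variable (C : Type u) [Category.{v} C] [Abelian C] [Linear ℂ C] [MonoidalCategory C]
  [MonoidalPreadditive C] [MonoidalLinear ℂ C] [FiniteSemisimple C]

variable {C} in
/-- The identity isomorphism `M_{id} ≅ id`. -/
def twistMapId (F : TensorAut C) : twistMap (𝟙 F) ≅ 𝟙 (twist F) :=
  Bimod.Hom₂.toIso
    { iso := Iso.refl (𝟭 C)
      left := fun X (m : C) => (by simp : 𝟙 (X ⊗ m) ≫ 𝟙 _ = 𝟙 _ ≫ X ◁ 𝟙 m)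
      right := fun (m : C) Y => by
        change 𝟙 _ ≫ 𝟙 _ = m ◁ 𝟙 _ ≫ 𝟙 m ▷ F.functor.obj Y
        simp }

variable {C} in
/-- The identity isomorphism `M_{η ∘ θ} ≅ M_η ∘ M_θ`. -/
def twistMapComp {F G H : TensorAut C} (θ : F ⟶ G) (η : G ⟶ H) :
    twistMap (θ ≫ η) ≅ twistMap θ ≫ twistMap η :=
  Bimod.Hom₂.toIso
    { iso := Iso.refl (𝟭 C)
      left := fun X (m : C) => by
        change 𝟙 _ ≫ 𝟙 _ ≫ 𝟙 _ = 𝟙 _ ≫ X ◁ 𝟙 m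
        simp
      right := fun (m : C) Y => by
        change 𝟙 _ ≫ m ◁ (TensorAut.Hom.iso θ).hom.app Y ≫ m ◁ (TensorAut.Hom.iso η).hom.app Y =
          m ◁ ((TensorAut.Hom.iso θ).hom.app Y ≫ (TensorAut.Hom.iso η).hom.app Y) ≫ 𝟙 m ▷ _
        simp }

variable {C} in
lemma twistMap_eqToHom_app {F G : TensorAut C} {θ θ' : F ⟶ G} (e : θ = θ')
    (h : twistMap θ = twistMap θ') (m : C) :
    (Bimod.Hom₂.iso (eqToHom h)).hom.app m = (𝟙 m : m ⟶ m) := by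
  subst e; rfl

/-- The functor of 2-categories `M_-`, from the categorical group of tensor autoequivalences, with
only identity 2-morphisms, to the bicategory of bimodule categories. -/
def twistPseudofunctor : Pseudofunctor (LocallyDiscrete (TensorAut C)) (Bimod.{v, u} C) :=
  pseudofunctorOfIsLocallyDiscrete (fun F => twist F.as) (fun θ => twistMap θ.as)
    (fun F => twistMapId F.as) (fun θ η => twistMapComp θ.as η.as)
    (fun f g h => by
      refine Bimod.hom₂_ext (fun (m : C) => ?_)
      refine Eq.trans ?_ (twistMap_eqToHom_app (Category.assoc f.as g.as h.as) _ m).symm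
      change 𝟙 m ≫ 𝟙 m ≫ 𝟙 m ≫ 𝟙 m ≫ 𝟙 m = 𝟙 m
      simp)
    (fun f => by
      refine Bimod.hom₂_ext (fun (m : C) => ?_)
      refine Eq.trans ?_ (twistMap_eqToHom_app (Category.id_comp f.as) _ m).symm
      change 𝟙 m ≫ 𝟙 m ≫ 𝟙 m = 𝟙 m
      simp)
    (fun f => by
      refine Bimod.hom₂_ext (fun (m : C) => ?_)
      refine Eq.trans ?_ (twistMap_eqToHom_app (Category.comp_id f.as) _ m).symm
      change 𝟙 m ≫ 𝟙 m ≫ 𝟙 m = 𝟙 m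
      simp)

end TwistPseudofunctor

section Families

variable {C : Type u} [Category.{v} C] [Abelian C] [Linear ℂ C] [MonoidalCategory C]

namespace Family

variable {G : Type*} [Category G] (Ψ : Pseudofunctor (LocallyDiscrete G) (Bimod.{v, u} C))

/-- The bimodule category `Ψ F`. -/
abbrev value (F : G) : Bimod.{v, u} C := Ψ.obj ⟨F⟩

/-- The bimodule equivalence `Ψ θ`. -/
abbrev hom {F F' : G} (θ : F ⟶ F') : value Ψ F ⟶ value Ψ F' := Ψ.map θ.toLoc

/-- The functor underlying the bimodule equivalence `Ψ θ`. -/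
abbrev fn {F F' : G} (θ : F ⟶ F') : (value Ψ F).carrier ⥤ (value Ψ F').carrier :=
  Bimod.Hom.functor (hom Ψ θ)

/-- The component `Ψ θ m ≅ m` of the unit isomorphism of `Ψ`, when `θ` is an identity. -/
abbrev idIso {F : G} (θ : F ⟶ F) (h : θ = 𝟙 F) (m : (value Ψ F).carrier) :
    (fn Ψ θ).obj m ≅ m :=
  (Bimod.Hom₂.iso (Ψ.mapId' θ.toLoc (by rw [h]; rfl)).hom).app m

/-- The component `Ψ κ m ≅ Ψ η (Ψ θ m)` of the composition isomorphism of `Ψ`, when `κ = η ∘ θ`. -/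
abbrev compIso {F F' F'' : G} (θ : F ⟶ F') (η : F' ⟶ F'') (κ : F ⟶ F'') (h : θ ≫ η = κ)
    (m : (value Ψ F).carrier) : (fn Ψ κ).obj m ≅ (fn Ψ η).obj ((fn Ψ θ).obj m) :=
  (Bimod.Hom₂.iso (Ψ.mapComp' θ.toLoc η.toLoc κ.toLoc (by rw [← h]; rfl)).hom).app m

end Family

end Families

section MonoidalStructure

open Family

variable {C : Type u} [Category.{v} C] [Abelian C] [Linear ℂ C] [MonoidalCategory C]
  [MonoidalPreadditive C] [MonoidalLinear ℂ C] [FiniteSemisimple C]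

/-- The structure making a functor `Ψ` of 2-groupoids from a categorical group `G` (with
only identity 2-morphisms) to bimodule categories into a homomorphism of categorical 2-groups:
equivalences `ι F F' : Ψ F ⊠_C Ψ F' ≃ Ψ (F ⊗ F')`, pseudonatural in `F` and `F'`, an equivalence
`unit : C ≃ Ψ 𝟙`, natural isomorphisms `assoc`, `unitLeft`, `unitRight` expressing associativity
and unitality up to isomorphism, which satisfy the pentagon and triangle identities. -/
structure MonoidalStructure {G : Type*} [Category G] [MonoidalCategory G]
    (Ψ : Pseudofunctor (LocallyDiscrete G) (Bimod.{v, u} C)) where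
  ι (F F' : G) : Pairing (value Ψ F) (value Ψ F') (value Ψ (F ⊗ F'))
  universal (F F' : G) : (ι F F').toBalanced.IsUniversal
  natural {F₁ F₂ F₁' F₂' : G} (θ : F₁ ⟶ F₂) (θ' : F₁' ⟶ F₂') :
    Square (hom Ψ θ) (hom Ψ θ') (hom Ψ (θ ⊗ₘ θ')) (ι F₁ F₁') (ι F₂ F₂')
  natural_id (F F' : G) (m : (value Ψ F).carrier) (n : (value Ψ F').carrier) :
    ((natural (𝟙 F) (𝟙 F')).iso m n).hom ≫ (ι F F').mapL (idIso Ψ (𝟙 F) rfl m).hom _ ≫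
        (ι F F').mapR m (idIso Ψ (𝟙 F') rfl n).hom =
      (idIso Ψ (𝟙 F ⊗ₘ 𝟙 F') (by simp) ((ι F F').val m n)).hom
  natural_comp {F₁ F₂ F₃ F₁' F₂' F₃' : G} (θ : F₁ ⟶ F₂) (η : F₂ ⟶ F₃) (θ' : F₁' ⟶ F₂')
    (η' : F₂' ⟶ F₃') (m : (value Ψ F₁).carrier) (n : (value Ψ F₁').carrier) :
    ((natural (θ ≫ η) (θ' ≫ η')).iso m n).hom ≫
        (ι F₃ F₃').mapL (compIso Ψ θ η _ rfl m).hom _ ≫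
          (ι F₃ F₃').mapR _ (compIso Ψ θ' η' _ rfl n).hom =
      (compIso Ψ (θ ⊗ₘ θ') (η ⊗ₘ η') (θ ≫ η ⊗ₘ θ' ≫ η') (by simp) ((ι F₁ F₁').val m n)).hom ≫
        (fn Ψ (η ⊗ₘ η')).map ((natural θ θ').iso m n).hom ≫ ((natural η η').iso _ _).hom
  unit : regular C ⟶ value Ψ (𝟙_ G)
  assoc (F F' F'' : G) :
    Assoc (ι F F') (ι (F ⊗ F') F'') (ι F' F'') (ι F (F' ⊗ F'')) (hom Ψ (α_ F F' F'').hom)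
  assoc_natural {F₁ F₂ F₁' F₂' F₁'' F₂'' : G} (θ : F₁ ⟶ F₂) (θ' : F₁' ⟶ F₂') (θ'' : F₁'' ⟶ F₂'')
    (l : (value Ψ F₁).carrier) (m : (value Ψ F₁').carrier) (n : (value Ψ F₁'').carrier) :
    (compIso Ψ ((θ ⊗ₘ θ') ⊗ₘ θ'') (α_ F₂ F₂' F₂'').hom
          (((θ ⊗ₘ θ') ⊗ₘ θ'') ≫ (α_ F₂ F₂' F₂'').hom) rfl _).hom ≫
        (fn Ψ (α_ F₂ F₂' F₂'').hom).map
          (((natural (θ ⊗ₘ θ') θ'').iso ((ι F₁ F₁').val l m) n).hom ≫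
            (ι (F₂ ⊗ F₂') F₂'').mapL ((natural θ θ').iso l m).hom _) ≫
          ((assoc F₂ F₂' F₂'').iso _ _ _).hom =
      (compIso Ψ (α_ F₁ F₁' F₁'').hom (θ ⊗ₘ (θ' ⊗ₘ θ'')) _
          (associator_naturality θ θ' θ'').symm _).hom ≫
        (fn Ψ (θ ⊗ₘ (θ' ⊗ₘ θ''))).map ((assoc F₁ F₁' F₁'').iso l m n).hom ≫
          ((natural θ (θ' ⊗ₘ θ'')).iso l ((ι F₁' F₁'').val m n)).hom ≫
            (ι F₂ (F₂' ⊗ F₂'')).mapR _ ((natural θ' θ'').iso m n).hom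
  unitLeft (F : G) : Square unit (𝟙 (value Ψ F)) (hom Ψ (λ_ F).inv) (actL _) (ι (𝟙_ G) F)
  unitLeft_natural {F F' : G} (θ : F ⟶ F') (X : C) (m : (value Ψ F).carrier) :
    (compIso Ψ θ (λ_ F').inv (θ ≫ (λ_ F').inv) rfl _).hom ≫
        (fn Ψ (λ_ F').inv).map (Bimod.Hom.left (hom Ψ θ) X m).hom ≫
          ((unitLeft F').iso X ((fn Ψ θ).obj m)).hom =
      (compIso Ψ (λ_ F).inv (𝟙 (𝟙_ G) ⊗ₘ θ) (θ ≫ (λ_ F').inv) (by simp) _).hom ≫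
        (fn Ψ (𝟙 (𝟙_ G) ⊗ₘ θ)).map ((unitLeft F).iso X m).hom ≫
          ((natural (𝟙 (𝟙_ G)) θ).iso _ m).hom ≫ (ι (𝟙_ G) F').mapL (idIso Ψ _ rfl _).hom _
  unitRight (F : G) : Square (𝟙 (value Ψ F)) unit (hom Ψ (ρ_ F).inv) (actR _) (ι F (𝟙_ G))
  unitRight_natural {F F' : G} (θ : F ⟶ F') (m : (value Ψ F).carrier) (X : C) :
    (compIso Ψ θ (ρ_ F').inv (θ ≫ (ρ_ F').inv) rfl _).hom ≫
        (fn Ψ (ρ_ F').inv).map (Bimod.Hom.right (hom Ψ θ) m X).hom ≫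
          ((unitRight F').iso ((fn Ψ θ).obj m) X).hom =
      (compIso Ψ (ρ_ F).inv (θ ⊗ₘ 𝟙 (𝟙_ G)) (θ ≫ (ρ_ F').inv) (by simp) _).hom ≫
        (fn Ψ (θ ⊗ₘ 𝟙 (𝟙_ G))).map ((unitRight F).iso m X).hom ≫
          ((natural θ (𝟙 (𝟙_ G))).iso m _).hom ≫ (ι F' (𝟙_ G)).mapR _ (idIso Ψ _ rfl _).hom
  pentagon (F F' F'' F''' : G) (l : (value Ψ F).carrier) (m : (value Ψ F').carrier)
    (n : (value Ψ F'').carrier) (p : (value Ψ F''').carrier) :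
    (compIso Ψ ((α_ F F' F'').hom ⊗ₘ 𝟙 F''') ((α_ F (F' ⊗ F'') F''').hom ≫
            (𝟙 F ⊗ₘ (α_ F' F'' F''').hom))
          ((α_ (F ⊗ F') F'' F''').hom ≫ (α_ F F' (F'' ⊗ F''')).hom) (by simp) _).hom ≫
        (compIso Ψ (α_ F (F' ⊗ F'') F''').hom (𝟙 F ⊗ₘ (α_ F' F'' F''').hom) _ rfl _).hom ≫
          (fn Ψ (𝟙 F ⊗ₘ (α_ F' F'' F''').hom)).map
            ((fn Ψ (α_ F (F' ⊗ F'') F''').hom).map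
                (((natural (α_ F F' F'').hom (𝟙 F''')).iso
                    ((ι (F ⊗ F') F'').val ((ι F F').val l m) n) p).hom ≫
                  (ι (F ⊗ F' ⊗ F'') F''').mapL ((assoc F F' F'').iso l m n).hom _ ≫
                    (ι (F ⊗ F' ⊗ F'') F''').mapR _ (idIso Ψ (𝟙 F''') rfl p).hom) ≫
              ((assoc F (F' ⊗ F'') F''').iso l ((ι F' F'').val m n) p).hom) ≫
            ((natural (𝟙 F) (α_ F' F'' F''').hom).iso l _).hom ≫
              (ι F (F' ⊗ F'' ⊗ F''')).mapL (idIso Ψ (𝟙 F) rfl l).hom _ ≫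
                (ι F (F' ⊗ F'' ⊗ F''')).mapR l ((assoc F' F'' F''').iso m n p).hom =
      (compIso Ψ (α_ (F ⊗ F') F'' F''').hom (α_ F F' (F'' ⊗ F''')).hom _ rfl _).hom ≫
        (fn Ψ (α_ F F' (F'' ⊗ F''')).hom).map
            ((assoc (F ⊗ F') F'' F''').iso ((ι F F').val l m) n p).hom ≫
          ((assoc F F' (F'' ⊗ F''')).iso l m ((ι F'' F''').val n p)).hom
  triangle (F F' : G) (m : (value Ψ F).carrier) (X : C) (n : (value Ψ F').carrier) :
    (compIso Ψ ((ρ_ F).inv ⊗ₘ 𝟙 F') (α_ F (𝟙_ G) F').hom (𝟙 F ⊗ₘ (λ_ F').inv) (by simp) _).hom ≫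
        (fn Ψ (α_ F (𝟙_ G) F').hom).map
            (((natural (ρ_ F).inv (𝟙 F')).iso (m ⊙ᵣ X) n).hom ≫
              (ι (F ⊗ 𝟙_ G) F').mapL ((unitRight F).iso m X).hom _ ≫
                (ι (F ⊗ 𝟙_ G) F').mapR _ (idIso Ψ (𝟙 F') rfl n).hom) ≫
          ((assoc F (𝟙_ G) F').iso m _ n).hom =
      (fn Ψ (𝟙 F ⊗ₘ (λ_ F').inv)).map ((ι F F').bal m X n).hom ≫
        ((natural (𝟙 F) (λ_ F').inv).iso m (X ⊙ₗ n)).hom ≫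
          (ι F (𝟙_ G ⊗ F')).mapL (idIso Ψ (𝟙 F) rfl m).hom _ ≫
            (ι F (𝟙_ G ⊗ F')).mapR m ((unitLeft F').iso X n).hom

end MonoidalStructure

section HomotopyFiber

open Family Bicategory

variable {C : Type u} [Category.{v} C] [Abelian C] [Linear ℂ C] [MonoidalCategory C]

/-- The objects of the homotopy fiber of `Ψ` over the bimodule category `X`: pairs of an object `F` and
an equivalence `X ≃ Ψ F`. -/
structure HomotopyFiber {G : Type*} [Category G]
    (Ψ : Pseudofunctor (LocallyDiscrete G) (Bimod.{v, u} C)) (X : Bimod.{v, u} C) where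
  base : G
  equiv : X ⟶ value Ψ base

namespace HomotopyFiber

variable {G : Type*} [Category G] {Ψ : Pseudofunctor (LocallyDiscrete G) (Bimod.{v, u} C)}
  {X : Bimod.{v, u} C}

/-- A morphism `(F, φ) ⟶ (F', φ')` in the homotopy fiber: a morphism `θ : F ⟶ F'` together with an
isomorphism `Ψ θ ∘ φ ≅ φ'` of bimodule equivalences. -/
structure Hom (A B : HomotopyFiber Ψ X) where
  base : A.base ⟶ B.base
  cell : A.equiv ≫ hom Ψ base ⟶ B.equiv

lemma Hom.ext' {A B : HomotopyFiber Ψ X} {a b : Hom A B} (h : a.base = b.base)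
    (w : a.cell = A.equiv ◁ Ψ.map₂ (eqToHom (congrArg Quiver.Hom.toLoc h)) ≫ b.cell) : a = b := by
  obtain ⟨a, a'⟩ := a
  obtain ⟨b, b'⟩ := b
  obtain rfl : a = b := h
  simp at w
  rw [w]

section

variable {B : Type*} [Bicategory B] {x a b c d : B}

lemma cell_id_comp (f : x ⟶ a) (i : a ⟶ a) (p κ : a ⟶ b) (g : x ⟶ b) (t : i ⟶ 𝟙 a)
    (k : κ ⟶ i ≫ p) (y : f ≫ p ⟶ g) :
    f ◁ k ≫ (Bicategory.associator f i p).inv ≫ (f ◁ t ≫ (Bicategory.rightUnitor f).hom) ▷ p ≫ y =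
      f ◁ (k ≫ t ▷ p ≫ (Bicategory.leftUnitor p).hom) ≫ y := by
  simp

lemma cell_comp_id (f : x ⟶ a) (i : b ⟶ b) (p κ : a ⟶ b) (g : x ⟶ b) (t : i ⟶ 𝟙 b)
    (k : κ ⟶ p ≫ i) (y : f ≫ p ⟶ g) :
    f ◁ k ≫ (Bicategory.associator f p i).inv ≫ y ▷ i ≫ g ◁ t ≫ (Bicategory.rightUnitor g).hom =
      f ◁ (k ≫ p ◁ t ≫ (Bicategory.rightUnitor p).hom) ≫ y := by
  rw [← Bicategory.whisker_exchange_assoc]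
  simp

lemma cell_assoc (f : x ⟶ a) (p : a ⟶ b) (q : b ⟶ c) (r : c ⟶ d) {pq : a ⟶ c} {qr : b ⟶ d}
    {κ κ' : a ⟶ d} {g : x ⟶ b} {g' : x ⟶ c} {g'' : x ⟶ d} (k₁ : pq ⟶ p ≫ q) (k₂ : κ ⟶ pq ≫ r)
    (k₃ : qr ≅ q ≫ r) (k₄ : κ' ≅ p ≫ qr) (y : f ≫ p ⟶ g) (y' : g ≫ q ⟶ g') (y'' : g' ≫ r ⟶ g'') :
    f ◁ k₂ ≫ (Bicategory.associator f pq r).inv ≫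
        (f ◁ k₁ ≫ (Bicategory.associator f p q).inv ≫ y ▷ q ≫ y') ▷ r ≫ y'' =
      f ◁ (k₂ ≫ k₁ ▷ r ≫ (Bicategory.associator p q r).hom ≫ p ◁ k₃.inv ≫ k₄.inv) ≫
        f ◁ k₄.hom ≫ (Bicategory.associator f p qr).inv ≫ y ▷ qr ≫
          g ◁ k₃.hom ≫ (Bicategory.associator g q r).inv ≫ y' ▷ r ≫ y'' := by
  rw [← Bicategory.whisker_exchange_assoc]
  simp

end

instance : Category (HomotopyFiber Ψ X) where
  Hom := Hom
  id A := ⟨𝟙 A.base, A.equiv ◁ (Ψ.mapId ⟨A.base⟩).hom ≫ (Bicategory.rightUnitor A.equiv).hom⟩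
  comp {A _ _} a b :=
    ⟨a.base ≫ b.base, A.equiv ◁ (Ψ.mapComp a.base.toLoc b.base.toLoc).hom ≫
      (Bicategory.associator A.equiv (hom Ψ a.base) (hom Ψ b.base)).inv ≫ a.cell ▷ hom Ψ b.base ≫ b.cell⟩
  id_comp a := by
    refine Hom.ext' (Category.id_comp _) ?_
    have h : Ψ.map₂ (eqToHom (congrArg Quiver.Hom.toLoc (Category.id_comp a.base))) = _ :=
      (congrArg Ψ.map₂ (Subsingleton.elim _ (Bicategory.leftUnitor a.base.toLoc).hom)).trans (Ψ.map₂_left_unitor _)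
    rw [h]
    exact cell_id_comp _ _ _ _ _ _ _ _
  comp_id a := by
    refine Hom.ext' (Category.comp_id _) ?_
    have h : Ψ.map₂ (eqToHom (congrArg Quiver.Hom.toLoc (Category.comp_id a.base))) = _ :=
      (congrArg Ψ.map₂ (Subsingleton.elim _ (Bicategory.rightUnitor a.base.toLoc).hom)).trans (Ψ.map₂_right_unitor _)
    rw [h]
    exact cell_comp_id _ _ _ _ _ _ _ _
  assoc a b c := by
    refine Hom.ext' (Category.assoc _ _ _) ?_
    have h : Ψ.map₂ (eqToHom (congrArg Quiver.Hom.toLoc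
        (Category.assoc a.base b.base c.base))) = _ :=
      (congrArg Ψ.map₂ (Subsingleton.elim _
        (Bicategory.associator a.base.toLoc b.base.toLoc c.base.toLoc).hom)).trans
        (Ψ.map₂_associator _ _ _)
    rw [h]
    exact cell_assoc _ _ _ _ _ _ _ _ _ _ _

end HomotopyFiber

end HomotopyFiber

section NullHomotopy

open Family
open Functor.OplaxMonoidal (δ η)

variable {C : Type u} [Category.{v} C] [Abelian C] [Linear ℂ C] [MonoidalCategory C]
  [MonoidalPreadditive C] [MonoidalLinear ℂ C] [FiniteSemisimple C]

/-- A null homotopy of the composition of a homomorphism `K : H ⥤ G` of categorical groups with a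
homomorphism `Ψ` of categorical 2-groups from `G` to bimodule categories: a monoidal pseudonatural
equivalence from the constant homomorphism at the unit object to `Ψ ∘ K`. It consists of bimodule
equivalences `Φ g : C ≃ Ψ (K g)`, pseudonatural in `g`, of isomorphisms
`Ψ δ (Φ (g ⊗ h) (X ⊗ Y)) ≅ ι (Φ g X, Φ h Y)` and of an isomorphism between the unit constraint of `Ψ`
and `Φ 𝟙`, compatible with the associativity and unit isomorphisms. -/
structure NullHomotopy {H G : Type*} [Category H] [MonoidalCategory H] [Category G]
    [MonoidalCategory G] (K : H ⥤ G) [K.Monoidal]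
    (Ψ : Pseudofunctor (LocallyDiscrete G) (Bimod.{v, u} C)) (S : MonoidalStructure Ψ) where
  Φ (g : H) : regular C ⟶ value Ψ (K.obj g)
  natural {g h : H} (f : g ⟶ h) : Φ g ≫ hom Ψ (K.map f) ⟶ Φ h
  natural_id (g : H) (X : C) :
    (Bimod.Hom₂.iso (natural (𝟙 g))).hom.app X =
      (idIso Ψ (K.map (𝟙 g)) (K.map_id g) ((Bimod.Hom.functor (Φ g)).obj X)).hom
  natural_comp {g h k : H} (f : g ⟶ h) (f' : h ⟶ k) (X : C) :
    (Bimod.Hom₂.iso (natural (f ≫ f'))).hom.app X =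
      (compIso Ψ (K.map f) (K.map f') (K.map (f ≫ f')) (K.map_comp f f').symm
          ((Bimod.Hom.functor (Φ g)).obj X)).hom ≫
        (fn Ψ (K.map f')).map ((Bimod.Hom₂.iso (natural f)).hom.app X) ≫
          (Bimod.Hom₂.iso (natural f')).hom.app X
  mul (g h : H) :
    Square (Φ g) (Φ h) (Φ (g ⊗ h) ≫ hom Ψ (δ K g h)) (actL (regular C)) (S.ι (K.obj g) (K.obj h))
  mul_natural {g g' h h' : H} (f : g ⟶ g') (k : h ⟶ h') (X Y : C) :
    (compIso Ψ (K.map (f ⊗ₘ k)) (δ K g' h') (K.map (f ⊗ₘ k) ≫ δ K g' h') rfl _).hom ≫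
        (fn Ψ (δ K g' h')).map ((Bimod.Hom₂.iso (natural (f ⊗ₘ k))).hom.app (X ⊗ Y : C)) ≫
          ((mul g' h').iso X Y).hom =
      (compIso Ψ (δ K g h) (K.map f ⊗ₘ K.map k) (K.map (f ⊗ₘ k) ≫ δ K g' h')
          (Functor.OplaxMonoidal.δ_natural K f k) _).hom ≫
        (fn Ψ (K.map f ⊗ₘ K.map k)).map ((mul g h).iso X Y).hom ≫
          ((S.natural (K.map f) (K.map k)).iso _ _).hom ≫
            (S.ι (K.obj g') (K.obj h')).mapL ((Bimod.Hom₂.iso (natural f)).hom.app X) _ ≫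
              (S.ι (K.obj g') (K.obj h')).mapR _ ((Bimod.Hom₂.iso (natural k)).hom.app Y)
  one : S.unit ⟶ Φ (𝟙_ H) ≫ hom Ψ (η K)
  mul_assoc (g h k : H) (X Y Z : C) :
    (compIso Ψ (K.map (α_ g h k).hom) (δ K g (h ⊗ k) ≫ (𝟙 (K.obj g) ⊗ₘ δ K h k))
          (δ K (g ⊗ h) k ≫ (δ K g h ⊗ₘ 𝟙 (K.obj k)) ≫ (α_ (K.obj g) (K.obj h) (K.obj k)).hom)
          (by simp) _).hom ≫
        (compIso Ψ (δ K g (h ⊗ k)) (𝟙 (K.obj g) ⊗ₘ δ K h k) _ rfl _).hom ≫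
          (fn Ψ (𝟙 (K.obj g) ⊗ₘ δ K h k)).map
            ((fn Ψ (δ K g (h ⊗ k))).map
                ((Bimod.Hom₂.iso (natural (α_ g h k).hom)).hom.app ((X ⊗ Y) ⊗ Z : C) ≫
                  (Bimod.Hom.functor (Φ (g ⊗ h ⊗ k))).map
                    (show ((X ⊗ Y) ⊗ Z : C) ⟶ (X ⊗ (Y ⊗ Z) : C) from (α_ X Y Z).hom)) ≫
              ((mul g (h ⊗ k)).iso X (Y ⊗ Z : C)).hom) ≫
            ((S.natural (𝟙 (K.obj g)) (δ K h k)).iso _ _).hom ≫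
              (S.ι (K.obj g) (K.obj h ⊗ K.obj k)).mapL (idIso Ψ (𝟙 (K.obj g)) rfl _).hom _ ≫
                (S.ι (K.obj g) (K.obj h ⊗ K.obj k)).mapR _ ((mul h k).iso Y Z).hom =
      (compIso Ψ (δ K (g ⊗ h) k)
          ((δ K g h ⊗ₘ 𝟙 (K.obj k)) ≫ (α_ (K.obj g) (K.obj h) (K.obj k)).hom) _ rfl _).hom ≫
        (compIso Ψ (δ K g h ⊗ₘ 𝟙 (K.obj k)) (α_ (K.obj g) (K.obj h) (K.obj k)).hom _ rfl _).hom ≫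
          (fn Ψ (α_ (K.obj g) (K.obj h) (K.obj k)).hom).map
            ((fn Ψ (δ K g h ⊗ₘ 𝟙 (K.obj k))).map ((mul (g ⊗ h) k).iso (X ⊗ Y : C) Z).hom ≫
              ((S.natural (δ K g h) (𝟙 (K.obj k))).iso _ _).hom ≫
                (S.ι (K.obj g ⊗ K.obj h) (K.obj k)).mapL ((mul g h).iso X Y).hom _ ≫
                  (S.ι (K.obj g ⊗ K.obj h) (K.obj k)).mapR _ (idIso Ψ (𝟙 (K.obj k)) rfl _).hom) ≫
            ((S.assoc (K.obj g) (K.obj h) (K.obj k)).iso _ _ _).hom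
  one_mul (g : H) (X Y : C) :
    (fn Ψ (λ_ (K.obj g)).inv).map (Bimod.Hom.left (Φ g) X Y).hom ≫
        ((S.unitLeft (K.obj g)).iso X _).hom ≫
          (S.ι (𝟙_ G) (K.obj g)).mapL ((Bimod.Hom₂.iso one).hom.app X) _ =
      (compIso Ψ (K.map (λ_ g).inv) (δ K (𝟙_ H) g ≫ (η K ⊗ₘ 𝟙 (K.obj g))) (λ_ (K.obj g)).inv
          (by simp) _).hom ≫
        (compIso Ψ (δ K (𝟙_ H) g) (η K ⊗ₘ 𝟙 (K.obj g)) _ rfl _).hom ≫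
          (fn Ψ (η K ⊗ₘ 𝟙 (K.obj g))).map
            ((fn Ψ (δ K (𝟙_ H) g)).map
                ((Bimod.Hom₂.iso (natural (λ_ g).inv)).hom.app (X ⊗ Y : C)) ≫
              ((mul (𝟙_ H) g).iso X Y).hom) ≫
            ((S.natural (η K) (𝟙 (K.obj g))).iso _ _).hom ≫
              (S.ι (𝟙_ G) (K.obj g)).mapR _ (idIso Ψ (𝟙 (K.obj g)) rfl _).hom
  mul_one (g : H) (X Y : C) :
    (fn Ψ (ρ_ (K.obj g)).inv).map (Bimod.Hom.right (Φ g) X Y).hom ≫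
        ((S.unitRight (K.obj g)).iso _ Y).hom ≫
          (S.ι (K.obj g) (𝟙_ G)).mapR _ ((Bimod.Hom₂.iso one).hom.app Y) =
      (compIso Ψ (K.map (ρ_ g).inv) (δ K g (𝟙_ H) ≫ (𝟙 (K.obj g) ⊗ₘ η K)) (ρ_ (K.obj g)).inv
          (by simp) _).hom ≫
        (compIso Ψ (δ K g (𝟙_ H)) (𝟙 (K.obj g) ⊗ₘ η K) _ rfl _).hom ≫
          (fn Ψ (𝟙 (K.obj g) ⊗ₘ η K)).map
            ((fn Ψ (δ K g (𝟙_ H))).map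
                ((Bimod.Hom₂.iso (natural (ρ_ g).inv)).hom.app (X ⊗ Y : C)) ≫
              ((mul g (𝟙_ H)).iso X Y).hom) ≫
            ((S.natural (𝟙 (K.obj g)) (η K)).iso _ _).hom ≫
              (S.ι (K.obj g) (𝟙_ G)).mapL (idIso Ψ (𝟙 (K.obj g)) rfl _).hom _

/-- The functor `g ↦ (K g, Φ g)` to the homotopy fiber over the unit object defined by a null
homotopy. -/
def NullHomotopy.lift {H G : Type*} [Category H] [MonoidalCategory H] [Category G]
    [MonoidalCategory G] {K : H ⥤ G} [K.Monoidal]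
    {Ψ : Pseudofunctor (LocallyDiscrete G) (Bimod.{v, u} C)} {S : MonoidalStructure Ψ}
    (N : NullHomotopy K Ψ S) : H ⥤ HomotopyFiber Ψ (regular C) where
  obj g := ⟨K.obj g, N.Φ g⟩
  map f := ⟨K.map f, N.natural f⟩
  map_id g := by
    refine HomotopyFiber.Hom.ext' (K.map_id g) (Bimod.hom₂_ext fun X => ?_)
    refine (N.natural_id g X).trans ?_
    exact congrArg (_ ≫ ·) (Category.comp_id _).symm
  map_comp f f' := by
    refine HomotopyFiber.Hom.ext' (K.map_comp f f') (Bimod.hom₂_ext fun X => ?_)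
    refine (N.natural_comp f f' X).trans ?_
    refine (Category.assoc _ _ _).trans (congrArg (_ ≫ ·) ?_)
    exact congrArg (_ ≫ ·) (Category.id_comp _).symm

end NullHomotopy

section ConjugationTensor

variable {C : Type u} [Category.{v} C] [MonoidalCategory C] [RightRigidCategory C]

/-- The canonical morphism `F_{g ⊗ h} X ⟶ F_g (F_h X)`, composed of the canonical isomorphism
`(g ⊗ h)* ≅ h* ⊗ g*` and associativity isomorphisms. -/
def InvObj.conjTensor (g h : InvObj C) (X : C) :
    (g.obj ⊗ h.obj) ⊗ (X ⊗ (g.obj ⊗ h.obj)ᘁ) ⟶ g.obj ⊗ ((h.obj ⊗ (X ⊗ h.objᘁ)) ⊗ g.objᘁ) :=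
  (g.obj ⊗ h.obj) ◁ (X ◁ (rightDualTensorIso g.obj h.obj).hom) ⊗≫ 𝟙 _

end ConjugationTensor

end FusionFiber

open FusionFiber

/-!
# The homotopy fiber sequence `Inv C ⟶ Eq C ⟶ Out C` of a fusion category

The underlying left module category of every `M_F` is the regular one, which is freely generated by
the unit object. Two things follow from this.

A balanced functor on `M × M_G` amounts to its restriction to `M × {𝟙}`, because the balancing
determines its value at `(m, X ⊗ 𝟙)` from that at `(m ⊗ X, 𝟙)`. Hence a balanced functor `B` on
`M × M_G` is universal as soon as `B (-, 𝟙)` is an equivalence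
(`Balanced.isUniversal_of_generator`). For `(m, n) ↦ m ⊗ F n` this functor is `m ↦ m ⊗ F 𝟙 ≅ m`, so
that `M_F ⊠ M_G ≃ M_{F ∘ G}`, and an inverse of `F` in `Eq C` provides an inverse of `M_F`. With
these universal functors the axioms for the homomorphism `M_-` become equations between morphisms of
`C`, which express that tensor autoequivalences and their isomorphisms are monoidal
(`twistMonoidal`).

An autoequivalence `φ` of the left module category `C` is `X ↦ X ⊗ d` with `d = φ 𝟙`. If `φ` is a
bimodule equivalence `C ⟶ M_F`, then `Y ⊗ d ≅ φ Y ≅ d ⊗ F Y` for all `Y`; taking `Y` with `φ Y ≅ 𝟙`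
shows that `d` is invertible, hence `d ≅ g*` for an invertible object `g`
(`InvObj.exists_trivialization`). Cancelling `g*` from `Y ⊗ g* ≅ g* ⊗ F Y` gives `F_g Y ≅ F Y`, and
the compatibility of `φ` with the two actions says that this isomorphism is monoidal and that it
carries `Φ_g` to `φ` (`InvObj.exists_conj_iso`). Therefore `g ↦ (F_g, Φ_g)` is essentially
surjective. A morphism `(F_g, Φ_g) ⟶ (F_h, Φ_h)` has a left linear 2-cell, with components `X ⊗ u`
for some `u : g* ≅ h*`, and `u` is `(f⁻¹)*` for a unique `f : g ≅ h`. As tensoring with `g*` is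
faithful, the compatibility with the right actions recovers the monoidal isomorphism of the morphism
from its 2-cell (`lift_hom_ext`), so that the functor is fully faithful.

The remaining constraints are built from the canonical isomorphisms `(g ⊗ h)* ≅ h* ⊗ g*` and
`𝟙* ≅ 𝟙`, which make `g ↦ F_g` monoidal (`conjugationMonoidal`), and from the inverses of the
evaluations `g* ⊗ g ⟶ 𝟙`, which give the isomorphisms
`X ⊗ Y ⊗ (g ⊗ h)* ≅ (X ⊗ g*) ⊗ F_g (Y ⊗ h*)` that make the `Φ_g` a monoidal pseudonatural
equivalence (`conjugationNullHomotopy`). Their coherence follows from the fact that a morphism into a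
dual is determined by the functional it induces (`hom_ext_evaluation`).
-/

/-! ### Categorical groups of invertible objects and tensor autoequivalences -/

namespace FusionFiber

section CategoricalGroups

/-- Every invertible object has the inverse witnessed by its definition, and every morphism of
invertible objects is an isomorphism of `C`. -/
lemma InvObj.isCategoricalGroup (C : Type u) [Category.{v} C] [MonoidalCategory C] :
    IsCategoricalGroup (InvObj C) where
  isGroupoid := ⟨fun f => (InvObj.mkIso (InvObj.Hom.iso f)).isIso_hom⟩
  exists_inverse g := by
    obtain ⟨h, ⟨a⟩, ⟨b⟩⟩ := g.invertible
    exact ⟨⟨h, g.obj, ⟨b⟩, ⟨a⟩⟩, ⟨InvObj.mkIso a⟩, ⟨InvObj.mkIso b⟩⟩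

variable {C : Type u} [Category.{v} C] [Abelian C] [Linear ℂ C] [MonoidalCategory C]

/-- The inverse of a tensor autoequivalence is a tensor autoequivalence: its monoidal structure is
transported along the adjunction. -/
lemma TensorAut.exists_inverse (F : TensorAut C) :
    ∃ F' : TensorAut C, Nonempty (F ⊗ F' ≅ 𝟙_ _) ∧ Nonempty (F' ⊗ F ≅ 𝟙_ _) := by
  obtain ⟨e, he⟩ : ∃ e : C ≌ C, e.functor = F.functor := ⟨F.functor.asEquivalence, rfl⟩
  obtain ⟨functor⟩ := F
  obtain rfl : e.functor = functor := he
  let : e.inverse.Monoidal := e.inverseMonoidal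
  have : e.IsMonoidal := by
    dsimp only [Equivalence.IsMonoidal]
    exact Adjunction.instIsMonoidal _
  exact ⟨⟨e.inverse⟩, ⟨TensorAut.mkIso (F := TensorAut.tensor ⟨e.functor⟩ ⟨e.inverse⟩)
      (G := TensorAut.unit) e.counitIso
      (inferInstanceAs (NatTrans.IsMonoidal e.toAdjunction.counit))⟩,
    ⟨(TensorAut.mkIso (F := TensorAut.unit) (G := TensorAut.tensor ⟨e.inverse⟩ ⟨e.functor⟩)
      e.unitIso (inferInstanceAs (NatTrans.IsMonoidal e.toAdjunction.unit))).symm⟩⟩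

lemma TensorAut.isCategoricalGroup : IsCategoricalGroup (TensorAut C) where
  isGroupoid := ⟨fun θ => (TensorAut.mkIso (TensorAut.Hom.iso θ)
    (TensorAut.Hom.isMonoidal θ)).isIso_hom⟩
  exists_inverse := TensorAut.exists_inverse

end CategoricalGroups

end FusionFiber

/-! ### Universal balanced functors on free module categories -/

namespace FusionFiber

open scoped MonoidalLeftAction MonoidalRightAction

section Universality

variable {C : Type u} [Category.{v} C] [Abelian C] [Linear ℂ C] [MonoidalCategory C]

namespace Balanced

variable {M N : Bimod.{v, u} C}

section

variable {D : Type u} [Category.{v} D] [Preadditive D] [Linear ℂ D]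

lemma mapL_mapR (T : Balanced M N D) {m m' : M.carrier} (f : m ⟶ m') {n n' : N.carrier}
    (g : n ⟶ n') : T.mapL f n ≫ T.mapR m' g = T.mapR m g ≫ T.mapL f n' :=
  ((T.bifunctor.map f).naturality g).symm

lemma mapR_comp (T : Balanced M N D) (m : M.carrier) {n n' n'' : N.carrier} (f : n ⟶ n')
    (g : n' ⟶ n'') : T.mapR m (f ≫ g) = T.mapR m f ≫ T.mapR m g :=
  (T.bifunctor.obj m).map_comp f g

lemma Hom.natural_left {T T' : Balanced M N D} (a : T ⟶ T') {m m' : M.carrier} (f : m ⟶ m')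
    (n : N.carrier) : T.mapL f n ≫ ((Hom.trans a).app m').app n =
      ((Hom.trans a).app m).app n ≫ T'.mapL f n :=
  congrArg (fun t => t.app n) ((Hom.trans a).naturality f)

lemma Hom.natural_right {T T' : Balanced M N D} (a : T ⟶ T') (m : M.carrier) {n n' : N.carrier}
    (g : n ⟶ n') : T.mapR m g ≫ ((Hom.trans a).app m).app n' =
      ((Hom.trans a).app m).app n ≫ T'.mapR m g :=
  ((Hom.trans a).app m).naturality g

/-- Restriction `T ↦ T (-, e)` of balanced functors to an object `e` of the second factor. -/
@[simps] def restrict (M : Bimod.{v, u} C) {N : Bimod.{v, u} C} (e : N.carrier)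
    (D : Type u) [Category.{v} D] [Preadditive D] [Linear ℂ D] :
    Balanced M N D ⥤ LinearFunctors M.carrier D where
  obj T := ⟨T.bifunctor.flip.obj e, T.bilinear.additive_left e, T.bilinear.linear_left e⟩
  map a := ObjectProperty.homMk
    { app m := ((Hom.trans a).app m).app e
      naturality _ _ f := Hom.natural_left a f e }

variable {e : N.carrier}

section extend

variable {T T' : Balanced M N D}
  (τ : T.bifunctor.flip.obj e ⟶ T'.bifunctor.flip.obj e)

/-- The component at `(m, X ⊙ₗ e)` that the balancings force on an extension of `τ`. -/
def extendFree (m : M.carrier) (X : C) : T.val m (X ⊙ₗ e) ⟶ T'.val m (X ⊙ₗ e) :=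
  (T.bal m X e).inv ≫ τ.app (m ⊙ᵣ X) ≫ (T'.bal m X e).hom

lemma bal_extendFree (m : M.carrier) (X : C) :
    (T.bal m X e).hom ≫ extendFree τ m X = τ.app (m ⊙ᵣ X) ≫ (T'.bal m X e).hom := by
  simp [extendFree]

lemma extendFree_natural_left {m m' : M.carrier} (f : m ⟶ m') (X : C) :
    T.mapL f (X ⊙ₗ e) ≫ extendFree τ m' X = extendFree τ m X ≫ T'.mapL f (X ⊙ₗ e) := by
  rw [← cancel_epi (T.bal m X e).hom, ← reassoc_of% T.bal_natural_left, bal_extendFree,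
    reassoc_of% bal_extendFree, ← T'.bal_natural_left]
  exact τ.naturality_assoc (f ⊵ᵣ X) _

lemma extendFree_natural_right (m : M.carrier) {X X' : C} (x : X ⟶ X') :
    T.mapR m (x ⊵ₗ e) ≫ extendFree τ m X' = extendFree τ m X ≫ T'.mapR m (x ⊵ₗ e) := by
  rw [← cancel_epi (T.bal m X e).hom, ← reassoc_of% T.bal_natural, bal_extendFree,
    reassoc_of% bal_extendFree, ← T'.bal_natural]
  exact τ.naturality_assoc (m ⊴ᵣ x) _

variable [((MonoidalLeftAction.curriedAction C N.carrier).flip.obj e).IsEquivalence]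

variable (e) in
/-- A presentation `X ⊙ₗ e ≅ n` of an object of a module category generated by `e`. -/
noncomputable def presentation (n : N.carrier) :
    ((MonoidalLeftAction.curriedAction C N.carrier).flip.obj e).objPreimage n ⊙ₗ e ≅ n :=
  ((MonoidalLeftAction.curriedAction C N.carrier).flip.obj e).objObjPreimageIso n

variable (e) in
lemma exists_action_eq {X X' : C} (f : X ⊙ₗ e ⟶ X' ⊙ₗ e) : ∃ x : X ⟶ X', x ⊵ₗ e = f :=
  ((MonoidalLeftAction.curriedAction C N.carrier).flip.obj e).map_surjective f

/-- The component at `(m, n)` of the extension of `τ`. -/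
noncomputable def extendApp (m : M.carrier) (n : N.carrier) : T.val m n ⟶ T'.val m n :=
  T.mapR m (presentation e n).inv ≫ extendFree τ m _ ≫ T'.mapR m (presentation e n).hom

lemma mapR_extendApp (m : M.carrier) {n : N.carrier} {X : C} (i : X ⊙ₗ e ⟶ n) :
    T.mapR m i ≫ extendApp τ m n = extendFree τ m X ≫ T'.mapR m i := by
  obtain ⟨x, hx⟩ := exists_action_eq e (i ≫ (presentation e n).inv)
  have h := extendFree_natural_right τ m x
  rw [hx] at h
  rw [extendApp, ← Category.assoc, ← mapR_comp, reassoc_of% h, ← mapR_comp]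
  simp

lemma extendApp_natural_left {m m' : M.carrier} (f : m ⟶ m') (n : N.carrier) :
    T.mapL f n ≫ extendApp τ m' n = extendApp τ m n ≫ T'.mapL f n := by
  rw [← cancel_epi (T.mapR m (presentation e n).hom), reassoc_of% mapR_extendApp,
    ← reassoc_of% mapL_mapR, mapR_extendApp, ← mapL_mapR, reassoc_of% extendFree_natural_left]

lemma extendApp_natural_right (m : M.carrier) {n n' : N.carrier} (g : n ⟶ n') :
    T.mapR m g ≫ extendApp τ m n' = extendApp τ m n ≫ T'.mapR m g := by
  rw [← cancel_epi (T.mapR m (presentation e n).hom), reassoc_of% mapR_extendApp,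
    ← reassoc_of% mapR_comp, mapR_extendApp, ← mapR_comp]

lemma extendApp_bal (m : M.carrier) (Y : C) (n : N.carrier) :
    extendApp τ (m ⊙ᵣ Y) n ≫ (T'.bal m Y n).hom = (T.bal m Y n).hom ≫ extendApp τ m (Y ⊙ₗ n) := by
  let X := ((MonoidalLeftAction.curriedAction C N.carrier).flip.obj e).objPreimage n
  let i : X ⊙ₗ e ≅ n := presentation e n
  have h := mapR_extendApp τ m ((αₗ Y X e).hom ≫ Y ⊴ₗ i.hom)
  have h₁ : T.mapR (m ⊙ᵣ Y) i.hom ≫ (T.bal m Y n).hom =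
      (T.bal m Y (X ⊙ₗ e)).hom ≫ T.mapR m (Y ⊴ₗ i.hom) := T.bal_natural_right m Y i.hom
  have h₂ : T'.mapR (m ⊙ᵣ Y) i.hom ≫ (T'.bal m Y n).hom =
      (T'.bal m Y (X ⊙ₗ e)).hom ≫ T'.mapR m (Y ⊴ₗ i.hom) := T'.bal_natural_right m Y i.hom
  have h₃ : (T.bal m (Y ⊗ X) e).hom ≫ T.mapR m (αₗ Y X e).hom = T.mapL (αᵣ m Y X).hom e ≫
      (T.bal (m ⊙ᵣ Y) X e).hom ≫ (T.bal m Y (X ⊙ₗ e)).hom := T.bal_assoc m Y X e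
  have h₄ : (T'.bal m (Y ⊗ X) e).hom ≫ T'.mapR m (αₗ Y X e).hom = T'.mapL (αᵣ m Y X).hom e ≫
      (T'.bal (m ⊙ᵣ Y) X e).hom ≫ (T'.bal m Y (X ⊙ₗ e)).hom := T'.bal_assoc m Y X e
  have h₅ : T.mapL (αᵣ m Y X).hom e ≫ τ.app ((m ⊙ᵣ Y) ⊙ᵣ X) =
      τ.app (m ⊙ᵣ (Y ⊗ X)) ≫ T'.mapL (αᵣ m Y X).hom e := τ.naturality (αᵣ m Y X).hom
  have : IsIso (T.mapL (αᵣ m Y X).hom e) :=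
    inferInstanceAs (IsIso ((T.bifunctor.flip.obj e).map (αᵣ m Y X).hom))
  rw [← cancel_epi (T.mapR (m ⊙ᵣ Y) i.hom), ← cancel_epi (T.bal (m ⊙ᵣ Y) X e).hom,
    ← cancel_epi (T.mapL (αᵣ m Y X).hom e), reassoc_of% mapR_extendApp, h₂,
    reassoc_of% bal_extendFree, reassoc_of% h₅, ← reassoc_of% h₄, reassoc_of% h₁,
    ← reassoc_of% h₃, ← mapR_comp, ← reassoc_of% (mapR_comp T m), h, reassoc_of% bal_extendFree]

/-- The extension of a natural transformation `T (-, e) ⟶ T' (-, e)` to a morphism of balanced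
functors, when `e` freely generates the second factor as a left module category. -/
noncomputable def extend : T ⟶ T' where
  trans :=
    { app m :=
        { app n := extendApp τ m n
          naturality _ _ g := extendApp_natural_right τ m g }
      naturality _ _ f := by
        ext n
        exact extendApp_natural_left τ f n }
  bal := extendApp_bal τ

lemma extendApp_self (m : M.carrier) : extendApp τ m e = τ.app m := by
  have h₁ : (T.bal m (𝟙_ C) e).hom ≫ T.mapR m (λₗ e).hom = T.mapL (ρᵣ m).hom e := T.bal_unit m e
  have h₂ : (T'.bal m (𝟙_ C) e).hom ≫ T'.mapR m (λₗ e).hom = T'.mapL (ρᵣ m).hom e :=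
    T'.bal_unit m e
  have h := mapR_extendApp τ m (λₗ e).hom
  have : IsIso (T.mapL (ρᵣ m : m ⊙ᵣ (𝟙_ C) ≅ m).hom e) :=
    inferInstanceAs (IsIso ((T.bifunctor.flip.obj e).map (ρᵣ m : m ⊙ᵣ (𝟙_ C) ≅ m).hom))
  rw [← cancel_epi (T.mapL (ρᵣ m : m ⊙ᵣ (𝟙_ C) ≅ m).hom e)]
  refine Eq.trans ?_ (τ.naturality (ρᵣ m).hom).symm
  change _ = _ ≫ T'.mapL (ρᵣ m).hom e
  rw [← h₁, Category.assoc, h, reassoc_of% bal_extendFree, h₂]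

end extend

variable (M e D) in
lemma restrict_full [((MonoidalLeftAction.curriedAction C N.carrier).flip.obj e).IsEquivalence] :
    (restrict M e D).Full where
  map_surjective τ :=
    ⟨extend τ.hom, ObjectProperty.hom_ext _ (NatTrans.ext (funext (extendApp_self τ.hom)))⟩

variable (M e D) in
lemma restrict_faithful
    [((MonoidalLeftAction.curriedAction C N.carrier).flip.obj e).IsEquivalence] :
    (restrict M e D).Faithful where
  map_injective {T T'} a b h := by
    have h (m : M.carrier) : ((Hom.trans a).app m).app e = ((Hom.trans b).app m).app e :=
      congrArg (fun t => t.hom.app m) h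
    have h' (m : M.carrier) (X : C) :
        ((Hom.trans a).app m).app (X ⊙ₗ e) = ((Hom.trans b).app m).app (X ⊙ₗ e) := by
      rw [← cancel_epi (T.bal m X e).hom]
      exact (a.bal m X e).symm.trans ((congrArg (· ≫ _) (h _)).trans (b.bal m X e))
    ext m n
    have : IsIso (T.mapR m (presentation e n).hom) :=
      inferInstanceAs (IsIso ((T.bifunctor.obj m).map (presentation e n).hom))
    rw [← cancel_epi (T.mapR m (presentation e n).hom), Hom.natural_right, Hom.natural_right, h']

end

/-- A balanced functor `B` on `M × N` is universal if the left module category `N` is freely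
generated by an object `e` and `B (-, e)` is an equivalence: restriction along `e` identifies
balanced functors with functors on `M`. -/
lemma isUniversal_of_generator {A : Type u} [Category.{v} A] [Preadditive A] [Linear ℂ A]
    (B : Balanced M N A) (e : N.carrier)
    [((MonoidalLeftAction.curriedAction C N.carrier).flip.obj e).IsEquivalence]
    [(B.bifunctor.flip.obj e).IsEquivalence] : B.IsUniversal := by
  intro D _ _ _
  let U := B.bifunctor.flip.obj e
  have : U.Additive := B.bilinear.additive_left e
  have : U.Linear ℂ := B.bilinear.linear_left e
  have : (restrict M e D).Full := restrict_full M D e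
  have : (restrict M e D).Faithful := restrict_faithful M D e
  have : (B.postcomp D ⋙ restrict M e D).Faithful :=
    ⟨fun {G G'} a b h => by
      have h (m : M.carrier) : a.hom.app (U.obj m) = b.hom.app (U.obj m) :=
        congrArg (fun t => t.hom.app m) h
      refine ObjectProperty.hom_ext _ (NatTrans.ext (funext fun x => ?_))
      rw [← cancel_epi (G.obj.map (U.objObjPreimageIso x).hom), NatTrans.naturality,
        NatTrans.naturality, h]⟩
  have : (B.postcomp D ⋙ restrict M e D).Full :=
    ⟨fun {G G'} τ => by
      obtain ⟨a, ha⟩ := ((Functor.whiskeringLeft _ _ D).obj U).map_surjective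
        (X := G.obj) (Y := G'.obj) τ.hom
      exact ⟨ObjectProperty.homMk a, ObjectProperty.hom_ext _ ha⟩⟩
  have : (B.postcomp D ⋙ restrict M e D).EssSurj :=
    ⟨fun H => by
      have := H.property.1
      have := H.property.2
      let E := U.asEquivalence
      have : E.functor.Additive := inferInstanceAs U.Additive
      have : E.functor.Linear ℂ := inferInstanceAs (U.Linear ℂ)
      exact ⟨⟨E.inverse ⋙ H.obj, inferInstance, inferInstance⟩,
        ⟨ObjectProperty.isoMk _ (Functor.isoWhiskerRight E.unitIso.symm H.obj ≪≫
          H.obj.leftUnitor)⟩⟩⟩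
  have : (B.postcomp D ⋙ restrict M e D).IsEquivalence := {}
  have : (restrict M e D).EssSurj :=
    ⟨fun H => ⟨(B.postcomp D).obj ((B.postcomp D ⋙ restrict M e D).objPreimage H),
      ⟨(B.postcomp D ⋙ restrict M e D).objObjPreimageIso H⟩⟩⟩
  have : (restrict M e D).IsEquivalence := {}
  exact Functor.isEquivalence_of_comp_right (B.postcomp D) (restrict M e D)

end Balanced

end Universality

end FusionFiber

/-! ### The bimodule categories `M_F` and their relative tensor products -/

namespace FusionFiber

open scoped MonoidalLeftAction MonoidalRightAction

section Invertibility

open Functor.LaxMonoidal Functor.OplaxMonoidal Functor.Monoidal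

variable {C : Type u} [Category.{v} C] [Abelian C] [Linear ℂ C] [MonoidalCategory C]

/-- The composition of a pairing with a bimodule equivalence. -/
def Pairing.comp {M N P Q : Bimod.{v, u} C} (B : Pairing M N P) (h : P ⟶ Q) : Pairing M N Q where
  toBalanced := (B.toBalanced.postcomp Q.carrier).obj
    ⟨Bimod.Hom.functor h, Bimod.Hom.additive h, Bimod.Hom.linear h⟩
  left X m n := (Bimod.Hom.functor h).mapIso (B.left X m n) ≪≫ Bimod.Hom.left h X _
  right m n Y := (Bimod.Hom.functor h).mapIso (B.right m n Y) ≪≫ Bimod.Hom.right h _ Y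
  left_natural_left f m n := by
    change (Bimod.Hom.functor h).map _ ≫ (Bimod.Hom.functor h).map _ ≫ _ =
      ((Bimod.Hom.functor h).map _ ≫ _) ≫ f ⊵ₗ (Bimod.Hom.functor h).obj (B.val m n)
    rw [← Functor.map_comp_assoc, B.left_natural_left, Functor.map_comp_assoc, Category.assoc,
      Bimod.Hom.left_natural_left h]
  left_natural X m m' f n := by
    change (Bimod.Hom.functor h).map _ ≫ (Bimod.Hom.functor h).map _ ≫ _ =
      ((Bimod.Hom.functor h).map _ ≫ _) ≫ X ⊴ₗ (Bimod.Hom.functor h).map (B.mapL f n)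
    rw [← Functor.map_comp_assoc, B.left_natural, Functor.map_comp_assoc, Category.assoc,
      Bimod.Hom.left_natural h]
  left_natural_right X m n n' f := by
    change (Bimod.Hom.functor h).map _ ≫ (Bimod.Hom.functor h).map _ ≫ _ =
      ((Bimod.Hom.functor h).map _ ≫ _) ≫ X ⊴ₗ (Bimod.Hom.functor h).map (B.mapR m f)
    rw [← Functor.map_comp_assoc, B.left_natural_right, Functor.map_comp_assoc, Category.assoc,
      Bimod.Hom.left_natural h]
  right_natural_left f n Y := by
    change (Bimod.Hom.functor h).map _ ≫ (Bimod.Hom.functor h).map _ ≫ _ =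
      ((Bimod.Hom.functor h).map _ ≫ _) ≫ (Bimod.Hom.functor h).map (B.mapL f n) ⊵ᵣ Y
    rw [← Functor.map_comp_assoc, B.right_natural_left, Functor.map_comp_assoc, Category.assoc,
      Bimod.Hom.right_natural h]
  right_natural m n n' f Y := by
    change (Bimod.Hom.functor h).map _ ≫ (Bimod.Hom.functor h).map _ ≫ _ =
      ((Bimod.Hom.functor h).map _ ≫ _) ≫ (Bimod.Hom.functor h).map (B.mapR m f) ⊵ᵣ Y
    rw [← Functor.map_comp_assoc, B.right_natural, Functor.map_comp_assoc, Category.assoc,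
      Bimod.Hom.right_natural h]
  right_natural_right m n Y Y' f := by
    change (Bimod.Hom.functor h).map _ ≫ (Bimod.Hom.functor h).map _ ≫ _ =
      ((Bimod.Hom.functor h).map _ ≫ _) ≫ (Bimod.Hom.functor h).obj (B.val m n) ⊴ᵣ f
    rw [← Functor.map_comp_assoc, B.right_natural_right, Functor.map_comp_assoc, Category.assoc,
      Bimod.Hom.right_natural_right h]
  left_assoc X X' m n := by
    change (Bimod.Hom.functor h).map _ ≫ ((Bimod.Hom.functor h).map _ ≫ _) ≫
        X ⊴ₗ ((Bimod.Hom.functor h).map _ ≫ _) =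
      ((Bimod.Hom.functor h).map _ ≫ _) ≫ (αₗ X X' ((Bimod.Hom.functor h).obj (B.val m n))).hom
    rw [MonoidalLeftAction.actionHomRight_comp, Category.assoc, Category.assoc,
      ← reassoc_of% Bimod.Hom.left_natural h, ← Bimod.Hom.left_assoc h,
      ← Functor.map_comp_assoc, ← Functor.map_comp_assoc, ← Functor.map_comp_assoc,
      Category.assoc, B.left_assoc]
  right_assoc m n Y Y' := by
    change (Bimod.Hom.functor h).map _ ≫ ((Bimod.Hom.functor h).map _ ≫ _) ≫
        ((Bimod.Hom.functor h).map _ ≫ _) ⊵ᵣ Y' =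
      ((Bimod.Hom.functor h).map _ ≫ _) ≫ (αᵣ ((Bimod.Hom.functor h).obj (B.val m n)) Y Y').hom
    rw [MonoidalRightAction.comp_actionHomLeft, Category.assoc, Category.assoc,
      ← reassoc_of% Bimod.Hom.right_natural h, ← Bimod.Hom.right_assoc h,
      ← Functor.map_comp_assoc, ← Functor.map_comp_assoc, ← Functor.map_comp_assoc,
      Category.assoc, B.right_assoc]
  left_unit m n := by
    change ((Bimod.Hom.functor h).map _ ≫ _) ≫ (λₗ ((Bimod.Hom.functor h).obj (B.val m n))).hom =
      (Bimod.Hom.functor h).map _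
    rw [Category.assoc, Bimod.Hom.left_unit h, ← Functor.map_comp, B.left_unit]
  right_unit m n := by
    change ((Bimod.Hom.functor h).map _ ≫ _) ≫ (ρᵣ ((Bimod.Hom.functor h).obj (B.val m n))).hom =
      (Bimod.Hom.functor h).map _
    rw [Category.assoc, Bimod.Hom.right_unit h, ← Functor.map_comp, B.right_unit]
  middle X m n Y := by
    change ((Bimod.Hom.functor h).map _ ≫ _) ≫ ((Bimod.Hom.functor h).map _ ≫ _) ⊵ᵣ Y ≫
        (Q.middle X ((Bimod.Hom.functor h).obj (B.val m n)) Y).hom =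
      ((Bimod.Hom.functor h).map _ ≫ _) ≫ X ⊴ₗ ((Bimod.Hom.functor h).map _ ≫ _)
    rw [MonoidalRightAction.comp_actionHomLeft, MonoidalLeftAction.actionHomRight_comp,
      Category.assoc, Category.assoc, Category.assoc,
      ← reassoc_of% Bimod.Hom.right_natural h, ← reassoc_of% Bimod.Hom.left_natural h]
    rw [← Bimod.Hom.middle h, ← Functor.map_comp_assoc, ← Functor.map_comp_assoc,
      ← Functor.map_comp_assoc, Category.assoc, B.middle]
  left_bal X m Y n := by
    change (Bimod.Hom.functor h).map _ ≫ ((Bimod.Hom.functor h).map _ ≫ _) ≫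
        X ⊴ₗ ((Bimod.Hom.functor h).map _) =
      (Bimod.Hom.functor h).map _ ≫ (Bimod.Hom.functor h).map _ ≫ _
    rw [Category.assoc, ← Bimod.Hom.left_natural h, ← Functor.map_comp_assoc,
      ← Functor.map_comp_assoc, ← Functor.map_comp_assoc, Category.assoc, B.left_bal]
  right_bal m X n Y := by
    change ((Bimod.Hom.functor h).map _ ≫ _) ≫ ((Bimod.Hom.functor h).map _) ⊵ᵣ Y ≫
        (_ ≫ (Bimod.Hom.functor h).map _) =
      (Bimod.Hom.functor h).map _ ≫ (Bimod.Hom.functor h).map _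
    rw [Category.assoc, ← reassoc_of% Bimod.Hom.right_natural h]
    change (Bimod.Hom.functor h).map _ ≫ (Bimod.Hom.functor h).map _ ≫
        (Bimod.Hom.right h _ Y).hom ≫ (Bimod.Hom.right h _ Y).inv ≫ _ =
      _
    rw [Iso.hom_inv_id_assoc, ← Functor.map_comp, ← Functor.map_comp, ← Functor.map_comp,
      B.right_bal]

variable [MonoidalPreadditive C] [MonoidalLinear ℂ C] [FiniteSemisimple C]

/-- The bimodule equivalence between the regular bimodule category and the twist by the identity
functor, which is the identity on underlying categories. -/
def regularTwist : regular C ⟶ twist (𝟙_ (TensorAut C)) where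
  functor := 𝟭 C
  additive := inferInstanceAs (𝟭 C).Additive
  linear := inferInstanceAs ((𝟭 C).Linear ℂ)
  isEquivalence := inferInstanceAs (𝟭 C).IsEquivalence
  left (X : C) (m : C) := Iso.refl (X ⊗ m)
  right (m : C) Y := Iso.refl (m ⊗ Y)
  left_natural_left {X X'} f (m : C) := (by simp : f ▷ m ≫ 𝟙 (X' ⊗ m) = 𝟙 (X ⊗ m) ≫ f ▷ m)
  left_natural (X : C) {m m' : C} (f : m ⟶ m') :=
    (by simp : X ◁ f ≫ 𝟙 (X ⊗ m') = 𝟙 (X ⊗ m) ≫ X ◁ f)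
  right_natural {m m' : C} (f : m ⟶ m') Y :=
    (by simp : f ▷ Y ≫ 𝟙 (m' ⊗ Y) = 𝟙 (m ⊗ Y) ≫ f ▷ Y)
  right_natural_right (m : C) {Y Y'} f :=
    (by simp : m ◁ f ≫ 𝟙 (m ⊗ Y') = 𝟙 (m ⊗ Y) ≫ m ◁ f)
  left_assoc X X' (m : C) := by
    change (α_ X X' m).hom ≫ 𝟙 _ ≫ X ◁ 𝟙 _ = 𝟙 _ ≫ (α_ X X' m).hom
    simp
  right_assoc (m : C) Y Y' := by
    change (α_ m Y Y').inv ≫ 𝟙 _ ≫ 𝟙 _ ▷ Y' = 𝟙 _ ≫ m ◁ 𝟙 _ ≫ (α_ m Y Y').inv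
    simp
  left_unit (m : C) := (by simp : 𝟙 _ ≫ (λ_ m).hom = (λ_ m).hom)
  right_unit (m : C) := by
    change 𝟙 _ ≫ m ◁ 𝟙 _ ≫ (ρ_ m).hom = (ρ_ m).hom
    simp
  middle X (m : C) Y := by
    change (α_ X m Y).hom ≫ 𝟙 _ ≫ X ◁ 𝟙 _ = 𝟙 _ ≫ 𝟙 _ ▷ Y ≫ (α_ X m Y).hom
    simp

/-- The inverse of `regularTwist`, again the identity on underlying categories. -/
def twistRegular : twist (𝟙_ (TensorAut C)) ⟶ regular C where
  functor := 𝟭 C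
  additive := inferInstanceAs (𝟭 C).Additive
  linear := inferInstanceAs ((𝟭 C).Linear ℂ)
  isEquivalence := inferInstanceAs (𝟭 C).IsEquivalence
  left (X : C) (m : C) := Iso.refl (X ⊗ m)
  right (m : C) (Y : C) := Iso.refl (m ⊗ Y)
  left_natural_left {X X'} f (m : C) := (by simp : f ▷ m ≫ 𝟙 (X' ⊗ m) = 𝟙 (X ⊗ m) ≫ f ▷ m)
  left_natural (X : C) {m m' : C} (f : m ⟶ m') :=
    (by simp : X ◁ f ≫ 𝟙 (X ⊗ m') = 𝟙 (X ⊗ m) ≫ X ◁ f)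
  right_natural {m m' : C} (f : m ⟶ m') Y :=
    (by simp : f ▷ Y ≫ 𝟙 (m' ⊗ Y) = 𝟙 (m ⊗ Y) ≫ f ▷ Y)
  right_natural_right (m : C) {Y Y'} f :=
    (by simp : m ◁ f ≫ 𝟙 (m ⊗ Y') = 𝟙 (m ⊗ Y) ≫ m ◁ f)
  left_assoc X X' (m : C) := by
    change (α_ X X' m).hom ≫ 𝟙 _ ≫ X ◁ 𝟙 _ = 𝟙 _ ≫ (α_ X X' m).hom
    simp
  right_assoc (m : C) Y Y' := by
    change (m ◁ 𝟙 _ ≫ (α_ m Y Y').inv) ≫ 𝟙 _ ≫ 𝟙 _ ▷ Y' = 𝟙 _ ≫ (α_ m Y Y').inv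
    simp
  left_unit (m : C) := (by simp : 𝟙 _ ≫ (λ_ m).hom = (λ_ m).hom)
  right_unit (m : C) := by
    change 𝟙 _ ≫ (ρ_ m).hom = m ◁ 𝟙 _ ≫ (ρ_ m).hom
    simp
  middle X (m : C) Y := by
    change (α_ X m Y).hom ≫ 𝟙 _ ≫ X ◁ 𝟙 _ = 𝟙 _ ≫ 𝟙 _ ▷ Y ≫ (α_ X m Y).hom
    simp

/-- The left module category `C` is freely generated by the unit object. -/
lemma isEquivalence_act_unit :
    ((MonoidalLeftAction.curriedAction C (regular C).carrier).flip.obj (𝟙_ C)).IsEquivalence :=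
  (Functor.isEquivalence_of_iso (rightUnitorNatIso C).symm : (tensorRight (𝟙_ C)).IsEquivalence)

/-- The functor `m ↦ m ⊗ F 𝟙` is an equivalence, because `F 𝟙 ≅ 𝟙`. -/
lemma isEquivalence_twistPairing_unit (F G : TensorAut C) :
    ((twistPairing F G).bifunctor.flip.obj (𝟙_ C : C)).IsEquivalence :=
  (Functor.isEquivalence_of_iso ((rightUnitorNatIso C).symm ≪≫
    (tensoringRight C).mapIso (εIso F.functor)) :
    (tensorRight (F.functor.obj (𝟙_ C))).IsEquivalence)

/-- The balanced functor `(m, n) ↦ m ⊗ F n` exhibits `M_{F ∘ G}` as `M_F ⊠ M_G`. -/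
lemma twistPairing_isUniversal (F G : TensorAut C) :
    (twistPairing F G).toBalanced.IsUniversal := by
  have : ((MonoidalLeftAction.curriedAction C (twist G).carrier).flip.obj
    (𝟙_ C : C)).IsEquivalence := isEquivalence_act_unit
  have := isEquivalence_twistPairing_unit F G
  exact Balanced.isUniversal_of_generator _ (𝟙_ C : C)

/-- If `F ∘ G` is isomorphic to the identity, then the regular bimodule category is a relative
tensor product of `M_F` and `M_G`; hence every `M_F` is invertible. -/
lemma exists_pairing_regular (F G : TensorAut C) (e : F ⊗ G ≅ 𝟙_ (TensorAut C)) :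
    ∃ B : Pairing (twist F) (twist G) (regular C), B.toBalanced.IsUniversal := by
  have : ((MonoidalLeftAction.curriedAction C (twist G).carrier).flip.obj
    (𝟙_ C : C)).IsEquivalence := isEquivalence_act_unit
  have := isEquivalence_twistPairing_unit F G
  let h : twist (F ⊗ G) ⟶ regular C := twistMap e.hom ≫ twistRegular
  have : (((twistPairing F G).comp h).bifunctor.flip.obj (𝟙_ C : C)).IsEquivalence :=
    Functor.isEquivalence_trans ((twistPairing F G).bifunctor.flip.obj (𝟙_ C : C))
      (Bimod.Hom.functor h)
  exact ⟨(twistPairing F G).comp h, Balanced.isUniversal_of_generator _ (𝟙_ C : C)⟩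

/-- The identity functor as a module functor. -/
abbrev idLeftLinear (C : Type*) [Category* C] [MonoidalCategory C] (D : Type*) [Category* D]
    [MonoidalLeftAction C D] : (𝟭 D).LeftLinear C where
  μₗ X m := 𝟙 (X ⊙ₗ m)
  δₗ X m := 𝟙 (X ⊙ₗ m)
  μₗ_comp_δₗ := by simp
  δₗ_comp_μₗ := by simp

variable (C) in
lemma regular_isOuter : (regular C).IsOuter where
  isInvertible := by
    have := isEquivalence_act_unit (C := C)
    have : ((actL (regular C)).bifunctor.flip.obj (𝟙_ C : C)).IsEquivalence := this
    have := Balanced.isUniversal_of_generator (actL (regular C)).toBalanced (𝟙_ C : C)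
    exact ⟨regular C, ⟨_, this⟩, ⟨_, this⟩⟩
  isLeftTrivial := ⟨𝟭 C, inferInstanceAs (𝟭 C).IsEquivalence, inferInstanceAs (𝟭 C).Additive,
    inferInstanceAs ((𝟭 C).Linear ℂ), ⟨idLeftLinear C (regular C).carrier⟩⟩

lemma twist_isOuter (F : TensorAut C) : (twist F).IsOuter where
  isInvertible := by
    obtain ⟨F', ⟨e⟩, ⟨e'⟩⟩ := F.exists_inverse
    exact ⟨twist F', exists_pairing_regular F F' e, exists_pairing_regular F' F e'⟩
  isLeftTrivial := (regular_isOuter C).isLeftTrivial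

end Invertibility

end FusionFiber

/-! ### `M_-` as a homomorphism of categorical 2-groups -/

namespace FusionFiber

open scoped MonoidalLeftAction MonoidalRightAction

section TwistMonoidal

open Functor.LaxMonoidal Functor.OplaxMonoidal Functor.Monoidal Family

variable {C : Type u} [Category.{v} C] [Abelian C] [Linear ℂ C] [MonoidalCategory C]

lemma TensorAut.app_δ {F G : TensorAut C} (θ : F ⟶ G) (X Y : C) :
    (Hom.iso θ).hom.app (X ⊗ Y) ≫ δ G.functor X Y =
      δ F.functor X Y ≫ F.functor.obj X ◁ (Hom.iso θ).hom.app Y ≫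
        (Hom.iso θ).hom.app X ▷ G.functor.obj Y := by
  rw [← cancel_epi (μ F.functor X Y), μ_δ_assoc, NatTrans.IsMonoidal.tensor_assoc, μ_δ,
    Category.comp_id, MonoidalCategory.tensorHom_def']

variable [MonoidalPreadditive C] [MonoidalLinear ℂ C] [FiniteSemisimple C]

/-- The bimodule equivalences `M_θ` all have the identity as underlying functor, so the composition
constraints of `M_-` have identity components. -/
lemma twistPseudofunctor_compIso {F F' F'' : TensorAut C} (θ : F ⟶ F') (η : F' ⟶ F'')
    (κ : F ⟶ F'') (h : θ ≫ η = κ)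
    (m : (value (twistPseudofunctor C) F).carrier) :
    (compIso (twistPseudofunctor C) θ η κ h m).hom = (𝟙 m : m ⟶ m) := by
  subst h
  have := (twistPseudofunctor C).mapComp'_eq_mapComp θ.toLoc η.toLoc
  exact (congrArg (fun t => (Bimod.Hom₂.iso t.hom).hom.app m) this).trans rfl

/-- The unit constraints of `M_-` have identity components. -/
lemma twistPseudofunctor_idIso {F : TensorAut C} (θ : F ⟶ F) (h : θ = 𝟙 F)
    (m : (value (twistPseudofunctor C) F).carrier) :
    (idIso (twistPseudofunctor C) θ h m).hom = (𝟙 m : m ⟶ m) := by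
  subst h
  have := (twistPseudofunctor C).mapId'_eq_mapId ⟨F⟩
  exact (congrArg (fun t => (Bimod.Hom₂.iso t.hom).hom.app m) this).trans rfl

/-- The pseudonaturality of the pairings `(m, n) ↦ m ⊗ F n` in `F` and `G`. -/
def twistSquare {F₁ F₂ F₁' F₂' : TensorAut C} (θ : F₁ ⟶ F₂) (θ' : F₁' ⟶ F₂') :
    Square (twistMap θ) (twistMap θ') (twistMap (θ ⊗ₘ θ')) (twistPairing F₁ F₁')
      (twistPairing F₂ F₂') where
  iso (m : C) (n : C) := whiskerLeftIso m (TensorAut.app θ n)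
  natural_left {m m' : C} a (n : C) := (whisker_exchange (C := C) _ _).symm
  natural_right (m : C) {n n' : C} (a : n ⟶ n') := by
    change m ◁ F₁.functor.map a ≫ m ◁ (TensorAut.Hom.iso θ).hom.app n' =
      m ◁ (TensorAut.Hom.iso θ).hom.app n ≫ m ◁ F₂.functor.map a
    rw [← MonoidalCategory.whiskerLeft_comp, ← MonoidalCategory.whiskerLeft_comp,
      NatTrans.naturality]
  bal (m : C) X (n : C) := by
    change ((α_ m _ _).hom ≫ m ◁ μ F₁.functor X n) ≫ m ◁ (TensorAut.Hom.iso θ).hom.app (X ⊗ n) ≫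
      m ◁ F₂.functor.map (𝟙 _) = (m ⊗ F₁.functor.obj X) ◁ (TensorAut.Hom.iso θ).hom.app n ≫
      (m ◁ (TensorAut.Hom.iso θ).hom.app X) ▷ F₂.functor.obj n ≫ (α_ m _ _).hom ≫
        m ◁ μ F₂.functor X n
    rw [CategoryTheory.Functor.map_id, MonoidalCategory.whiskerLeft_id, Category.comp_id,
      Category.assoc, ← MonoidalCategory.whiskerLeft_comp, NatTrans.IsMonoidal.tensor,
      MonoidalCategory.tensorHom_def']
    simp
  left X (m : C) (n : C) := by
    change (α_ X m _).hom ≫ 𝟙 _ ≫ X ◁ m ◁ (TensorAut.Hom.iso θ).hom.app n =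
      (X ⊗ m) ◁ (TensorAut.Hom.iso θ).hom.app n ≫ 𝟙 _ ▷ _ ≫ (α_ X m _).hom
    simp
  right (m : C) (n : C) Y := by
    change (m ◁ δ F₁.functor n (F₁'.functor.obj Y) ≫ (α_ _ _ _).inv) ≫
      (m ⊗ F₁.functor.obj n) ◁ ((TensorAut.Hom.iso θ).hom.app (F₁'.functor.obj Y) ≫
        F₂.functor.map ((TensorAut.Hom.iso θ').hom.app Y)) ≫
        (m ◁ (TensorAut.Hom.iso θ).hom.app n) ▷ _ =
      m ◁ (TensorAut.Hom.iso θ).hom.app (n ⊗ F₁'.functor.obj Y) ≫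
        m ◁ F₂.functor.map (n ◁ (TensorAut.Hom.iso θ').hom.app Y) ≫
          m ◁ δ F₂.functor n (F₂'.functor.obj Y) ≫ (α_ _ _ _).inv
    have h : δ F₁.functor n (F₁'.functor.obj Y) ≫
        F₁.functor.obj n ◁ ((TensorAut.Hom.iso θ).hom.app (F₁'.functor.obj Y) ≫
          F₂.functor.map ((TensorAut.Hom.iso θ').hom.app Y)) ≫
            (TensorAut.Hom.iso θ).hom.app n ▷ _ =
        (TensorAut.Hom.iso θ).hom.app (n ⊗ F₁'.functor.obj Y) ≫
          F₂.functor.map (n ◁ (TensorAut.Hom.iso θ').hom.app Y) ≫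
            δ F₂.functor n (F₂'.functor.obj Y) := by
      rw [← δ_natural_right, reassoc_of% TensorAut.app_δ θ, MonoidalCategory.whiskerLeft_comp,
        Category.assoc, ← whisker_exchange]
    simp only [← MonoidalCategory.whiskerLeft_comp_assoc, Category.assoc, ← h]
    simp

/-- The associativity of the pairings `(m, n) ↦ m ⊗ F n`: the isomorphisms
`(l ⊗ F m) ⊗ F (G n) ≅ l ⊗ F (m ⊗ G n)` given by the tensor structure of `F`. -/
def twistAssoc (F G H : TensorAut C) :
    Assoc (twistPairing F G) (twistPairing (F ⊗ G) H) (twistPairing G H) (twistPairing F (G ⊗ H))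
      (twistMap (α_ F G H).hom) where
  iso (l : C) (m : C) (n : C) := show (l ⊗ F.functor.obj m) ⊗ F.functor.obj (G.functor.obj n) ≅
    l ⊗ F.functor.obj (m ⊗ G.functor.obj n) from α_ _ _ _ ≪≫ whiskerLeftIso l (μIso F.functor _ _)
  natural_left {l l' : C} (f : l ⟶ l') (m : C) (n : C) := by
    change (f ▷ F.functor.obj m) ▷ _ ≫ (α_ _ _ _).hom ≫ l' ◁ μ F.functor _ _ =
      ((α_ _ _ _).hom ≫ l ◁ μ F.functor _ _) ≫ f ▷ _
    rw [associator_naturality_left_assoc, ← whisker_exchange, Category.assoc]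
  natural_middle (l : C) {m m' : C} (f : m ⟶ m') (n : C) := by
    change (l ◁ F.functor.map f) ▷ _ ≫ (α_ _ _ _).hom ≫ l ◁ μ F.functor _ _ =
      ((α_ _ _ _).hom ≫ l ◁ μ F.functor _ _) ≫ l ◁ F.functor.map (f ▷ _)
    rw [associator_naturality_middle_assoc, ← MonoidalCategory.whiskerLeft_comp, μ_natural_left,
      MonoidalCategory.whiskerLeft_comp, Category.assoc]
  natural_right (l : C) (m : C) {n n' : C} (f : n ⟶ n') := by
    change (l ⊗ F.functor.obj m) ◁ F.functor.map (G.functor.map f) ≫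
      (α_ _ _ _).hom ≫ l ◁ μ F.functor _ _ =
      ((α_ _ _ _).hom ≫ l ◁ μ F.functor _ _) ≫ l ◁ F.functor.map (m ◁ G.functor.map f)
    rw [associator_naturality_right_assoc, ← MonoidalCategory.whiskerLeft_comp, μ_natural_right,
      MonoidalCategory.whiskerLeft_comp, Category.assoc]
  bal₁ (l : C) X (m : C) (n : C) := by
    change ((α_ _ _ _).hom ≫ l ◁ μ F.functor X m) ▷ F.functor.obj (G.functor.obj n) ≫
      ((α_ _ _ _).hom ≫ l ◁ μ F.functor _ _) ≫ l ◁ F.functor.map (α_ X m (G.functor.obj n)).hom =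
      ((α_ _ _ _).hom ≫ _ ◁ μ F.functor _ _) ≫ (α_ _ _ _).hom ≫ l ◁ μ F.functor X _
    have h := Functor.LaxMonoidal.associativity F.functor X m (G.functor.obj n)
    simp only [comp_whiskerRight, whisker_assoc, Category.assoc, Iso.inv_hom_id_assoc,
      ← MonoidalCategory.whiskerLeft_comp, h]
    simp
  bal₂ (l : C) (m : C) X (n : C) := by
    change ((l ◁ δ F.functor m (G.functor.obj X) ≫ (α_ _ _ _).inv) ▷ _ ≫
      (α_ _ _ _).hom ≫ _ ◁ (μ F.functor _ _ ≫ F.functor.map (μ G.functor X n))) ≫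
      (α_ _ _ _).hom ≫ l ◁ μ F.functor _ _ =
      ((α_ _ _ _).hom ≫ l ◁ μ F.functor _ _) ≫
        l ◁ F.functor.map ((α_ _ _ _).hom ≫ m ◁ μ G.functor X n)
    have h := Functor.LaxMonoidal.associativity F.functor m (G.functor.obj X) (G.functor.obj n)
    have h' : δ F.functor m (G.functor.obj X) ▷ F.functor.obj (G.functor.obj n) ≫ (α_ _ _ _).hom ≫
        F.functor.obj m ◁ (μ F.functor _ _ ≫ F.functor.map (μ G.functor X n)) ≫ μ F.functor _ _ =
        μ F.functor _ _ ≫ F.functor.map ((α_ _ _ _).hom ≫ m ◁ μ G.functor X n) := by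
      rw [MonoidalCategory.whiskerLeft_comp, Category.assoc, μ_natural_right, ← reassoc_of% h,
        ← comp_whiskerRight_assoc, δ_μ, id_whiskerRight, Category.id_comp, Functor.map_comp]
    conv_rhs => rw [Category.assoc, ← MonoidalCategory.whiskerLeft_comp, ← h']
    monoidal
  left X (l : C) (m : C) (n : C) := by
    change ((α_ X l _).hom ▷ _ ≫ (α_ X _ _).hom) ≫ 𝟙 _ ≫
      X ◁ ((α_ _ _ _).hom ≫ l ◁ μ F.functor m (G.functor.obj n)) =
      ((α_ _ _ _).hom ≫ _ ◁ μ F.functor _ _) ≫ (α_ X _ _).hom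
    simp
  right (l : C) (m : C) (n : C) Y := by
    change (_ ◁ (F.functor.map (δ G.functor n (H.functor.obj Y)) ≫ δ F.functor _ _) ≫
        (α_ _ _ _).inv) ≫
      ((l ⊗ F.functor.obj m) ⊗ F.functor.obj (G.functor.obj n)) ◁ 𝟙 _ ≫
        ((α_ _ _ _).hom ≫ l ◁ μ F.functor _ _) ▷ _ =
      ((α_ _ _ _).hom ≫ l ◁ μ F.functor _ _) ≫
        l ◁ F.functor.map (m ◁ δ G.functor n (H.functor.obj Y) ≫ (α_ _ _ _).inv) ≫
          (l ◁ δ F.functor _ _ ≫ (α_ _ _ _).inv)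
    have h := Functor.LaxMonoidal.associativity_inv F.functor m (G.functor.obj n)
      (G.functor.obj (H.functor.obj Y))
    have h' : F.functor.obj m ◁ (F.functor.map (δ G.functor n (H.functor.obj Y)) ≫
          δ F.functor _ _) ≫ (α_ _ _ _).inv ≫ μ F.functor _ _ ▷ _ =
        μ F.functor _ _ ≫
          F.functor.map (m ◁ δ G.functor n (H.functor.obj Y) ≫ (α_ _ _ _).inv) ≫
            δ F.functor _ _ := by
      rw [Functor.map_comp, Category.assoc, ← μ_natural_right_assoc,
        MonoidalCategory.whiskerLeft_comp, Category.assoc, ← cancel_mono (μ F.functor _ _)]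
      simp only [Category.assoc, δ_μ, Category.comp_id]
      congr 1
      rw [← cancel_epi (F.functor.obj m ◁ μ F.functor _ _), h,
        ← MonoidalCategory.whiskerLeft_comp_assoc, μ_δ, MonoidalCategory.whiskerLeft_id,
        Category.id_comp]
    conv_rhs => rw [Category.assoc, ← MonoidalCategory.whiskerLeft_comp_assoc,
      ← MonoidalCategory.whiskerLeft_comp_assoc, Category.assoc, ← h']
    simp

/-- The compatibility of `(m, n) ↦ m ⊗ n` with the left action of the unit bimodule category; its
components are identities. -/
def twistUnitLeft (F : TensorAut C) :
    Square regularTwist (𝟙 (twist F)) (twistMap (λ_ F).inv) (actL _) (twistPairing (𝟙_ _) F) where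
  iso (m : C) (n : C) := Iso.refl (m ⊗ n)
  natural_left {m m' : C} (a : m ⟶ m') (n : C) := by
    change a ▷ n ≫ 𝟙 _ = 𝟙 _ ≫ a ▷ n
    simp
  natural_right (m : C) {n n' : C} (a : n ⟶ n') := by
    change m ◁ a ≫ 𝟙 _ = 𝟙 _ ≫ m ◁ a
    simp
  bal (m : C) X (n : C) := by
    change (α_ _ _ _).hom ≫ 𝟙 _ ≫ m ◁ 𝟙 (X ⊗ n) = 𝟙 _ ≫ 𝟙 _ ▷ n ≫ (α_ m X n).hom ≫ m ◁ 𝟙 _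
    simp
  left X (m : C) (n : C) := by
    change (α_ _ _ _).hom ≫ 𝟙 _ ≫ X ◁ 𝟙 (m ⊗ n) = 𝟙 _ ≫ 𝟙 _ ▷ n ≫ (α_ X m n).hom
    simp
  right (m : C) (n : C) Y := by
    change (α_ _ _ _).inv ≫ _ ◁ 𝟙 (F.functor.obj Y) ≫ 𝟙 (m ⊗ n) ▷ _ =
      𝟙 _ ≫ m ◁ 𝟙 _ ≫ m ◁ 𝟙 _ ≫ (α_ m n _).inv
    simp

/-- The compatibility of `(m, n) ↦ m ⊗ F n` with the right action on `M_F`; its components are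
identities, because `m ⊙ᵣ n` is `m ⊗ F n` by definition. -/
def twistUnitRight (F : TensorAut C) :
    Square (𝟙 (twist F)) regularTwist (twistMap (ρ_ F).inv) (actR _) (twistPairing F (𝟙_ _)) where
  iso (m : C) (n : C) := Iso.refl (m ⊗ F.functor.obj n)
  natural_left {m m' : C} (a : m ⟶ m') (n : C) := by
    change a ▷ F.functor.obj n ≫ 𝟙 _ = 𝟙 _ ≫ a ▷ F.functor.obj n
    simp
  natural_right (m : C) {n n' : C} (a : n ⟶ n') := by
    change m ◁ F.functor.map a ≫ 𝟙 _ = 𝟙 _ ≫ m ◁ F.functor.map a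
    simp
  bal (m : C) X (n : C) := by
    change ((α_ _ _ _).hom ≫ m ◁ μ F.functor X n) ≫ 𝟙 _ ≫ m ◁ F.functor.map (𝟙 (X ⊗ n)) =
      𝟙 _ ≫ 𝟙 _ ▷ F.functor.obj n ≫ (α_ _ _ _).hom ≫ m ◁ μ F.functor X n
    simp
  left X (m : C) (n : C) := by
    change (α_ _ _ _).hom ≫ 𝟙 _ ≫ X ◁ 𝟙 (m ⊗ F.functor.obj n) =
      𝟙 _ ≫ 𝟙 _ ▷ _ ≫ (α_ X m (F.functor.obj n)).hom
    simp
  right (m : C) (n : C) (Y : C) := by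
    change (m ◁ δ F.functor n Y ≫ (α_ _ _ _).inv) ≫ _ ◁ 𝟙 (F.functor.obj Y) ≫
        𝟙 (m ⊗ F.functor.obj n) ▷ _ =
      𝟙 _ ≫ m ◁ F.functor.map (𝟙 _) ≫ m ◁ δ F.functor n Y ≫ (α_ _ _ _).inv
    simp

variable (C) in
set_option maxHeartbeats 4000000 in
/-- The structure of a homomorphism of categorical 2-groups on `M_-`. Up to the constraints of
`M_-`, which have identity components, each axiom is an axiom of the monoidal functor `F`, or of a monoidal
natural isomorphism, whiskered with an object of `C`. -/
def twistMonoidal : MonoidalStructure (twistPseudofunctor C) where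
  ι F G := twistPairing F G
  universal F G := twistPairing_isUniversal F G
  natural θ θ' := twistSquare θ θ'
  natural_id F G (m : C) (n : C) := by
    refine Eq.trans (congrArg₂ (fun (a : m ⟶ m) (b : n ⟶ n) => m ◁ 𝟙 (F.functor.obj n) ≫
        a ▷ F.functor.obj n ≫ m ◁ F.functor.map b) (twistPseudofunctor_idIso (𝟙 F) rfl m)
          (twistPseudofunctor_idIso (𝟙 G) rfl n))
      (Eq.trans ?_ (twistPseudofunctor_idIso (𝟙 F ⊗ₘ 𝟙 G) (by simp) _).symm)
    change m ◁ 𝟙 _ ≫ 𝟙 m ▷ F.functor.obj n ≫ m ◁ F.functor.map (𝟙 n) = 𝟙 _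
    simp
  natural_comp {F₁ F₂ F₃ F₁' F₂' F₃'} θ η θ' η' (m : C) (n : C) := by
    refine Eq.trans (congrArg₂ (fun (a : m ⟶ m) (b : n ⟶ n) =>
        m ◁ ((TensorAut.Hom.iso θ).hom.app n ≫ (TensorAut.Hom.iso η).hom.app n) ≫
        a ▷ F₃.functor.obj n ≫ m ◁ F₃.functor.map b)
          (twistPseudofunctor_compIso θ η _ rfl m) (twistPseudofunctor_compIso θ' η' _ rfl n))
      (Eq.trans ?_ (congrArg (· ≫ _)
        (twistPseudofunctor_compIso (θ ⊗ₘ θ') (η ⊗ₘ η') _ (by simp) _).symm))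
    change m ◁ ((TensorAut.Hom.iso θ).hom.app n ≫ (TensorAut.Hom.iso η).hom.app n) ≫
      𝟙 m ▷ F₃.functor.obj n ≫ m ◁ F₃.functor.map (𝟙 n) = 𝟙 _ ≫
        m ◁ (TensorAut.Hom.iso θ).hom.app n ≫ m ◁ (TensorAut.Hom.iso η).hom.app n
    simp
  unit := regularTwist
  assoc F G H := twistAssoc F G H
  assoc_natural {F₁ F₂ F₁' F₂' F₁'' F₂''} θ θ' θ'' (l : C) (m : C) (n : C) := by
    refine Eq.trans (congrArg (· ≫ _) (twistPseudofunctor_compIso ((θ ⊗ₘ θ') ⊗ₘ θ'')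
        (α_ F₂ F₂' F₂'').hom _ rfl _)) (Eq.trans ?_
      (congrArg (· ≫ _) (twistPseudofunctor_compIso (α_ F₁ F₁' F₁'').hom (θ ⊗ₘ (θ' ⊗ₘ θ'')) _
        (associator_naturality θ θ' θ'').symm _).symm))
    change 𝟙 _ ≫ (_ ◁ ((TensorAut.Hom.iso θ).hom.app (F₁'.functor.obj n) ≫
        F₂.functor.map ((TensorAut.Hom.iso θ').hom.app n)) ≫
          (l ◁ (TensorAut.Hom.iso θ).hom.app m) ▷ _) ≫ (α_ _ _ _).hom ≫ l ◁ μ F₂.functor _ _ =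
      𝟙 _ ≫ ((α_ _ _ _).hom ≫ l ◁ μ F₁.functor _ _) ≫
        l ◁ (TensorAut.Hom.iso θ).hom.app (m ⊗ F₁'.functor.obj n) ≫
          l ◁ F₂.functor.map (m ◁ (TensorAut.Hom.iso θ').hom.app n)
    have h : F₁.functor.obj m ◁ ((TensorAut.Hom.iso θ).hom.app (F₁'.functor.obj n) ≫
        F₂.functor.map ((TensorAut.Hom.iso θ').hom.app n)) ≫
          (TensorAut.Hom.iso θ).hom.app m ▷ _ ≫ μ F₂.functor _ _ =
        μ F₁.functor _ _ ≫ (TensorAut.Hom.iso θ).hom.app (m ⊗ F₁'.functor.obj n) ≫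
          F₂.functor.map (m ◁ (TensorAut.Hom.iso θ').hom.app n) := by
      rw [NatTrans.IsMonoidal.tensor_assoc, ← μ_natural_right, MonoidalCategory.tensorHom_def',
        MonoidalCategory.whiskerLeft_comp, Category.assoc, Category.assoc,
        whisker_exchange_assoc]
    rw [Category.id_comp, Category.id_comp, Category.assoc _ (l ◁ μ F₁.functor _ _),
      ← MonoidalCategory.whiskerLeft_comp, ← MonoidalCategory.whiskerLeft_comp, ← h]
    monoidal
  unitLeft F := twistUnitLeft F
  unitLeft_natural {F F'} θ (X : C) (m : C) := by
    refine Eq.trans (congrArg (· ≫ _) (twistPseudofunctor_compIso θ (λ_ F').inv _ rfl _))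
      (Eq.trans ?_ (congrArg₂ (fun (a : X ⊗ m ⟶ X ⊗ m) (b : X ⟶ X) =>
          a ≫ 𝟙 (X ⊗ m) ≫ X ◁ 𝟙 m ≫ b ▷ m)
        (twistPseudofunctor_compIso (λ_ F).inv (𝟙 (𝟙_ _) ⊗ₘ θ) (θ ≫ (λ_ F').inv) (by simp) _)
        (twistPseudofunctor_idIso (𝟙 (𝟙_ (TensorAut C))) rfl X)).symm)
    change 𝟙 _ ≫ 𝟙 _ ≫ 𝟙 (X ⊗ m) = 𝟙 _ ≫ 𝟙 _ ≫ X ◁ 𝟙 m ≫ 𝟙 X ▷ m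
    simp
  unitRight F := twistUnitRight F
  unitRight_natural {F F'} θ (m : C) (X : C) := by
    refine Eq.trans (congrArg (· ≫ _) (twistPseudofunctor_compIso θ (ρ_ F').inv _ rfl _))
      (Eq.trans ?_ (congrArg₂ (fun (a : m ⊗ F.functor.obj X ⟶ m ⊗ F.functor.obj X) (b : X ⟶ X) =>
          a ≫ 𝟙 _ ≫ m ◁ (TensorAut.Hom.iso θ).hom.app X ≫ m ◁ F'.functor.map b)
        (twistPseudofunctor_compIso (ρ_ F).inv (θ ⊗ₘ 𝟙 (𝟙_ _)) (θ ≫ (ρ_ F').inv) (by simp) _)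
        (twistPseudofunctor_idIso (𝟙 (𝟙_ (TensorAut C))) rfl X)).symm)
    change 𝟙 _ ≫ m ◁ (TensorAut.Hom.iso θ).hom.app X ≫ 𝟙 _ = 𝟙 _ ≫ 𝟙 _ ≫
      m ◁ (TensorAut.Hom.iso θ).hom.app X ≫ m ◁ F'.functor.map (𝟙 X)
    simp
  pentagon F G H K (l : C) (m : C) (n : C) (p : C) := by
    let L := ((l ⊗ F.functor.obj m) ⊗ F.functor.obj (G.functor.obj n)) ⊗
      F.functor.obj (G.functor.obj (H.functor.obj p))
    have e₁ := twistPseudofunctor_compIso ((α_ F G H).hom ⊗ₘ 𝟙 K)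
      ((α_ F (G ⊗ H) K).hom ≫ (𝟙 F ⊗ₘ (α_ G H K).hom))
      ((α_ (F ⊗ G) H K).hom ≫ (α_ F G (H ⊗ K)).hom) (by simp) L
    have e₂ := twistPseudofunctor_compIso (α_ F (G ⊗ H) K).hom (𝟙 F ⊗ₘ (α_ G H K).hom) _ rfl L
    have e₃ := twistPseudofunctor_compIso (α_ (F ⊗ G) H K).hom (α_ F G (H ⊗ K)).hom _ rfl L
    have e₄ := twistPseudofunctor_idIso (𝟙 K) rfl p
    have e₅ := twistPseudofunctor_idIso (𝟙 F) rfl l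
    -- once the constraints of `M_-` are replaced by identities, this is the associativity of `μ`
    have key : ∀ (a b : L ⟶ L) (c : p ⟶ p) (d : l ⟶ l), a = 𝟙 _ → b = 𝟙 _ → c = 𝟙 _ → d = 𝟙 _ →
        a ≫ b ≫ ((_ ◁ 𝟙 (F.functor.obj (G.functor.obj (H.functor.obj p))) ≫
          ((α_ _ _ _).hom ≫ l ◁ μ F.functor m (G.functor.obj n)) ▷ _ ≫
            _ ◁ F.functor.map (G.functor.map (H.functor.map c))) ≫
              (α_ _ _ _).hom ≫ l ◁ μ F.functor _ _) ≫ l ◁ 𝟙 _ ≫ d ▷ _ ≫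
            l ◁ F.functor.map ((α_ m _ _).hom ≫ m ◁ μ G.functor n (H.functor.obj p)) =
          𝟙 _ ≫ ((α_ _ _ _).hom ≫ (l ⊗ F.functor.obj m) ◁
            μ (G.functor ⋙ F.functor) n (H.functor.obj p)) ≫
              (α_ _ _ _).hom ≫ l ◁ μ F.functor _ _ := by
      rintro _ _ _ _ rfl rfl rfl rfl
      have h : μ F.functor m (G.functor.obj n) ▷ F.functor.obj (G.functor.obj (H.functor.obj p)) ≫
          μ F.functor _ _ ≫ F.functor.map ((α_ m _ _).hom ≫ m ◁ μ G.functor n (H.functor.obj p)) =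
          (α_ _ _ _).hom ≫ F.functor.obj m ◁ (μ F.functor _ _ ≫ F.functor.map (μ G.functor _ _)) ≫
            μ F.functor _ _ := by
        rw [Functor.map_comp, Functor.LaxMonoidal.associativity_assoc,
          MonoidalCategory.whiskerLeft_comp, Category.assoc, μ_natural_right]
      have h' : μ (G.functor ⋙ F.functor) n (H.functor.obj p) =
        μ F.functor _ _ ≫ F.functor.map (μ G.functor _ _) := rfl
      rw [h']
      simp only [CategoryTheory.Functor.map_id, MonoidalCategory.whiskerLeft_id, id_whiskerRight,
        Category.id_comp, Category.comp_id]
      trans 𝟙 _ ⊗≫ l ◁ (μ F.functor m (G.functor.obj n) ▷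
          F.functor.obj (G.functor.obj (H.functor.obj p)) ≫
          μ F.functor _ _ ≫ F.functor.map ((α_ m _ _).hom ≫ m ◁ μ G.functor n (H.functor.obj p)))
      · simp only [Category.assoc]
        monoidal
      · rw [h]
        monoidal
    exact (key _ _ _ _ e₁ e₂ e₄ e₅).trans (congrArg (· ≫ _) e₃.symm)
  triangle F G (m : C) (X : C) (n : C) := by
    refine Eq.trans (congrArg₂ (fun (a : (m ⊗ F.functor.obj X) ⊗ F.functor.obj n ⟶
          (m ⊗ F.functor.obj X) ⊗ F.functor.obj n) (b : n ⟶ n) =>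
        a ≫ (_ ◁ 𝟙 (F.functor.obj n) ≫ 𝟙 (m ⊗ F.functor.obj X) ▷ F.functor.obj n ≫
      _ ◁ F.functor.map b) ≫ (α_ _ _ _).hom ≫ m ◁ μ F.functor X n)
        (twistPseudofunctor_compIso ((ρ_ F).inv ⊗ₘ 𝟙 G) (α_ F (𝟙_ _) G).hom
          (𝟙 F ⊗ₘ (λ_ G).inv) (by simp) _)
        (twistPseudofunctor_idIso (𝟙 G) rfl n))
      (Eq.trans ?_ (congrArg (fun (a : m ⟶ m) =>
        ((α_ _ _ _).hom ≫ m ◁ μ F.functor X n) ≫ m ◁ 𝟙 (F.functor.obj (X ⊗ n)) ≫ a ▷ _ ≫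
          m ◁ F.functor.map (𝟙 (X ⊗ n)))
        (twistPseudofunctor_idIso (𝟙 F) rfl m)).symm)
    change 𝟙 _ ≫ (_ ◁ 𝟙 _ ≫ 𝟙 (m ⊗ F.functor.obj X) ▷ F.functor.obj n ≫
      _ ◁ F.functor.map (𝟙 n)) ≫ (α_ _ _ _).hom ≫ m ◁ μ F.functor X n =
      ((α_ _ _ _).hom ≫ m ◁ μ F.functor X n) ≫ m ◁ 𝟙 _ ≫ 𝟙 m ▷ _ ≫ m ◁ F.functor.map (𝟙 _)
    simp

end TwistMonoidal

end FusionFiber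

/-! ### Duals of tensor products and the canonical isomorphisms of conjugation -/

namespace FusionFiber

section Duals

variable {C : Type u} [Category.{v} C] [MonoidalCategory C]

/-- A morphism into a right dual `b` of `a` is determined by the functional on `a` that it
induces. -/
lemma hom_ext_evaluation (a : C) {b Y : C} [ExactPairing a b] {p q : Y ⟶ b}
    (h : p ▷ a ≫ ε_ a b = q ▷ a ≫ ε_ a b) : p = q := by
  have key (r : Y ⟶ b) : r = 𝟙 _ ⊗≫ Y ◁ η_ a b ⊗≫ (r ▷ a ≫ ε_ a b) ▷ b ⊗≫ 𝟙 _ := by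
    symm
    calc
      _ = 𝟙 _ ⊗≫ (Y ◁ η_ a b ≫ r ▷ (a ⊗ b)) ⊗≫ ε_ a b ▷ b ⊗≫ 𝟙 _ := by monoidal
      _ = 𝟙 _ ⊗≫ r ▷ 𝟙_ C ⊗≫ (b ◁ η_ a b ⊗≫ ε_ a b ▷ b) ⊗≫ 𝟙 _ := by
        rw [whisker_exchange]; monoidal
      _ = r := by
        rw [ExactPairing.coevaluation_evaluation'']; monoidal
  rw [key p, key q, h]

lemma rightDualIso_hom_evaluation {a b b' : C} (p : ExactPairing a b) (p' : ExactPairing a b') :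
    (rightDualIso p p').hom ▷ a ≫ @ExactPairing.evaluation _ _ _ a b' p' =
      @ExactPairing.evaluation _ _ _ a b p := by
  refine (@rightAdjointMate_comp_evaluation _ _ _ a a ⟨b'⟩ ⟨b⟩ (𝟙 a)).trans ?_
  rw [MonoidalCategory.whiskerLeft_id, Category.id_comp]
  rfl

lemma coevaluation_rightDualIso_hom {a b b' : C} (p : ExactPairing a b) (p' : ExactPairing a b') :
    @ExactPairing.coevaluation _ _ _ a b p ≫ a ◁ (rightDualIso p p').hom =
      @ExactPairing.coevaluation _ _ _ a b' p' := by
  refine (@coevaluation_comp_rightAdjointMate _ _ _ a a ⟨b'⟩ ⟨b⟩ (𝟙 a)).trans ?_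
  rw [id_whiskerRight, Category.comp_id]
  rfl

/-- Changing the evaluation of the left factor in the evaluation of a tensor product. -/
lemma whiskerLeft_comp_tensorEvaluation {a b b' c c' : C} {t : b ⊗ a ⟶ 𝟙_ C} {t' : b' ⊗ a ⟶ 𝟙_ C}
    {i : b ⟶ b'} (h : i ▷ a ≫ t' = t) (s : c' ⊗ c ⟶ 𝟙_ C) :
    (c' ◁ i) ▷ (a ⊗ c) ≫ (𝟙 _ ⊗≫ c' ◁ (t' ▷ c) ⊗≫ s) = 𝟙 _ ⊗≫ c' ◁ (t ▷ c) ⊗≫ s := by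
  subst h
  monoidal

/-- Changing the evaluation of the right factor in the evaluation of a tensor product. -/
lemma whiskerRight_comp_tensorEvaluation {a b c c' c'' : C} (t : b ⊗ a ⟶ 𝟙_ C)
    {s : c' ⊗ c ⟶ 𝟙_ C} {s' : c'' ⊗ c ⟶ 𝟙_ C} {i : c' ⟶ c''} (h : i ▷ c ≫ s' = s) :
    (i ▷ b) ▷ (a ⊗ c) ≫ (𝟙 _ ⊗≫ c'' ◁ (t ▷ c) ⊗≫ s') = 𝟙 _ ⊗≫ c' ◁ (t ▷ c) ⊗≫ s := by
  subst h
  trans 𝟙 _ ⊗≫ (i ▷ ((b ⊗ a) ⊗ c) ≫ c'' ◁ (t ▷ c)) ⊗≫ s'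
  · monoidal
  · rw [← whisker_exchange]
    monoidal

variable [RightRigidCategory C]

/-- The isomorphism `(a ⊗ b)* ≅ b* ⊗ a*` is characterized by its compatibility with the
evaluations. -/
lemma rightDualTensorIso_hom_evaluation (a b : C) :
    (rightDualTensorIso a b).hom ▷ (a ⊗ b) ≫ ε_ (a ⊗ b) (bᘁ ⊗ aᘁ) = ε_ (a ⊗ b) (a ⊗ b)ᘁ :=
  rightDualIso_hom_evaluation _ _

lemma coevaluation_rightDualTensorIso_hom (a b : C) :
    η_ (a ⊗ b) (a ⊗ b)ᘁ ≫ (a ⊗ b) ◁ (rightDualTensorIso a b).hom = η_ (a ⊗ b) (bᘁ ⊗ aᘁ) :=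
  coevaluation_rightDualIso_hom _ _

lemma rightDualTensorIso_hom_natural {a a' b b' : C} (f : a ⟶ a') (k : b ⟶ b') :
    (f ⊗ₘ k)ᘁ ≫ (rightDualTensorIso a b).hom = (rightDualTensorIso a' b').hom ≫ (kᘁ ⊗ₘ fᘁ) := by
  refine hom_ext_evaluation (a ⊗ b) ?_
  have h : (kᘁ ⊗ₘ fᘁ) ▷ (a ⊗ b) ≫ ε_ (a ⊗ b) (bᘁ ⊗ aᘁ) =
      (b'ᘁ ⊗ a'ᘁ) ◁ (f ⊗ₘ k) ≫ ε_ (a' ⊗ b') (b'ᘁ ⊗ a'ᘁ) := by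
    rw [ExactPairing.tensor_evaluation, ExactPairing.tensor_evaluation]
    calc
      _ = 𝟙 _ ⊗≫ (b'ᘁ : C) ◁ ((fᘁ ▷ a ≫ ε_ a aᘁ) ▷ b) ⊗≫ kᘁ ▷ b ≫ ε_ b bᘁ := by
        trans 𝟙 _ ⊗≫ (b'ᘁ : C) ◁ (fᘁ ▷ a) ▷ b ⊗≫
          (kᘁ ▷ ((aᘁ ⊗ a) ⊗ b) ≫ bᘁ ◁ (ε_ a aᘁ ▷ b)) ⊗≫ ε_ b bᘁ
        · rw [MonoidalCategory.tensorHom_def']; monoidal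
        · rw [← whisker_exchange]; monoidal
      _ = 𝟙 _ ⊗≫ (b'ᘁ : C) ◁ ((a'ᘁ ◁ f ≫ ε_ a' a'ᘁ) ▷ b) ⊗≫ (b'ᘁ : C) ◁ k ≫ ε_ b' b'ᘁ := by
        rw [rightAdjointMate_comp_evaluation, rightAdjointMate_comp_evaluation]
      _ = 𝟙 _ ⊗≫ (b'ᘁ : C) ◁ ((a'ᘁ ◁ f) ▷ b) ⊗≫
          (b'ᘁ : C) ◁ (ε_ a' a'ᘁ ▷ b ≫ 𝟙_ C ◁ k) ⊗≫ ε_ b' b'ᘁ := by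
        monoidal
      _ = _ := by
        rw [← whisker_exchange, MonoidalCategory.tensorHom_def]; monoidal
  rw [comp_whiskerRight, Category.assoc, rightDualTensorIso_hom_evaluation,
    rightAdjointMate_comp_evaluation, comp_whiskerRight, Category.assoc, h,
    ← whisker_exchange_assoc, rightDualTensorIso_hom_evaluation]

lemma rightDualTensorIso_hom_assoc (a b c : C) :
    (rightDualTensorIso (a ⊗ b) c).hom ≫ cᘁ ◁ (rightDualTensorIso a b).hom =
      (α_ a b c).invᘁ ≫ (rightDualTensorIso a (b ⊗ c)).hom ≫
        (rightDualTensorIso b c).hom ▷ aᘁ ≫ (α_ _ _ _).hom := by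
  refine hom_ext_evaluation ((a ⊗ b) ⊗ c) ?_
  have h₁ : (cᘁ ◁ (rightDualTensorIso a b).hom) ▷ ((a ⊗ b) ⊗ c) ≫
      ε_ ((a ⊗ b) ⊗ c) (cᘁ ⊗ (bᘁ ⊗ aᘁ)) = ε_ ((a ⊗ b) ⊗ c) (cᘁ ⊗ (a ⊗ b)ᘁ) :=
    whiskerLeft_comp_tensorEvaluation (rightDualTensorIso_hom_evaluation a b) _
  have h₂ : ((rightDualTensorIso b c).hom ▷ aᘁ) ▷ (a ⊗ (b ⊗ c)) ≫
      ε_ (a ⊗ (b ⊗ c)) ((cᘁ ⊗ bᘁ) ⊗ aᘁ) = ε_ (a ⊗ (b ⊗ c)) ((b ⊗ c)ᘁ ⊗ aᘁ) :=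
    whiskerRight_comp_tensorEvaluation _ (rightDualTensorIso_hom_evaluation b c)
  have h₃ : (α_ cᘁ bᘁ aᘁ).hom ▷ ((a ⊗ b) ⊗ c) ≫ ε_ ((a ⊗ b) ⊗ c) (cᘁ ⊗ (bᘁ ⊗ aᘁ)) =
      _ ◁ (α_ a b c).hom ≫ ε_ (a ⊗ (b ⊗ c)) ((cᘁ ⊗ bᘁ) ⊗ aᘁ) := by
    simp only [ExactPairing.tensor_evaluation]
    monoidal
  simp only [comp_whiskerRight, Category.assoc, h₁, h₃]
  rw [← whisker_exchange_assoc, h₂, ← whisker_exchange_assoc, rightDualTensorIso_hom_evaluation,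
    ← whisker_exchange_assoc, rightDualTensorIso_hom_evaluation, rightAdjointMate_comp_evaluation,
    ← MonoidalCategory.whiskerLeft_comp_assoc, Iso.hom_inv_id, MonoidalCategory.whiskerLeft_id,
    Category.id_comp]

/-- The canonical isomorphism `𝟙* ≅ 𝟙`, for any chosen right dual `𝟙*` of the unit object. -/
def rightDualUnitIso (d : HasRightDual (𝟙_ C)) : d.rightDual ≅ 𝟙_ C :=
  rightDualIso d.exact exactPairingUnit

lemma rightDualTensorIso_hom_unit_left (d : HasRightDual (𝟙_ C)) (a : C) :
    (λ_ a).homᘁ ≫ (@rightDualTensorIso _ _ _ (𝟙_ C) a d _ _).hom ≫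
      aᘁ ◁ (rightDualUnitIso d).hom = (ρ_ aᘁ).inv := by
  refine hom_ext_evaluation (𝟙_ C ⊗ a) ?_
  have h₁ : (aᘁ ◁ (rightDualUnitIso d).hom) ▷ (𝟙_ C ⊗ a) ≫ ε_ (𝟙_ C ⊗ a) (aᘁ ⊗ 𝟙_ C) = _ :=
    whiskerLeft_comp_tensorEvaluation (rightDualIso_hom_evaluation d.exact exactPairingUnit) _
  have h₂ := rightDualIso_hom_evaluation (HasRightDual.exact (X := 𝟙_ C ⊗ a))
    (@ExactPairing.tensor _ _ _ (𝟙_ C) a d.rightDual aᘁ d.exact _)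
  have h₃ : ε_ (𝟙_ C ⊗ a) (aᘁ ⊗ 𝟙_ C) = (aᘁ ⊗ 𝟙_ C) ◁ (λ_ a).hom ≫ (ρ_ _).hom ▷ a ≫ ε_ a aᘁ := by
    have e : ε_ (𝟙_ C) (𝟙_ C) = (ρ_ (𝟙_ C)).hom := rfl
    rw [ExactPairing.tensor_evaluation, e]
    monoidal
  rw [comp_whiskerRight, comp_whiskerRight, Category.assoc, Category.assoc, h₁]
  refine (congrArg (_ ≫ ·) h₂).trans ?_
  rw [rightAdjointMate_comp_evaluation, h₃, whisker_exchange_assoc,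
    ← comp_whiskerRight_assoc, Iso.inv_hom_id, id_whiskerRight, Category.id_comp]

lemma rightDualTensorIso_hom_unit_right (d : HasRightDual (𝟙_ C)) (a : C) :
    (ρ_ a).homᘁ ≫ (@rightDualTensorIso _ _ _ a (𝟙_ C) _ d _).hom ≫
      (rightDualUnitIso d).hom ▷ aᘁ = (λ_ aᘁ).inv := by
  refine hom_ext_evaluation (a ⊗ 𝟙_ C) ?_
  have h₁ : ((rightDualUnitIso d).hom ▷ aᘁ) ▷ (a ⊗ 𝟙_ C) ≫ ε_ (a ⊗ 𝟙_ C) (𝟙_ C ⊗ aᘁ) = _ :=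
    whiskerRight_comp_tensorEvaluation _ (rightDualIso_hom_evaluation d.exact exactPairingUnit)
  have h₂ := rightDualIso_hom_evaluation (HasRightDual.exact (X := a ⊗ 𝟙_ C))
    (@ExactPairing.tensor _ _ _ a (𝟙_ C) aᘁ d.rightDual _ d.exact)
  have h₃ : ε_ (a ⊗ 𝟙_ C) (𝟙_ C ⊗ aᘁ) = (𝟙_ C ⊗ aᘁ) ◁ (ρ_ a).hom ≫ (λ_ _).hom ▷ a ≫ ε_ a aᘁ := by
    have e : ε_ (𝟙_ C) (𝟙_ C) = (ρ_ (𝟙_ C)).hom := rfl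
    rw [ExactPairing.tensor_evaluation, e]
    monoidal
  rw [comp_whiskerRight, comp_whiskerRight, Category.assoc, Category.assoc, h₁]
  refine (congrArg (_ ≫ ·) h₂).trans ?_
  rw [rightAdjointMate_comp_evaluation, h₃, whisker_exchange_assoc,
    ← comp_whiskerRight_assoc, Iso.inv_hom_id, id_whiskerRight, Category.id_comp]

end Duals

namespace InvObj

variable {C : Type u} [Category.{v} C] [MonoidalCategory C] [RightRigidCategory C]

instance isIso_conjTensor (g h : InvObj C) (X : C) : IsIso (g.conjTensor h X) := by
  dsimp only [conjTensor, monoidalComp]; infer_instance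

lemma conjTensor_natural (g h : InvObj C) {X Y : C} (f : X ⟶ Y) :
    (g.obj ⊗ h.obj) ◁ (f ▷ (g.obj ⊗ h.obj)ᘁ) ≫ g.conjTensor h Y =
      g.conjTensor h X ≫ g.obj ◁ ((h.obj ◁ (f ▷ h.objᘁ)) ▷ g.objᘁ) := by
  let D := (rightDualTensorIso g.obj h.obj).hom
  calc
    _ = (g.obj ⊗ h.obj) ◁ (f ▷ (g.obj ⊗ h.obj)ᘁ ≫ Y ◁ D) ⊗≫ 𝟙 _ := by
      dsimp only [conjTensor, D]; monoidal
    _ = _ := by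
      rw [← whisker_exchange]; dsimp only [conjTensor, D]; monoidal

/-- The isomorphisms `F_{g ⊗ h} ≅ F_g ∘ F_h` are compatible with the units. -/
lemma conjEps_conjTensor (g h : InvObj C) :
    (g ⊗ h).conjEps ≫ g.conjTensor h (𝟙_ C) = g.conjEps ≫ g.obj ◁ (h.conjEps ▷ g.objᘁ) := by
  calc
    _ = (η_ (g.obj ⊗ h.obj) (g.obj ⊗ h.obj)ᘁ ≫
        (g.obj ⊗ h.obj) ◁ (rightDualTensorIso g.obj h.obj).hom) ⊗≫ 𝟙 _ := by
      dsimp only [conjTensor, conjEps, tensor_obj']; monoidal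
    _ = _ := by
      rw [coevaluation_rightDualTensorIso_hom, ExactPairing.tensor_coevaluation]
      dsimp only [conjEps]; monoidal

/-- The isomorphisms `F_{g ⊗ h} ≅ F_g ∘ F_h` are compatible with the tensor structures: both sides
contract `(g ⊗ h)* ⊗ (g ⊗ h)`, at once or in two steps. -/
lemma conjMu_conjTensor (g h : InvObj C) (X Y : C) :
    (g ⊗ h).conjMu X Y ≫ g.conjTensor h (X ⊗ Y) =
      (g.conjTensor h X ⊗ₘ g.conjTensor h Y) ≫
        g.conjMu (h.obj ⊗ (X ⊗ h.objᘁ)) (h.obj ⊗ (Y ⊗ h.objᘁ)) ≫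
          g.obj ◁ (h.conjMu X Y ▷ g.objᘁ) := by
  let D := (rightDualTensorIso g.obj h.obj).hom
  let a := g.obj ⊗ h.obj
  calc
    _ = 𝟙 ((a ⊗ (X ⊗ aᘁ)) ⊗ (a ⊗ (Y ⊗ aᘁ))) ⊗≫
        (a ⊗ X) ◁ (ε_ a aᘁ ▷ (Y ⊗ aᘁ)) ⊗≫ (a ⊗ X ⊗ Y) ◁ D ⊗≫ 𝟙 _ := by
      dsimp only [conjTensor, conjMu, tensor_obj', D, a]; monoidal
    _ = 𝟙 ((a ⊗ (X ⊗ aᘁ)) ⊗ (a ⊗ (Y ⊗ aᘁ))) ⊗≫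
        (a ⊗ X) ◁ ((D ▷ a ≫ ε_ a (h.objᘁ ⊗ g.objᘁ)) ▷ (Y ⊗ aᘁ)) ⊗≫ (a ⊗ X ⊗ Y) ◁ D ⊗≫ 𝟙 _ := by
      rw [rightDualTensorIso_hom_evaluation]
    _ = 𝟙 ((a ⊗ (X ⊗ aᘁ)) ⊗ (a ⊗ (Y ⊗ aᘁ))) ⊗≫ (a ⊗ X) ◁ (D ▷ (a ⊗ (Y ⊗ aᘁ))) ⊗≫
        (a ⊗ X) ◁ ((ε_ a (h.objᘁ ⊗ g.objᘁ)) ▷ (Y ⊗ aᘁ) ≫ 𝟙_ C ◁ (Y ◁ D)) ⊗≫ 𝟙 _ := by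
      monoidal
    _ = 𝟙 ((a ⊗ (X ⊗ aᘁ)) ⊗ (a ⊗ (Y ⊗ aᘁ))) ⊗≫ (a ⊗ X) ◁ (D ▷ (a ⊗ (Y ⊗ aᘁ))) ⊗≫
        (a ⊗ X) ◁ (_ ◁ (Y ◁ D) ≫ (ε_ a (h.objᘁ ⊗ g.objᘁ)) ▷ (Y ⊗ (h.objᘁ ⊗ g.objᘁ))) ⊗≫ 𝟙 _ := by
      rw [whisker_exchange]
    _ = _ := by
      rw [ExactPairing.tensor_evaluation, MonoidalCategory.tensorHom_def]
      dsimp only [conjTensor, conjMu, D, a]; monoidal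

/-- The isomorphisms `F_{g ⊗ h} ≅ F_g ∘ F_h` are natural in `g` and `h`. -/
lemma conjTensor_natural_obj {g g' h h' : InvObj C} (f : g.obj ≅ g'.obj) (k : h.obj ≅ h'.obj)
    (X : C) :
    ((f.hom ⊗ₘ k.hom) ⊗ₘ (X ◁ (f.inv ⊗ₘ k.inv)ᘁ)) ≫ g'.conjTensor h' X =
      g.conjTensor h X ≫ (f.hom ⊗ₘ ((h.obj ⊗ (X ⊗ h.objᘁ)) ◁ (f.inv)ᘁ)) ≫
        g'.obj ◁ ((k.hom ⊗ₘ (X ◁ (k.inv)ᘁ)) ▷ g'.objᘁ) := by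
  let D := (rightDualTensorIso g.obj h.obj).hom
  let D' := (rightDualTensorIso g'.obj h'.obj).hom
  let p := (f.inv)ᘁ
  let q := (k.inv)ᘁ
  calc
    _ = (f.hom ⊗ₘ k.hom) ▷ (X ⊗ (g.obj ⊗ h.obj)ᘁ) ⊗≫
        (g'.obj ⊗ h'.obj) ◁ (X ◁ ((f.inv ⊗ₘ k.inv)ᘁ ≫ D')) ⊗≫ 𝟙 _ := by
      rw [MonoidalCategory.tensorHom_def (f.hom ⊗ₘ k.hom)]
      dsimp only [conjTensor, D']; monoidal
    _ = ((f.hom ⊗ₘ k.hom) ▷ (X ⊗ (g.obj ⊗ h.obj)ᘁ) ≫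
        (g'.obj ⊗ h'.obj) ◁ (X ◁ D)) ⊗≫ (g'.obj ⊗ h'.obj) ◁ (X ◁ (q ⊗ₘ p)) ⊗≫ 𝟙 _ := by
      rw [rightDualTensorIso_hom_natural]; monoidal
    _ = (g.obj ⊗ h.obj) ◁ (X ◁ D) ⊗≫ f.hom ▷ (h.obj ⊗ (X ⊗ (h.objᘁ ⊗ g.objᘁ))) ⊗≫
        g'.obj ◁ (k.hom ▷ ((X ⊗ h.objᘁ) ⊗ g.objᘁ) ≫ h'.obj ◁ ((X ⊗ h.objᘁ) ◁ p)) ⊗≫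
          (g'.obj ⊗ h'.obj) ◁ ((X ◁ q) ▷ g'.objᘁ) ⊗≫ 𝟙 _ := by
      rw [← whisker_exchange, MonoidalCategory.tensorHom_def, MonoidalCategory.tensorHom_def' q]
      monoidal
    _ = _ := by
      rw [← whisker_exchange, MonoidalCategory.tensorHom_def f.hom,
        MonoidalCategory.tensorHom_def k.hom]
      dsimp only [conjTensor, D, p, q]; monoidal

lemma conjTensor_assoc (g h k : InvObj C) (X : C) :
    (g ⊗ h).conjTensor k X ≫ g.conjTensor h (k.obj ⊗ (X ⊗ k.objᘁ)) =
      ((α_ g.obj h.obj k.obj).hom ⊗ₘ (X ◁ ((α_ g.obj h.obj k.obj).inv)ᘁ)) ≫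
        g.conjTensor (h ⊗ k) X ≫ g.obj ◁ (h.conjTensor k X ▷ g.objᘁ) := by
  calc
    _ = ((g.obj ⊗ h.obj) ⊗ k.obj) ◁ (X ◁ ((rightDualTensorIso (g.obj ⊗ h.obj) k.obj).hom ≫
        k.objᘁ ◁ (rightDualTensorIso g.obj h.obj).hom)) ⊗≫ 𝟙 _ := by
      dsimp only [conjTensor, tensor_obj']; monoidal
    _ = _ := by
      rw [rightDualTensorIso_hom_assoc, MonoidalCategory.tensorHom_def]
      dsimp only [conjTensor, tensor_obj']; monoidal

variable (C) in
/-- The canonical isomorphism `𝟙* ≅ 𝟙`, for the dual of `𝟙` chosen by the rigid structure. -/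
def unitDualIso : (𝟙_ (InvObj C)).objᘁ ≅ 𝟙_ C := rightDualUnitIso _

/-- The canonical morphism `F_𝟙 X ⟶ X`. -/
def conjUnit (X : C) : 𝟙_ C ⊗ (X ⊗ (𝟙_ (InvObj C)).objᘁ) ⟶ X :=
  (λ_ _).hom ≫ X ◁ (unitDualIso C).hom ≫ (ρ_ X).hom

instance isIso_conjUnit (X : C) : IsIso (conjUnit X) := by
  dsimp only [conjUnit]; infer_instance

lemma conjUnit_natural {X Y : C} (f : X ⟶ Y) :
    𝟙_ C ◁ (f ▷ (𝟙_ (InvObj C)).objᘁ) ≫ conjUnit Y = conjUnit X ≫ f := by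
  calc
    _ = 𝟙 _ ⊗≫ (f ▷ (𝟙_ (InvObj C)).objᘁ ≫ Y ◁ (unitDualIso C).hom) ⊗≫ 𝟙 _ := by
      dsimp only [conjUnit]; monoidal
    _ = _ := by
      rw [← whisker_exchange]; dsimp only [conjUnit]; monoidal

lemma unitDualIso_hom_evaluation :
    (unitDualIso C).hom ▷ 𝟙_ C ≫ (ρ_ (𝟙_ C)).hom =
      ε_ (𝟙_ (InvObj C)).obj (𝟙_ (InvObj C)).objᘁ :=
  rightDualIso_hom_evaluation _ _

lemma coevaluation_unitDualIso_hom :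
    η_ (𝟙_ (InvObj C)).obj (𝟙_ (InvObj C)).objᘁ ≫ 𝟙_ C ◁ (unitDualIso C).hom =
      (ρ_ (𝟙_ C)).inv :=
  coevaluation_rightDualIso_hom _ _

lemma conjEps_conjUnit : (𝟙_ (InvObj C)).conjEps ≫ conjUnit (𝟙_ C) = 𝟙 (𝟙_ C) := by
  calc
    _ = (η_ (𝟙_ (InvObj C)).obj (𝟙_ (InvObj C)).objᘁ ≫ 𝟙_ C ◁ (unitDualIso C).hom) ⊗≫
        𝟙 (𝟙_ C) := by
      dsimp only [conjEps, conjUnit, unit_obj']; monoidal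
    _ = _ := by
      rw [coevaluation_unitDualIso_hom]; monoidal

lemma conjMu_conjUnit (X Y : C) :
    (𝟙_ (InvObj C)).conjMu X Y ≫ conjUnit (X ⊗ Y) = conjUnit X ⊗ₘ conjUnit Y := by
  have key (a b : C) (i : a ⟶ 𝟙_ C) (u : b ⟶ 𝟙_ C) (e : b ⊗ a ⟶ 𝟙_ C)
      (h : u ▷ a ≫ (λ_ a).hom ≫ i = e) :
      (𝟙 ((a ⊗ (X ⊗ b)) ⊗ (a ⊗ (Y ⊗ b))) ⊗≫ (a ⊗ X) ◁ e ▷ (Y ⊗ b) ⊗≫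
        𝟙 (a ⊗ ((X ⊗ Y) ⊗ b))) ≫ (i ▷ _ ≫ (λ_ _).hom ≫ (X ⊗ Y) ◁ u ≫ (ρ_ _).hom) =
      ((i ▷ _ ≫ (λ_ _).hom ≫ X ◁ u ≫ (ρ_ X).hom) ⊗ₘ
        (i ▷ _ ≫ (λ_ _).hom ≫ Y ◁ u ≫ (ρ_ Y).hom)) := by
    subst h
    calc
      _ = 𝟙 _ ⊗≫ (a ⊗ X) ◁ (u ▷ (a ⊗ (Y ⊗ b))) ⊗≫
          (i ▷ (X ⊗ (a ⊗ (Y ⊗ b))) ≫ 𝟙_ C ◁ (X ◁ (i ▷ (Y ⊗ b)))) ⊗≫ X ◁ (Y ◁ u) ⊗≫ 𝟙 _ := by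
        rw [← whisker_exchange]; monoidal
      _ = 𝟙 _ ⊗≫ (a ◁ (X ◁ u) ≫ i ▷ (X ⊗ 𝟙_ C)) ▷ (a ⊗ (Y ⊗ b)) ⊗≫
          X ◁ (i ▷ (Y ⊗ b)) ⊗≫ X ◁ (Y ◁ u) ⊗≫ 𝟙 _ := by
        monoidal
      _ = _ := by
        rw [whisker_exchange, MonoidalCategory.tensorHom_def]; monoidal
  have := key _ _ (𝟙 _) _ _ ((congrArg (_ ≫ ·) ((Category.comp_id _).trans
    unitors_equal)).trans unitDualIso_hom_evaluation)
  simp only [id_whiskerRight, Category.id_comp] at this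
  exact this

lemma conjTensor_unit_left (g : InvObj C) (X : C) :
    ((λ_ g.obj).inv ⊗ₘ (X ◁ ((λ_ g.obj).hom)ᘁ)) ≫ (𝟙_ (InvObj C)).conjTensor g X ≫
      conjUnit (g.obj ⊗ (X ⊗ g.objᘁ)) = 𝟙 _ := by
  have h : ((λ_ g.obj).hom)ᘁ ≫ (rightDualTensorIso (𝟙_ (InvObj C)).obj g.obj).hom ≫
      g.objᘁ ◁ (unitDualIso C).hom = (ρ_ g.objᘁ).inv := rightDualTensorIso_hom_unit_left _ _
  calc
    _ = 𝟙 _ ⊗≫ g.obj ◁ (X ◁ (((λ_ g.obj).hom)ᘁ ≫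
        (rightDualTensorIso (𝟙_ (InvObj C)).obj g.obj).hom ≫
          g.objᘁ ◁ (unitDualIso C).hom)) ⊗≫ 𝟙 _ := by
      rw [MonoidalCategory.tensorHom_def]
      dsimp only [conjTensor, conjUnit, unit_obj']; monoidal
    _ = _ := by
      rw [h]; monoidal

lemma conjTensor_unit_right (g : InvObj C) (X : C) :
    ((ρ_ g.obj).inv ⊗ₘ (X ◁ ((ρ_ g.obj).hom)ᘁ)) ≫ g.conjTensor (𝟙_ (InvObj C)) X ≫
      g.obj ◁ (conjUnit X ▷ g.objᘁ) = 𝟙 _ := by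
  have h : ((ρ_ g.obj).hom)ᘁ ≫ (rightDualTensorIso g.obj (𝟙_ (InvObj C)).obj).hom ≫
      (unitDualIso C).hom ▷ g.objᘁ = (λ_ g.objᘁ).inv := rightDualTensorIso_hom_unit_right _ _
  calc
    _ = 𝟙 _ ⊗≫ g.obj ◁ (X ◁ (((ρ_ g.obj).hom)ᘁ ≫
        (rightDualTensorIso g.obj (𝟙_ (InvObj C)).obj).hom ≫
          (unitDualIso C).hom ▷ g.objᘁ)) ⊗≫ 𝟙 _ := by
      rw [MonoidalCategory.tensorHom_def]
      dsimp only [conjTensor, conjUnit, unit_obj']; monoidal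
    _ = _ := by
      rw [h]; monoidal

end InvObj

end FusionFiber

/-! ### Conjugation as a homomorphism of categorical groups -/

namespace FusionFiber

section ConjugationMonoidal

variable {C : Type u} [Category.{v} C] [Abelian C] [Linear ℂ C] [MonoidalCategory C]
  [MonoidalPreadditive C] [MonoidalLinear ℂ C] [RightRigidCategory C]

/-- The monoidal natural isomorphism `F_{g ⊗ h} ≅ F_g ∘ F_h`. -/
noncomputable def conjTensorIso (g h : InvObj C) :
    (conjugation C).obj (g ⊗ h) ≅ (conjugation C).obj g ⊗ (conjugation C).obj h :=
  TensorAut.mkIso (F := (g ⊗ h).conj) (G := TensorAut.tensor g.conj h.conj)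
    (NatIso.ofComponents (fun X => @asIso _ _ _ _ (g.conjTensor h X) (g.isIso_conjTensor h X))
      (fun f => InvObj.conjTensor_natural g h f))
    { unit := InvObj.conjEps_conjTensor g h
      tensor := fun X Y => (InvObj.conjMu_conjTensor g h X Y) }

variable (C) in
/-- The monoidal natural isomorphism `F_𝟙 ≅ 𝟭`. -/
noncomputable def conjUnitIso : (conjugation C).obj (𝟙_ (InvObj C)) ≅ 𝟙_ (TensorAut C) :=
  TensorAut.mkIso (F := (𝟙_ (InvObj C)).conj) (G := TensorAut.unit)
    (NatIso.ofComponents (fun X => @asIso _ _ _ _ (InvObj.conjUnit X) (InvObj.isIso_conjUnit X))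
      (fun f => InvObj.conjUnit_natural f))
    { unit := InvObj.conjEps_conjUnit
      tensor := fun X Y => (InvObj.conjMu_conjUnit X Y).trans (Category.comp_id _).symm }

lemma conjTensorIso_natural {g g' h h' : InvObj C} (f : g ⟶ g') (k : h ⟶ h') :
    (conjugation C).map (f ⊗ₘ k) ≫ (conjTensorIso g' h').hom =
      (conjTensorIso g h).hom ≫ ((conjugation C).map f ⊗ₘ (conjugation C).map k) := by
  ext X
  exact InvObj.conjTensor_natural_obj (InvObj.Hom.iso f) (InvObj.Hom.iso k) X

variable (C) in
/-- The oplax structure of `g ↦ F_g`, given by the canonical isomorphisms `F_{g ⊗ h} ≅ F_g ∘ F_h`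
and `F_𝟙 ≅ 𝟭`. -/
@[reducible]
noncomputable def conjugationOplax : (conjugation C).OplaxMonoidal where
  δ g h := (conjTensorIso g h).hom
  η := (conjUnitIso C).hom
  δ_natural_left f h := by
    have := conjTensorIso_natural f (𝟙 h)
    simpa using this.symm
  δ_natural_right g f := by
    have := conjTensorIso_natural (𝟙 g) f
    simpa using this.symm
  oplax_associativity g h k := by
    ext X
    exact (congrArg (_ ≫ ·) (Category.comp_id _)).trans (InvObj.conjTensor_assoc g h k X)
  oplax_left_unitality g := by
    ext X
    exact (InvObj.conjTensor_unit_left g X).symm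
  oplax_right_unitality g := by
    ext X
    exact (InvObj.conjTensor_unit_right g X).symm

variable (C) in
/-- The structure of a homomorphism of categorical groups on `g ↦ F_g`, given by the canonical
isomorphisms `F_{g ⊗ h} ≅ F_g ∘ F_h` and `F_𝟙 ≅ 𝟭`. -/
@[reducible]
noncomputable def conjugationMonoidal : (conjugation C).Monoidal :=
  letI := conjugationOplax C
  have (g h : InvObj C) : IsIso (Functor.OplaxMonoidal.δ (conjugation C) g h) :=
    inferInstanceAs (IsIso (conjTensorIso g h).hom)
  have : IsIso (Functor.OplaxMonoidal.η (conjugation C)) :=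
    inferInstanceAs (IsIso (conjUnitIso C).hom)
  Functor.Monoidal.ofOplaxMonoidal (conjugation C)

lemma conjugation_δ_app (g h : InvObj C) (X : C) :
    letI := conjugationMonoidal C
    (TensorAut.Hom.iso (Functor.OplaxMonoidal.δ (conjugation C) g h)).hom.app X =
      g.conjTensor h X := rfl

end ConjugationMonoidal

end FusionFiber

/-! ### Evaluation of invertible objects and the constraints of `Φ` -/

namespace FusionFiber

namespace InvObj

variable {C : Type u} [Category.{v} C] [MonoidalCategory C]

/-- Inverses of two evaluations which correspond under `b ≅ b'` correspond as well. -/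
lemma inverse_comp_whiskerRight {a b b' : C} (i : b ≅ b') {e : b ⊗ a ⟶ 𝟙_ C} {e' : b' ⊗ a ⟶ 𝟙_ C}
    {t : 𝟙_ C ⟶ b ⊗ a} {t' : 𝟙_ C ⟶ b' ⊗ a} (h : i.hom ▷ a ≫ e' = e) (h₁ : e ≫ t = 𝟙 _)
    (h₂ : t' ≫ e' = 𝟙 _) : t ≫ i.hom ▷ a = t' := by
  have e₀ : e' = i.inv ▷ a ≫ e := by
    rw [← h, ← comp_whiskerRight_assoc, Iso.inv_hom_id, id_whiskerRight, Category.id_comp]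
  calc
    _ = (t' ≫ e') ≫ t ≫ i.hom ▷ a := by rw [h₂, Category.id_comp]
    _ = t' ≫ i.inv ▷ a ≫ (e ≫ t) ≫ i.hom ▷ a := by rw [e₀]; simp only [Category.assoc]
    _ = t' := by
      rw [h₁, Category.id_comp, ← comp_whiskerRight, Iso.inv_hom_id, id_whiskerRight,
        Category.comp_id]

variable [RightRigidCategory C]

/-- The inverse `𝟙 ⟶ g* ⊗ g` of the evaluation of an invertible object. -/
noncomputable def invEvaluation (g : InvObj C) : 𝟙_ C ⟶ g.objᘁ ⊗ g.obj := inv (ε_ g.obj g.objᘁ)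

@[simp]
lemma invEvaluation_evaluation (g : InvObj C) : g.invEvaluation ≫ ε_ g.obj g.objᘁ = 𝟙 _ :=
  IsIso.inv_hom_id _

@[simp]
lemma evaluation_invEvaluation (g : InvObj C) : ε_ g.obj g.objᘁ ≫ g.invEvaluation = 𝟙 _ :=
  IsIso.hom_inv_id _

lemma eq_invEvaluation (g : InvObj C) {t : 𝟙_ C ⟶ g.objᘁ ⊗ g.obj}
    (h : t ≫ ε_ g.obj g.objᘁ = 𝟙 _) : t = g.invEvaluation := by
  rw [← cancel_mono (ε_ g.obj g.objᘁ), h, invEvaluation_evaluation]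

/-- The inverse evaluation is dinatural. This is what makes the isomorphisms `X ⊗ (f⁻¹)*` compatible
with the right actions. -/
lemma invEvaluation_natural {g h : InvObj C} (f : g.obj ≅ h.obj) :
    g.invEvaluation ≫ g.objᘁ ◁ f.hom ≫ (f.inv)ᘁ ▷ h.obj = h.invEvaluation := by
  refine h.eq_invEvaluation ?_
  rw [Category.assoc, Category.assoc, rightAdjointMate_comp_evaluation,
    ← MonoidalCategory.whiskerLeft_comp_assoc, Iso.hom_inv_id, MonoidalCategory.whiskerLeft_id,
    Category.id_comp, invEvaluation_evaluation]

/-- The inverse evaluation of `g ⊗ h` is the composition of those of `h` and `g`. -/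
lemma invEvaluation_tensor (g h : InvObj C) :
    (g ⊗ h).invEvaluation ≫ (rightDualTensorIso g.obj h.obj).hom ▷ (g.obj ⊗ h.obj) =
      h.invEvaluation ⊗≫ h.objᘁ ◁ (g.invEvaluation ▷ h.obj) ⊗≫ 𝟙 _ := by
  refine inverse_comp_whiskerRight _ (rightDualTensorIso_hom_evaluation g.obj h.obj)
    (g ⊗ h).evaluation_invEvaluation ?_
  rw [ExactPairing.tensor_evaluation]
  calc
    _ = h.invEvaluation ⊗≫ h.objᘁ ◁ ((g.invEvaluation ≫ ε_ g.obj g.objᘁ) ▷ h.obj) ⊗≫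
        ε_ h.obj h.objᘁ := by monoidal
    _ = h.invEvaluation ≫ ε_ h.obj h.objᘁ := by
      rw [invEvaluation_evaluation]; monoidal
    _ = _ := by simp

lemma invEvaluation_unit :
    (𝟙_ (InvObj C)).invEvaluation ≫ (𝟙_ (InvObj C)).objᘁ ◁ 𝟙 (𝟙_ C) =
      (unitDualIso C).inv ≫ (ρ_ _).inv := by
  have key {b : C} (u : b ≅ 𝟙_ C) (t : 𝟙_ C ⟶ b ⊗ 𝟙_ C)
      (ht : t ≫ u.hom ▷ 𝟙_ C = (ρ_ (𝟙_ C)).inv) : t ≫ b ◁ 𝟙 (𝟙_ C) = u.inv ≫ (ρ_ _).inv := by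
    rw [← cancel_mono (u.hom ▷ 𝟙_ C), MonoidalCategory.whiskerLeft_id, Category.comp_id, ht]
    simp
  exact key _ _ (inverse_comp_whiskerRight _ unitDualIso_hom_evaluation
    (𝟙_ (InvObj C)).evaluation_invEvaluation (Iso.inv_hom_id _))

/-- The inverse `X ⊗ Y ⊗ g* ⟶ X ⊗ g* ⊗ g ⊗ Y ⊗ g*` of `conjAct`. -/
noncomputable def conjCoact (g : InvObj C) (X Y : C) :
    (X ⊗ Y) ⊗ g.objᘁ ⟶ (X ⊗ g.objᘁ) ⊗ (g.obj ⊗ (Y ⊗ g.objᘁ)) :=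
  𝟙 _ ⊗≫ X ◁ g.invEvaluation ▷ (Y ⊗ g.objᘁ) ⊗≫ 𝟙 _

lemma inv_conjAct (g : InvObj C) (X Y : C) : inv (g.conjAct X Y) = g.conjCoact X Y := by
  refine IsIso.inv_eq_of_inv_hom_id ?_
  calc
    _ = 𝟙 _ ⊗≫ X ◁ (g.invEvaluation ≫ ε_ g.obj g.objᘁ) ▷ (Y ⊗ g.objᘁ) ⊗≫ 𝟙 _ := by
      dsimp only [conjAct, conjCoact]; monoidal
    _ = _ := by
      rw [invEvaluation_evaluation]; monoidal

/-- The inverse of the tensor structure of `F_g`. -/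
noncomputable def conjComu (g : InvObj C) (X Y : C) :
    g.obj ⊗ ((X ⊗ Y) ⊗ g.objᘁ) ⟶ (g.obj ⊗ (X ⊗ g.objᘁ)) ⊗ (g.obj ⊗ (Y ⊗ g.objᘁ)) :=
  𝟙 _ ⊗≫ (g.obj ⊗ X) ◁ g.invEvaluation ▷ (Y ⊗ g.objᘁ) ⊗≫ 𝟙 _

lemma conjComu_conjMu (g : InvObj C) (X Y : C) : g.conjComu X Y ≫ g.conjMu X Y = 𝟙 _ := by
  calc
    _ = 𝟙 _ ⊗≫ (g.obj ⊗ X) ◁ (g.invEvaluation ≫ ε_ g.obj g.objᘁ) ▷ (Y ⊗ g.objᘁ) ⊗≫ 𝟙 _ := by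
      dsimp only [conjMu, conjComu]; monoidal
    _ = _ := by
      rw [invEvaluation_evaluation]; monoidal

lemma inv_conjMu (g : InvObj C) (X Y : C) : inv (g.conjMu X Y) = g.conjComu X Y :=
  IsIso.inv_eq_of_inv_hom_id (g.conjComu_conjMu X Y)

lemma conjCoact_natural_left (g : InvObj C) {X Y : C} (f : X ⟶ Y) (Z : C) :
    (f ▷ Z) ▷ g.objᘁ ≫ g.conjCoact Y Z = g.conjCoact X Z ≫ (f ▷ g.objᘁ) ▷ _ := by
  rw [← inv_conjAct, ← inv_conjAct, IsIso.comp_inv_eq, Category.assoc, conjAct_natural_left,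
    IsIso.inv_hom_id_assoc]

lemma conjCoact_natural_right (g : InvObj C) (Z : C) {X Y : C} (f : X ⟶ Y) :
    (Z ◁ f) ▷ g.objᘁ ≫ g.conjCoact Z Y = g.conjCoact Z X ≫ _ ◁ (g.obj ◁ (f ▷ g.objᘁ)) := by
  rw [← inv_conjAct, ← inv_conjAct, IsIso.comp_inv_eq, Category.assoc, conjAct_natural_right,
    IsIso.inv_hom_id_assoc]

/-- The maps `X ⊗ (f⁻¹)*` are compatible with the right actions. -/
lemma conjCoact_natural_obj {g h : InvObj C} (f : g.obj ≅ h.obj) (X Y : C) :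
    (X ⊗ Y) ◁ (f.inv)ᘁ ≫ h.conjCoact X Y =
      (g.conjCoact X Y ≫ (X ⊗ g.objᘁ) ◁ (f.hom ⊗ₘ (Y ◁ (f.inv)ᘁ))) ≫ (X ◁ (f.inv)ᘁ) ▷ _ := by
  symm
  let p := (f.inv)ᘁ
  calc
    _ = 𝟙 _ ⊗≫ X ◁ (g.invEvaluation ▷ (Y ⊗ g.objᘁ) ≫ (g.objᘁ ⊗ g.obj) ◁ (Y ◁ p)) ⊗≫
        X ◁ (g.objᘁ ◁ f.hom ≫ p ▷ h.obj) ▷ (Y ⊗ h.objᘁ) ⊗≫ 𝟙 _ := by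
      rw [MonoidalCategory.tensorHom_def']
      dsimp only [conjCoact, p]; monoidal
    _ = 𝟙 _ ⊗≫ X ◁ (Y ◁ p) ⊗≫ X ◁ (g.invEvaluation ≫ g.objᘁ ◁ f.hom ≫ p ▷ h.obj) ▷
        (Y ⊗ h.objᘁ) ⊗≫ 𝟙 _ := by
      rw [← whisker_exchange]; monoidal
    _ = _ := by
      rw [invEvaluation_natural]; dsimp only [conjCoact, p]; monoidal

/-- The isomorphism `X ⊗ Y ⊗ (g ⊗ h)* ≅ X ⊗ (Y ⊗ h*) ⊗ g*`. -/
noncomputable def dualMul (g h : InvObj C) (X Y : C) :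
    (X ⊗ Y) ⊗ (g.obj ⊗ h.obj)ᘁ ⟶ (X ⊗ (Y ⊗ h.objᘁ)) ⊗ g.objᘁ :=
  (X ⊗ Y) ◁ (rightDualTensorIso g.obj h.obj).hom ⊗≫ 𝟙 _

/-- The constraint `Φ_{g ⊗ h} (X ⊗ Y) ⟶ Φ_g X ⊗ F_g (Φ_h Y)`. -/
noncomputable def conjMul (g h : InvObj C) (X Y : C) :
    (X ⊗ Y) ⊗ (g.obj ⊗ h.obj)ᘁ ⟶
      (X ⊗ g.objᘁ) ⊗ (g.obj ⊗ ((Y ⊗ h.objᘁ) ⊗ g.objᘁ)) :=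
  g.dualMul h X Y ≫ g.conjCoact X (Y ⊗ h.objᘁ)

instance isIso_conjMul (g h : InvObj C) (X Y : C) : IsIso (g.conjMul h X Y) := by
  rw [conjMul, ← inv_conjAct]
  dsimp only [dualMul, monoidalComp]; infer_instance

lemma conjMul_natural_left (g h : InvObj C) {X X' : C} (f : X ⟶ X') (Y : C) :
    (f ▷ Y) ▷ (g.obj ⊗ h.obj)ᘁ ≫ g.conjMul h X' Y = g.conjMul h X Y ≫ (f ▷ g.objᘁ) ▷ _ := by
  have e : (f ▷ Y) ▷ (g.obj ⊗ h.obj)ᘁ ≫ g.dualMul h X' Y =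
      g.dualMul h X Y ≫ (f ▷ (Y ⊗ h.objᘁ)) ▷ g.objᘁ := by
    calc
      _ = ((f ▷ Y) ▷ (g.obj ⊗ h.obj)ᘁ ≫ _ ◁ (rightDualTensorIso g.obj h.obj).hom) ⊗≫ 𝟙 _ := by
        dsimp only [dualMul]; monoidal
      _ = _ := by
        rw [← whisker_exchange]; dsimp only [dualMul]; monoidal
  rw [conjMul, conjMul, reassoc_of% e, Category.assoc, conjCoact_natural_left]

lemma conjMul_natural_right (g h : InvObj C) (X : C) {Y Y' : C} (f : Y ⟶ Y') :
    (X ◁ f) ▷ (g.obj ⊗ h.obj)ᘁ ≫ g.conjMul h X Y' =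
      g.conjMul h X Y ≫ _ ◁ (g.obj ◁ ((f ▷ h.objᘁ) ▷ g.objᘁ)) := by
  have e : (X ◁ f) ▷ (g.obj ⊗ h.obj)ᘁ ≫ g.dualMul h X Y' =
      g.dualMul h X Y ≫ (X ◁ (f ▷ h.objᘁ)) ▷ g.objᘁ := by
    calc
      _ = ((X ◁ f) ▷ (g.obj ⊗ h.obj)ᘁ ≫ _ ◁ (rightDualTensorIso g.obj h.obj).hom) ⊗≫ 𝟙 _ := by
        dsimp only [dualMul]; monoidal
      _ = _ := by
        rw [← whisker_exchange]; dsimp only [dualMul]; monoidal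
  rw [conjMul, conjMul, reassoc_of% e, Category.assoc, conjCoact_natural_right]

/-- The isomorphisms `conjMul` are compatible with the balancings of the action of `C` on itself and
of `(m, n) ↦ m ⊗ F_g n`. -/
lemma conjMul_balanced (g h : InvObj C) (X Y Z : C) :
    (α_ X Y Z).hom ▷ (g.obj ⊗ h.obj)ᘁ ≫ g.conjMul h X (Y ⊗ Z) ≫
        (X ⊗ g.objᘁ) ◁ (g.obj ◁ ((α_ Y Z h.objᘁ).hom ▷ g.objᘁ)) =
      g.conjMul h (X ⊗ Y) Z ≫ g.conjCoact X Y ▷ (g.obj ⊗ ((Z ⊗ h.objᘁ) ⊗ g.objᘁ)) ≫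
        (α_ _ _ _).hom ≫ (X ⊗ g.objᘁ) ◁ g.conjMu Y (Z ⊗ h.objᘁ) := by
  symm
  let D := (rightDualTensorIso g.obj h.obj).hom
  let t := g.invEvaluation
  calc
    _ = ((X ⊗ Y) ⊗ Z) ◁ D ⊗≫ X ◁ (𝟙_ C ◁ (Y ◁ t) ≫ t ▷ (Y ⊗ g.objᘁ ⊗ g.obj)) ▷
          ((Z ⊗ h.objᘁ) ⊗ g.objᘁ) ⊗≫
        (X ⊗ (g.objᘁ ⊗ g.obj) ⊗ Y) ◁ ε_ g.obj g.objᘁ ▷ ((Z ⊗ h.objᘁ) ⊗ g.objᘁ) ⊗≫ 𝟙 _ := by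
      dsimp only [conjMul, dualMul, conjCoact, conjMu, D, t]; monoidal
    _ = ((X ⊗ Y) ⊗ Z) ◁ D ⊗≫ X ◁ t ▷ (Y ⊗ (Z ⊗ h.objᘁ) ⊗ g.objᘁ) ⊗≫
        (X ⊗ (g.objᘁ ⊗ g.obj) ⊗ Y) ◁ (t ≫ ε_ g.obj g.objᘁ) ▷ ((Z ⊗ h.objᘁ) ⊗ g.objᘁ) ⊗≫
          𝟙 _ := by
      rw [whisker_exchange]; monoidal
    _ = _ := by
      dsimp only [t]
      rw [invEvaluation_evaluation]
      dsimp only [conjMul, dualMul, conjCoact, D, t]; monoidal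

/-- The isomorphisms `conjMul` are compatible with the left actions. -/
lemma conjMul_left (g h : InvObj C) (X Y Z : C) :
    (α_ X Y Z).hom ▷ (g.obj ⊗ h.obj)ᘁ ≫ (α_ _ _ _).hom ≫ X ◁ g.conjMul h Y Z =
      g.conjMul h (X ⊗ Y) Z ≫ (α_ X Y g.objᘁ).hom ▷ _ ≫ (α_ _ _ _).hom := by
  dsimp only [conjMul, dualMul, conjCoact]; monoidal

/-- The isomorphisms `conjMul` are compatible with the right actions. Here the inverse evaluation of
`g ⊗ h` has to be split into those of `g` and `h`. -/
lemma conjMul_right (g h : InvObj C) (X Y Z : C) :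
    (g ⊗ h).conjCoact (X ⊗ Y) Z ≫ ((X ⊗ Y) ⊗ (g.obj ⊗ h.obj)ᘁ) ◁ g.conjTensor h Z ≫
        g.conjMul h X Y ▷ (g.obj ⊗ ((h.obj ⊗ (Z ⊗ h.objᘁ)) ⊗ g.objᘁ)) =
      (α_ X Y Z).hom ▷ (g.obj ⊗ h.obj)ᘁ ≫ g.conjMul h X (Y ⊗ Z) ≫
        (X ⊗ g.objᘁ) ◁ (g.obj ◁ (h.conjCoact Y Z ▷ g.objᘁ)) ≫
          (X ⊗ g.objᘁ) ◁ g.conjComu (Y ⊗ h.objᘁ) (h.obj ⊗ (Z ⊗ h.objᘁ)) ≫ (α_ _ _ _).inv := by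
  let D := (rightDualTensorIso g.obj h.obj).hom
  let a := g.obj ⊗ h.obj
  let c := h.objᘁ ⊗ g.objᘁ
  let s : 𝟙_ C ⟶ c ⊗ a := h.invEvaluation ⊗≫ h.objᘁ ◁ (g.invEvaluation ▷ h.obj) ⊗≫ 𝟙 _
  let t : 𝟙_ C ⟶ aᘁ ⊗ a := (g ⊗ h).invEvaluation
  have ht : t ≫ D ▷ a = s := invEvaluation_tensor g h
  calc
    _ = 𝟙 (((X ⊗ Y) ⊗ Z) ⊗ aᘁ) ⊗≫ (X ⊗ Y) ◁ (t ▷ (Z ⊗ aᘁ) ≫ (aᘁ ⊗ a) ◁ (Z ◁ D)) ⊗≫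
        (X ⊗ Y) ◁ (D ▷ a) ▷ (Z ⊗ c) ⊗≫ X ◁ g.invEvaluation ▷ (Y ⊗ (c ⊗ a) ⊗ (Z ⊗ c)) ⊗≫ 𝟙 _ := by
      dsimp only [conjMul, dualMul, conjCoact, conjTensor, tensor_obj', D, a, c, t]; monoidal
    _ = 𝟙 (((X ⊗ Y) ⊗ Z) ⊗ aᘁ) ⊗≫ (X ⊗ Y ⊗ Z) ◁ D ⊗≫
        (X ⊗ Y) ◁ (t ≫ D ▷ a) ▷ (Z ⊗ c) ⊗≫
          X ◁ g.invEvaluation ▷ (Y ⊗ (c ⊗ a) ⊗ (Z ⊗ c)) ⊗≫ 𝟙 _ := by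
      rw [← whisker_exchange]; monoidal
    _ = 𝟙 (((X ⊗ Y) ⊗ Z) ⊗ aᘁ) ⊗≫ (X ⊗ Y ⊗ Z) ◁ D ⊗≫
        X ◁ (𝟙_ C ◁ (Y ◁ s) ≫ g.invEvaluation ▷ (Y ⊗ (c ⊗ a))) ▷ (Z ⊗ c) ⊗≫ 𝟙 _ := by
      rw [ht]; monoidal
    _ = _ := by
      rw [whisker_exchange]
      dsimp only [conjMul, dualMul, conjCoact, conjComu, s, D, a, c]; monoidal

/-- The isomorphisms `conjMul` are natural in the invertible objects. -/
lemma conjMul_natural_obj {g g' h h' : InvObj C} (f : g.obj ≅ g'.obj) (k : h.obj ≅ h'.obj)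
    (X Y : C) :
    (X ⊗ Y) ◁ (f.inv ⊗ₘ k.inv)ᘁ ≫ g'.conjMul h' X Y =
      g.conjMul h X Y ≫ (X ⊗ g.objᘁ) ◁ (f.hom ⊗ₘ ((Y ⊗ h.objᘁ) ◁ (f.inv)ᘁ)) ≫
        (X ◁ (f.inv)ᘁ) ▷ _ ≫ (X ⊗ g'.objᘁ) ◁ (g'.obj ◁ ((Y ◁ (k.inv)ᘁ) ▷ g'.objᘁ)) := by
  let p := (f.inv)ᘁ
  let q := (k.inv)ᘁ
  have e : (X ⊗ Y) ◁ (f.inv ⊗ₘ k.inv)ᘁ ≫ g'.dualMul h' X Y =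
      g.dualMul h X Y ≫ (X ⊗ (Y ⊗ h.objᘁ)) ◁ p ≫ (X ◁ (Y ◁ q)) ▷ g'.objᘁ := by
    calc
      _ = (X ⊗ Y) ◁ ((f.inv ⊗ₘ k.inv)ᘁ ≫ (rightDualTensorIso g'.obj h'.obj).hom) ⊗≫ 𝟙 _ := by
        dsimp only [dualMul]; monoidal
      _ = _ := by
        rw [rightDualTensorIso_hom_natural, MonoidalCategory.tensorHom_def']
        dsimp only [dualMul, p, q]; monoidal
  have e' := conjCoact_natural_obj f X (Y ⊗ h.objᘁ)
  rw [conjMul, conjMul, reassoc_of% e, conjCoact_natural_right, reassoc_of% e']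
  simp only [Category.assoc, q]

/-- The compatibility of `conjMul` with the associators of `Inv C` and of `C`. By `conjMul_right`
it reduces to the associativity of the isomorphisms `(a ⊗ b)* ≅ b* ⊗ a*`. -/
lemma conjMul_assoc (g h k : InvObj C) (X Y Z : C) :
    ((X ⊗ Y) ⊗ Z) ◁ ((α_ g.obj h.obj k.obj).inv)ᘁ ≫ (α_ X Y Z).hom ▷ _ ≫
        g.conjMul (h ⊗ k) X (Y ⊗ Z) ≫
          (X ⊗ g.objᘁ) ◁ (g.obj ◁ (h.conjMul k Y Z ▷ g.objᘁ)) =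
      (g ⊗ h).conjMul k (X ⊗ Y) Z ≫
        ((X ⊗ Y) ⊗ (g.obj ⊗ h.obj)ᘁ) ◁ g.conjTensor h (Z ⊗ k.objᘁ) ≫
          g.conjMul h X Y ▷ _ ≫ (α_ _ _ _).hom ≫
            (X ⊗ g.objᘁ) ◁ g.conjMu (Y ⊗ h.objᘁ) (h.obj ⊗ ((Z ⊗ k.objᘁ) ⊗ h.objᘁ)) := by
  have e₁ := conjMul_right g h X Y (Z ⊗ k.objᘁ)
  have e₂ : ((X ⊗ Y) ⊗ Z) ◁ ((α_ g.obj h.obj k.obj).inv)ᘁ ≫ (α_ X Y Z).hom ▷ _ ≫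
      g.dualMul (h ⊗ k) X (Y ⊗ Z) ≫ (X ◁ h.dualMul k Y Z) ▷ g.objᘁ =
      (g ⊗ h).dualMul k (X ⊗ Y) Z ≫ (α_ X Y (Z ⊗ k.objᘁ)).hom ▷ _ ≫
        g.dualMul h X (Y ⊗ (Z ⊗ k.objᘁ)) := by
    calc
      _ = ((X ⊗ Y) ⊗ Z) ◁ (((α_ g.obj h.obj k.obj).inv)ᘁ ≫
          (rightDualTensorIso g.obj (h.obj ⊗ k.obj)).hom ≫
            (rightDualTensorIso h.obj k.obj).hom ▷ g.objᘁ ≫ (α_ _ _ _).hom) ⊗≫ 𝟙 _ := by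
        dsimp only [dualMul, tensor_obj']; monoidal
      _ = _ := by
        rw [← rightDualTensorIso_hom_assoc]
        dsimp only [dualMul, tensor_obj']; monoidal
  have e₃ : (X ⊗ g.objᘁ) ◁ g.conjComu (Y ⊗ h.objᘁ) (h.obj ⊗ ((Z ⊗ k.objᘁ) ⊗ h.objᘁ)) ≫
      (X ⊗ g.objᘁ) ◁ g.conjMu (Y ⊗ h.objᘁ) (h.obj ⊗ ((Z ⊗ k.objᘁ) ⊗ h.objᘁ)) = 𝟙 _ := by
    rw [← MonoidalCategory.whiskerLeft_comp, conjComu_conjMu, MonoidalCategory.whiskerLeft_id]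
  have e₄ {U A B : C} (d : U ⟶ (X ⊗ A) ⊗ g.objᘁ) (f : A ⟶ B) :
      (d ≫ g.conjCoact X A) ≫ (X ⊗ g.objᘁ) ◁ (g.obj ◁ (f ▷ g.objᘁ)) =
        d ≫ (X ◁ f) ▷ g.objᘁ ≫ g.conjCoact X B := by
    rw [Category.assoc, conjCoact_natural_right]
  have e₅ {U A B B' : C} (d : U ⟶ (X ⊗ A) ⊗ g.objᘁ) (f : A ⟶ B) (f' : B ⟶ B') :
      (d ≫ g.conjCoact X A) ≫ (X ⊗ g.objᘁ) ◁ (g.obj ◁ ((f ≫ f') ▷ g.objᘁ)) =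
        d ≫ (X ◁ f) ▷ g.objᘁ ≫ (X ◁ f') ▷ g.objᘁ ≫ g.conjCoact X B' := by
    rw [e₄]; simp
  have e₆ {P Q R S T U V W : C} {a : P ⟶ Q} {b : Q ⟶ R} {c : R ⟶ S} {d : S ⟶ T} {p : P ⟶ U}
      {q : U ⟶ V} {r : V ⟶ T} (e : a ≫ b ≫ c ≫ d = p ≫ q ≫ r) (z : T ⟶ W) :
      a ≫ b ≫ c ≫ d ≫ z = p ≫ q ≫ r ≫ z := by
    simpa only [Category.assoc] using e =≫ z
  have e₇ {P Q R S T U V W : C} {x : P ⟶ Q} {y : Q ⟶ R} {w : R ⟶ S} {s : P ⟶ U} {c : U ⟶ V}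
      {d : V ⟶ W} {m : W ⟶ T} {n : T ⟶ W} {a : S ≅ T} (e : x ≫ y ≫ w = s ≫ c ≫ d ≫ m ≫ a.inv)
      (e' : m ≫ n = 𝟙 W) : s ≫ c ≫ d = x ≫ y ≫ w ≫ a.hom ≫ n := by
    rw [reassoc_of% e, Iso.inv_hom_id_assoc, e', Category.comp_id]
  let co := h.conjCoact Y (Z ⊗ k.objᘁ)
  refine (congrArg (fun x => _ ≫ _ ≫ x) (e₅ _ (h.dualMul k Y Z) co)).trans ((e₆ e₂ _).trans ?_)
  refine (congrArg (fun x => _ ≫ _ ≫ x) (e₄ _ co).symm).trans ?_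
  exact (congrArg ((g ⊗ h).dualMul k (X ⊗ Y) Z ≫ ·) (e₇ e₁ e₃)).trans (Category.assoc _ _ _).symm

/-- The isomorphisms `X ≅ X ⊗ 𝟙*` are compatible with the right actions. -/
lemma conjUnit_right (X Y : C) :
    ((ρ_ (X ⊗ Y)).inv ≫ (X ⊗ Y) ◁ (unitDualIso C).inv) ≫ (𝟙_ (InvObj C)).conjCoact X Y ≫
        (X ⊗ (𝟙_ (InvObj C)).objᘁ) ◁ conjUnit Y =
      ((ρ_ X).inv ≫ X ◁ (unitDualIso C).inv) ▷ Y := by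
  have key {a b : C} (i : a ⟶ 𝟙_ C) (u : b ≅ 𝟙_ C) (t : 𝟙_ C ⟶ b ⊗ a)
      (ht : t ≫ b ◁ i = u.inv ≫ (ρ_ b).inv) :
      ((ρ_ (X ⊗ Y)).inv ≫ (X ⊗ Y) ◁ u.inv) ≫
          (𝟙 _ ⊗≫ X ◁ t ▷ (Y ⊗ b) ⊗≫ 𝟙 ((X ⊗ b) ⊗ (a ⊗ (Y ⊗ b)))) ≫
            (X ⊗ b) ◁ (i ▷ _ ≫ (λ_ _).hom ≫ Y ◁ u.hom ≫ (ρ_ _).hom) =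
        ((ρ_ X).inv ≫ X ◁ u.inv) ▷ Y := by
    calc
      _ = 𝟙 _ ⊗≫ (X ⊗ Y) ◁ u.inv ⊗≫
          X ◁ ((t ≫ b ◁ i) ▷ (Y ⊗ b) ≫ (b ⊗ 𝟙_ C) ◁ (Y ◁ u.hom)) ⊗≫ 𝟙 _ := by
        monoidal
      _ = 𝟙 _ ⊗≫ (X ⊗ Y) ◁ (u.inv ≫ u.hom) ⊗≫ X ◁ ((t ≫ b ◁ i) ▷ Y) ⊗≫ 𝟙 _ := by
        rw [← whisker_exchange]; monoidal
      _ = _ := by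
        rw [Iso.inv_hom_id, ht]; monoidal
  have := key (𝟙 _) _ _ invEvaluation_unit
  simp only [id_whiskerRight, Category.id_comp] at this
  exact this

lemma conjCoact_conjUnit (X Y : C) :
    (𝟙_ (InvObj C)).conjCoact X Y ≫ (X ⊗ (𝟙_ (InvObj C)).objᘁ) ◁ conjUnit Y =
      (X ⊗ Y) ◁ (unitDualIso C).hom ≫ (ρ_ _).hom ≫
        ((ρ_ X).inv ≫ X ◁ (unitDualIso C).inv) ▷ Y := by
  rw [← conjUnit_right]
  simp only [Category.assoc, Iso.hom_inv_id_assoc, whiskerLeft_hom_inv_assoc]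

/-- The left unit axiom of the null homotopy formed by the `Φ_g`, as an equation in `C`. -/
lemma conjMul_unit_left (g : InvObj C) (X Y : C) :
    (α_ X Y g.objᘁ).hom ≫ ((ρ_ X).inv ≫ X ◁ (unitDualIso C).inv) ▷ (Y ⊗ g.objᘁ) =
      (X ⊗ Y) ◁ ((λ_ g.obj).hom)ᘁ ≫ (𝟙_ (InvObj C)).conjMul g X Y ≫
        (X ⊗ (𝟙_ (InvObj C)).objᘁ) ◁ conjUnit (Y ⊗ g.objᘁ) := by
  have h : ((λ_ g.obj).hom)ᘁ ≫ (rightDualTensorIso (𝟙_ (InvObj C)).obj g.obj).hom ≫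
      g.objᘁ ◁ (unitDualIso C).hom = (ρ_ g.objᘁ).inv := rightDualTensorIso_hom_unit_left _ _
  have key {b c A : C} (u : b ⟶ 𝟙_ C) (l : g.objᘁ ⟶ c) (d : c ⟶ g.objᘁ ⊗ b)
      (h : l ≫ d ≫ g.objᘁ ◁ u = (ρ_ _).inv) (r : X ⊗ (Y ⊗ g.objᘁ) ⟶ A) :
      (X ⊗ Y) ◁ l ≫ ((X ⊗ Y) ◁ d ⊗≫ 𝟙 ((X ⊗ (Y ⊗ g.objᘁ)) ⊗ b)) ≫
        (X ⊗ (Y ⊗ g.objᘁ)) ◁ u ≫ (ρ_ _).hom ≫ r = (α_ X Y g.objᘁ).hom ≫ r := by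
    calc
      _ = (X ⊗ Y) ◁ (l ≫ d ≫ g.objᘁ ◁ u) ⊗≫ r := by monoidal
      _ = _ := by rw [h]; monoidal
  refine Eq.trans ?_ (congrArg (_ ≫ ·) (Category.assoc _ _ _)).symm
  refine Eq.trans ?_ (congrArg (fun x => _ ≫ _ ≫ x) (conjCoact_conjUnit _ _)).symm
  exact (key _ _ _ h _).symm

/-- The right unit axiom of the null homotopy formed by the `Φ_g`, as an equation in `C`. -/
lemma conjMul_unit_right (g : InvObj C) (X Y : C) :
    g.conjCoact X Y ≫ (X ⊗ g.objᘁ) ◁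
        (g.obj ◁ (((ρ_ Y).inv ≫ Y ◁ (unitDualIso C).inv) ▷ g.objᘁ)) =
      (X ⊗ Y) ◁ ((ρ_ g.obj).hom)ᘁ ≫ g.conjMul (𝟙_ (InvObj C)) X Y := by
  have h : ((ρ_ g.obj).hom)ᘁ ≫ (rightDualTensorIso g.obj (𝟙_ (InvObj C)).obj).hom =
      (λ_ g.objᘁ).inv ≫ (unitDualIso C).inv ▷ g.objᘁ := by
    have e := rightDualTensorIso_hom_unit_right (RightRigidCategory.rightDual (𝟙_ C)) g.obj
    exact (Iso.eq_comp_inv (whiskerRightIso (unitDualIso C) g.objᘁ)).2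
      ((Category.assoc _ _ _).trans e)
  have e : (X ⊗ Y) ◁ ((ρ_ g.obj).hom)ᘁ ≫ g.dualMul (𝟙_ (InvObj C)) X Y =
      (X ◁ ((ρ_ Y).inv ≫ Y ◁ (unitDualIso C).inv)) ▷ g.objᘁ := by
    calc
      _ = (X ⊗ Y) ◁ (((ρ_ g.obj).hom)ᘁ ≫
          (rightDualTensorIso g.obj (𝟙_ (InvObj C)).obj).hom) ⊗≫ 𝟙 _ := by
        dsimp only [dualMul, unit_obj']; monoidal
      _ = _ := by
        rw [h]; monoidal
  rw [← conjCoact_natural_right, ← e]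
  exact Category.assoc _ _ _

end InvObj

end FusionFiber

/-! ### The null homotopy of `g ↦ M_{F_g}` -/

namespace FusionFiber

open scoped MonoidalLeftAction MonoidalRightAction

section ConjugationNullHomotopy

open Functor.LaxMonoidal Functor.OplaxMonoidal Functor.Monoidal Family

variable {C : Type u} [Category.{v} C] [Abelian C] [Linear ℂ C] [MonoidalCategory C]
  [MonoidalPreadditive C] [MonoidalLinear ℂ C] [RightRigidCategory C] [FiniteSemisimple C]

attribute [local instance] conjugationMonoidal

/-- The isomorphism `M_{F_f} ∘ Φ_g ≅ Φ_h` attached to an isomorphism `f : g ≅ h`, with components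
`X ⊗ (f⁻¹)*`. -/
noncomputable def conjEquivNatural {g h : InvObj C} (f : g ⟶ h) :
    conjEquiv g ≫ twistMap ((conjugation C).map f) ⟶ conjEquiv h :=
  Bimod.Hom₂.mk
    (NatIso.ofComponents (F := (tensorRight g.objᘁ ⋙ 𝟭 C : C ⥤ C)) (G := tensorRight h.objᘁ)
      (fun X => whiskerLeftIso X (InvObj.dualIso (InvObj.Hom.iso f)))
      (fun {X Y} a => by
        change a ▷ g.objᘁ ≫ Y ◁ _ = X ◁ _ ≫ a ▷ h.objᘁ
        rw [whisker_exchange]))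
    (fun X (m : C) => by
      change (X ⊗ m) ◁ ((InvObj.Hom.iso f).inv)ᘁ ≫ (α_ X m h.objᘁ).hom =
        ((α_ X m g.objᘁ).hom ≫ 𝟙 _) ≫ X ◁ (m ◁ ((InvObj.Hom.iso f).inv)ᘁ)
      simp)
    (fun (m : C) Y => by
      have e := InvObj.conjCoact_natural_obj (InvObj.Hom.iso f) m Y
      rw [← InvObj.inv_conjAct, ← InvObj.inv_conjAct] at e
      exact e)

/-- The isomorphism `M_δ (Φ_{g ⊗ h} (X ⊗ Y)) ≅ Φ_g X ⊗ F_g (Φ_h Y)`. -/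
noncomputable def conjEquivMul (g h : InvObj C) :
    Square (conjEquiv g) (conjEquiv h) (conjEquiv (g ⊗ h) ≫ twistMap (conjTensorIso g h).hom)
      (actL (regular C)) (twistPairing g.conj h.conj) where
  iso (X : C) (Y : C) := @asIso _ _ _ _ (g.conjMul h X Y) (g.isIso_conjMul h X Y)
  natural_left {X X' : C} f (Y : C) := g.conjMul_natural_left h f Y
  natural_right (X : C) {Y Y' : C} f := g.conjMul_natural_right h X f
  bal (X : C) (Y : C) (Z : C) := by
    have e := g.conjMul_balanced h X Y Z
    rw [← InvObj.inv_conjAct] at e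
    exact e
  left (X : C) (Y : C) (Z : C) := by
    refine Eq.trans ?_ (g.conjMul_left h X Y Z)
    exact congrArg (_ ≫ · ≫ _) (Category.comp_id _)
  right (X : C) (Y : C) (Z : C) := by
    have e := g.conjMul_right h X Y Z
    rw [← InvObj.inv_conjAct, ← InvObj.inv_conjAct, ← InvObj.inv_conjMu] at e
    have key {P Q R S T : C} (i : Q ≅ P) {a : Q ⟶ R} {b : R ⟶ S} {c : S ⟶ T} {d : P ⟶ T}
        (e : a ≫ b ≫ c = i.hom ≫ d) : i.inv ≫ (a ≫ b) ≫ c = d := by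
      rw [Category.assoc, e, Iso.inv_hom_id_assoc]
    exact key (whiskerRightIso (α_ X Y Z) _) e

variable (C) in
/-- The isomorphism `X ≅ M_η (Φ_𝟙 X)`. -/
noncomputable def conjEquivOne :
    regularTwist (C := C) ⟶ conjEquiv (𝟙_ (InvObj C)) ≫ twistMap (conjUnitIso C).hom :=
  Bimod.Hom₂.mk
    (NatIso.ofComponents (F := 𝟭 C) (G := (tensorRight (𝟙_ (InvObj C)).objᘁ ⋙ 𝟭 C : C ⥤ C))
      (fun X => (ρ_ X).symm ≪≫ whiskerLeftIso X (InvObj.unitDualIso C).symm)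
      (fun {X Y} f => by
        change f ≫ (ρ_ Y).inv ≫ Y ◁ (InvObj.unitDualIso C).inv =
          ((ρ_ X).inv ≫ X ◁ (InvObj.unitDualIso C).inv) ≫ f ▷ _
        rw [Category.assoc, whisker_exchange, rightUnitor_inv_naturality_assoc]))
    (fun X (m : C) => by
      change ((ρ_ (X ⊗ m)).inv ≫ (X ⊗ m) ◁ (InvObj.unitDualIso C).inv) ≫ (α_ X m _).hom ≫ 𝟙 _ =
        𝟙 _ ≫ X ◁ ((ρ_ m).inv ≫ m ◁ (InvObj.unitDualIso C).inv)
      simp)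
    (fun (m : C) Y => by
      have e := InvObj.conjUnit_right m Y
      rw [← InvObj.inv_conjAct] at e
      exact e.trans (Category.id_comp _).symm)

variable (C) in
set_option maxHeartbeats 400000 in
/-- The null homotopy of `g ↦ M_{F_g}` formed by the equivalences `Φ_g`. The constraints of `M_-`
that occur in its axioms have identity components; without them the axioms are the equations for
`conjMul` and `conjUnit` in `C`. -/
noncomputable def conjugationNullHomotopy :
    NullHomotopy (conjugation C) (twistPseudofunctor C) (twistMonoidal C) where
  Φ g := conjEquiv g
  natural f := conjEquivNatural f
  natural_id g (X : C) := by
    refine Eq.trans ?_ (twistPseudofunctor_idIso _ _ _).symm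
    change X ◁ (𝟙 g.obj)ᘁ = 𝟙 (X ⊗ g.objᘁ)
    rw [rightAdjointMate_id, MonoidalCategory.whiskerLeft_id]
  natural_comp {g h k} f f' (X : C) := by
    have key (a : X ⊗ g.objᘁ ⟶ X ⊗ g.objᘁ) (ha : a = 𝟙 _) :
        X ◁ ((InvObj.Hom.iso f').inv ≫ (InvObj.Hom.iso f).inv)ᘁ =
          a ≫ X ◁ ((InvObj.Hom.iso f).inv)ᘁ ≫ X ◁ ((InvObj.Hom.iso f').inv)ᘁ := by
      rw [ha, comp_rightAdjointMate, MonoidalCategory.whiskerLeft_comp, Category.id_comp]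
    exact key _ (twistPseudofunctor_compIso ((conjugation C).map f) ((conjugation C).map f')
      ((conjugation C).map (f ≫ f')) ((conjugation C).map_comp f f').symm (X ⊗ g.objᘁ : C))
  mul g h := conjEquivMul g h
  mul_natural {g g' h h'} f k (X : C) (Y : C) := by
    let L := (X ⊗ Y) ⊗ (g.obj ⊗ h.obj)ᘁ
    have e₁ := twistPseudofunctor_compIso ((conjugation C).map (f ⊗ₘ k)) (δ (conjugation C) g' h')
      ((conjugation C).map (f ⊗ₘ k) ≫ δ (conjugation C) g' h') rfl L
    have e₂ := twistPseudofunctor_compIso (δ (conjugation C) g h)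
      ((conjugation C).map f ⊗ₘ (conjugation C).map k)
      ((conjugation C).map (f ⊗ₘ k) ≫ δ (conjugation C) g' h') (δ_natural (conjugation C) f k) L
    have key (a b : L ⟶ L) (ha : a = 𝟙 _) (hb : b = 𝟙 _) :
        a ≫ (X ⊗ Y) ◁ ((InvObj.Hom.iso f).inv ⊗ₘ (InvObj.Hom.iso k).inv)ᘁ ≫ g'.conjMul h' X Y =
          b ≫ g.conjMul h X Y ≫ (X ⊗ g.objᘁ) ◁ ((InvObj.Hom.iso f).hom ⊗ₘ
            ((Y ⊗ h.objᘁ) ◁ ((InvObj.Hom.iso f).inv)ᘁ)) ≫ (X ◁ ((InvObj.Hom.iso f).inv)ᘁ) ▷ _ ≫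
              (X ⊗ g'.objᘁ) ◁ (g'.obj ◁ ((Y ◁ ((InvObj.Hom.iso k).inv)ᘁ) ▷ g'.objᘁ)) := by
      rw [ha, hb, Category.id_comp, Category.id_comp, InvObj.conjMul_natural_obj]
    exact key _ _ e₁ e₂
  one := conjEquivOne C
  mul_assoc g h k (X : C) (Y : C) (Z : C) := by
    let L := ((X ⊗ Y) ⊗ Z) ⊗ ((g.obj ⊗ h.obj) ⊗ k.obj)ᘁ
    have e₁ := twistPseudofunctor_compIso ((conjugation C).map (α_ g h k).hom)
      (δ (conjugation C) g (h ⊗ k) ≫ (𝟙 ((conjugation C).obj g) ⊗ₘ δ (conjugation C) h k))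
      (δ (conjugation C) (g ⊗ h) k ≫ (δ (conjugation C) g h ⊗ₘ 𝟙 ((conjugation C).obj k)) ≫
        (α_ ((conjugation C).obj g) ((conjugation C).obj h) ((conjugation C).obj k)).hom)
      (by simp) L
    have e₂ := twistPseudofunctor_compIso (δ (conjugation C) g (h ⊗ k))
      (𝟙 ((conjugation C).obj g) ⊗ₘ δ (conjugation C) h k) _ rfl L
    have e₃ := twistPseudofunctor_compIso (δ (conjugation C) (g ⊗ h) k)
      ((δ (conjugation C) g h ⊗ₘ 𝟙 ((conjugation C).obj k)) ≫
        (α_ ((conjugation C).obj g) ((conjugation C).obj h) ((conjugation C).obj k)).hom) _ rfl L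
    have e₄ := twistPseudofunctor_compIso (δ (conjugation C) g h ⊗ₘ 𝟙 ((conjugation C).obj k))
      (α_ ((conjugation C).obj g) ((conjugation C).obj h) ((conjugation C).obj k)).hom _ rfl L
    have e₅ := twistPseudofunctor_idIso (𝟙 ((conjugation C).obj g)) rfl (X ⊗ g.objᘁ : C)
    have e₆ := twistPseudofunctor_idIso (𝟙 ((conjugation C).obj k)) rfl (Z ⊗ k.objᘁ : C)
    have key {A₁ A₂ P Q S B₁ B₂ R : C} {n : L ⟶ A₁} {q : A₁ ⟶ A₂} {r : A₂ ⟶ P ⊗ Q} {s : P ⊗ Q ⟶ S}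
        {t : L ⟶ B₁} {t' : B₁ ⟶ B₂}
        {v : B₂ ⟶ R ⊗ (g.obj ⊗ ((h.obj ⊗ ((Z ⊗ k.objᘁ) ⊗ h.objᘁ)) ⊗ g.objᘁ))} {B₃ : C}
        {w : R ⊗ (g.obj ⊗ ((h.obj ⊗ ((Z ⊗ k.objᘁ) ⊗ h.objᘁ)) ⊗ g.objᘁ)) ⟶ B₃} {x : B₃ ⟶ S}
        (e : n ≫ q ≫ r ≫ s = t ≫ t' ≫ v ≫ w ≫ x) (a b a' b' : L ⟶ L) (c : P ⟶ P)
        (c' : Z ⊗ k.objᘁ ⟶ Z ⊗ k.objᘁ) (ha : a = 𝟙 _) (hb : b = 𝟙 _) (ha' : a' = 𝟙 _)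
        (hb' : b' = 𝟙 _) (hc : c = 𝟙 _) (hc' : c' = 𝟙 _) :
        a ≫ b ≫ ((n ≫ q) ≫ r) ≫ P ◁ 𝟙 Q ≫ c ▷ Q ≫ s =
          a' ≫ b' ≫ (t ≫ t' ≫ v ≫
            R ◁ (g.obj ◁ ((h.obj ◁ (c' ▷ h.objᘁ)) ▷ g.objᘁ))) ≫ w ≫ x := by
      simp only [ha, hb, ha', hb', hc, hc', id_whiskerRight, MonoidalCategory.whiskerLeft_id,
        Category.id_comp, Category.comp_id, Category.assoc, e]
    exact key (InvObj.conjMul_assoc g h k X Y Z) _ _ _ _ _ _ e₁ e₂ e₃ e₄ e₅ e₆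
  one_mul g (X : C) (Y : C) := by
    have e₁ := twistPseudofunctor_compIso ((conjugation C).map (λ_ g).inv)
      (δ (conjugation C) (𝟙_ _) g ≫ (η (conjugation C) ⊗ₘ 𝟙 ((conjugation C).obj g)))
      (λ_ ((conjugation C).obj g)).inv (by simp) ((X ⊗ Y) ⊗ g.objᘁ : C)
    have e₂ := twistPseudofunctor_compIso (δ (conjugation C) (𝟙_ _) g)
      (η (conjugation C) ⊗ₘ 𝟙 ((conjugation C).obj g)) _ rfl ((X ⊗ Y) ⊗ g.objᘁ : C)
    have e₃ := twistPseudofunctor_idIso (𝟙 ((conjugation C).obj g)) rfl (Y ⊗ g.objᘁ : C)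
    have key (a b : (X ⊗ Y) ⊗ g.objᘁ ⟶ (X ⊗ Y) ⊗ g.objᘁ) (c : Y ⊗ g.objᘁ ⟶ Y ⊗ g.objᘁ)
        (ha : a = 𝟙 _) (hb : b = 𝟙 _) (hc : c = 𝟙 _) :
        (α_ X Y g.objᘁ).hom ≫ 𝟙 (X ⊗ (Y ⊗ g.objᘁ)) ≫
            ((ρ_ X).inv ≫ X ◁ (InvObj.unitDualIso C).inv) ▷ (Y ⊗ g.objᘁ) =
          a ≫ b ≫ ((X ⊗ Y) ◁ ((λ_ g.obj).hom)ᘁ ≫ (𝟙_ (InvObj C)).conjMul g X Y) ≫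
            (X ⊗ (𝟙_ (InvObj C)).objᘁ) ◁ InvObj.conjUnit (Y ⊗ g.objᘁ) ≫
              (X ⊗ (𝟙_ (InvObj C)).objᘁ) ◁ c := by
      rw [ha, hb, hc, Category.id_comp, Category.id_comp, Category.id_comp,
        MonoidalCategory.whiskerLeft_id, Category.comp_id, InvObj.conjMul_unit_left]
      exact (Category.assoc _ _ _).symm
    exact key _ _ _ e₁ e₂ e₃
  mul_one g (X : C) (Y : C) := by
    have e₁ := twistPseudofunctor_compIso ((conjugation C).map (ρ_ g).inv)
      (δ (conjugation C) g (𝟙_ _) ≫ (𝟙 ((conjugation C).obj g) ⊗ₘ η (conjugation C)))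
      (ρ_ ((conjugation C).obj g)).inv (by simp) ((X ⊗ Y) ⊗ g.objᘁ : C)
    have e₂ := twistPseudofunctor_compIso (δ (conjugation C) g (𝟙_ _))
      (𝟙 ((conjugation C).obj g) ⊗ₘ η (conjugation C)) _ rfl ((X ⊗ Y) ⊗ g.objᘁ : C)
    have e₃ := twistPseudofunctor_idIso (𝟙 ((conjugation C).obj g)) rfl (X ⊗ g.objᘁ : C)
    have key (a b : (X ⊗ Y) ⊗ g.objᘁ ⟶ (X ⊗ Y) ⊗ g.objᘁ) (c : X ⊗ g.objᘁ ⟶ X ⊗ g.objᘁ)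
        (ha : a = 𝟙 _) (hb : b = 𝟙 _) (hc : c = 𝟙 _) :
        inv (g.conjAct X Y) ≫ 𝟙 _ ≫ (X ⊗ g.objᘁ) ◁
            (g.obj ◁ (((ρ_ Y).inv ≫ Y ◁ (InvObj.unitDualIso C).inv) ▷ g.objᘁ)) =
          a ≫ b ≫ ((X ⊗ Y) ◁ ((ρ_ g.obj).hom)ᘁ ≫ g.conjMul (𝟙_ (InvObj C)) X Y) ≫
            (X ⊗ g.objᘁ) ◁ 𝟙 (g.obj ⊗ ((Y ⊗ (𝟙_ (InvObj C)).objᘁ) ⊗ g.objᘁ)) ≫ c ▷ _ := by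
      rw [ha, hb, hc, Category.id_comp, Category.id_comp, Category.id_comp,
        MonoidalCategory.whiskerLeft_id, Category.id_comp, id_whiskerRight,
        InvObj.inv_conjAct, InvObj.conjMul_unit_right]
      exact (Category.comp_id _).symm
    exact key _ _ _ e₁ e₂ e₃

end ConjugationNullHomotopy

end FusionFiber

/-! ### Recognition of conjugation by an invertible object -/

namespace FusionFiber

section ConjugationRecognition

open Functor.LaxMonoidal Functor.OplaxMonoidal Functor.Monoidal

variable {C : Type u} [Category.{v} C] [MonoidalCategory C]

namespace InvObj

/-- An object `a` with a right inverse `d` that has a right inverse itself is invertible. -/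
lemma exists_of_iso {a d b : C} (i : a ⊗ d ≅ 𝟙_ C) (j : d ⊗ b ≅ 𝟙_ C) :
    ∃ g : InvObj C, g.obj = a ∧ Nonempty (d ⊗ g.obj ≅ 𝟙_ C) := by
  -- a left and a right inverse of `d` are isomorphic
  let e : a ≅ b := (ρ_ a).symm ≪≫ whiskerLeftIso a j.symm ≪≫ (α_ a d b).symm ≪≫
    whiskerRightIso i b ≪≫ λ_ b
  exact ⟨⟨a, d, ⟨i⟩, ⟨whiskerLeftIso d e ≪≫ j⟩⟩, rfl, ⟨whiskerLeftIso d e ≪≫ j⟩⟩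

variable [RightRigidCategory C]

/-- The dual of an invertible object as an invertible object. -/
@[simps] noncomputable def dual (g : InvObj C) : InvObj C where
  obj := g.objᘁ
  invertible := ⟨g.obj, ⟨asIso (ε_ g.obj g.objᘁ)⟩, ⟨(asIso (η_ g.obj g.objᘁ)).symm⟩⟩

lemma isEquivalence_tensorLeft_dual (g : InvObj C) : (tensorLeft g.objᘁ).IsEquivalence :=
  g.dual.isEquivalence_tensorLeft

/-- An isomorphism between the duals of invertible objects is the dual of an isomorphism. -/
lemma exists_rightAdjointMate_eq {g h : InvObj C} (u : g.objᘁ ≅ h.objᘁ) :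
    ∃ f : g.obj ≅ h.obj, (f.inv)ᘁ = u.hom := by
  have := g.isEquivalence_tensorLeft_dual
  let e : g.objᘁ ⊗ h.obj ≅ g.objᘁ ⊗ g.obj :=
    whiskerRightIso u h.obj ≪≫ asIso (ε_ h.obj h.objᘁ) ≪≫ (asIso (ε_ g.obj g.objᘁ)).symm
  let f : h.obj ≅ g.obj := (tensorLeft g.objᘁ).preimageIso e
  have hf : g.objᘁ ◁ f.hom = e.hom := (tensorLeft g.objᘁ).map_preimage e.hom
  refine ⟨f.symm, hom_ext_evaluation h.obj ?_⟩
  rw [rightAdjointMate_comp_evaluation]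
  change g.objᘁ ◁ f.hom ≫ _ = _
  rw [hf]
  simp [e]

lemma rightAdjointMate_injective {g h : InvObj C} {f f' : g.obj ⟶ h.obj}
    (w : fᘁ = f'ᘁ) : f = f' := by
  have := h.isEquivalence_tensorLeft_dual
  refine (tensorLeft h.objᘁ).map_injective ?_
  change h.objᘁ ◁ f = h.objᘁ ◁ f'
  rw [← cancel_mono (ε_ h.obj h.objᘁ), ← rightAdjointMate_comp_evaluation,
    ← rightAdjointMate_comp_evaluation, w]

/-- A functor `φ` from `C` to itself which is isomorphic to `X ↦ X ⊗ g*` as left module functor and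
intertwines the right actions of `Y` and `F Y` determines a monoidal isomorphism `F_g ≅ F`. -/
theorem exists_conj_iso (g : InvObj C) (F : C ⥤ C) [F.Monoidal] (φ : C ⥤ C)
    (l : ∀ X m : C, φ.obj (X ⊗ m) ≅ X ⊗ φ.obj m)
    (r : ∀ m Y : C, φ.obj (m ⊗ Y) ≅ φ.obj m ⊗ F.obj Y)
    (r_natural : ∀ {m m' : C} (f : m ⟶ m') (Y : C),
      φ.map (f ▷ Y) ≫ (r m' Y).hom = (r m Y).hom ≫ φ.map f ▷ F.obj Y)
    (r_natural_right : ∀ (m : C) {Y Y' : C} (f : Y ⟶ Y'),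
      φ.map (m ◁ f) ≫ (r m Y').hom = (r m Y).hom ≫ φ.obj m ◁ F.map f)
    (r_assoc : ∀ m Y Y' : C, φ.map (α_ m Y Y').inv ≫ (r (m ⊗ Y) Y').hom ≫ (r m Y).hom ▷ F.obj Y' =
      (r m (Y ⊗ Y')).hom ≫ φ.obj m ◁ δ F Y Y' ≫ (α_ _ _ _).inv)
    (r_unit : ∀ m : C, (r m (𝟙_ C)).hom ≫ φ.obj m ◁ η F ≫ (ρ_ _).hom = φ.map (ρ_ m).hom)
    (middle : ∀ X m Y : C, φ.map (α_ X m Y).hom ≫ (l X (m ⊗ Y)).hom ≫ X ◁ (r m Y).hom =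
      (r (X ⊗ m) Y).hom ≫ (l X m).hom ▷ F.obj Y ≫ (α_ _ _ _).hom)
    (κ : ∀ X : C, X ⊗ g.objᘁ ≅ φ.obj X)
    (κ_natural : ∀ {X X' : C} (f : X ⟶ X'), f ▷ g.objᘁ ≫ (κ X').hom = (κ X).hom ≫ φ.map f)
    (κ_left : ∀ X m : C, (κ (X ⊗ m)).hom ≫ (l X m).hom = (α_ X m g.objᘁ).hom ≫ X ◁ (κ m).hom) :
    ∃ θ : g.conjFunctor ≅ F, NatTrans.IsMonoidal θ.hom ∧ ∀ m Y : C,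
      g.conjAct m Y ≫ (κ (m ⊗ Y)).hom ≫ (r m Y).hom =
        (m ⊗ g.objᘁ) ◁ θ.hom.app Y ≫ (κ m).hom ▷ F.obj Y := by
  let w : C := 𝟙_ C ⊗ g.objᘁ
  have : (tensorLeft w).IsEquivalence := (InvObj.unit.tensor g.dual).isEquivalence_tensorLeft
  have cancel {X Y : C} {f f' : X ⟶ Y} (h : w ◁ f = w ◁ f') : f = f' :=
    (tensorLeft w).map_injective h
  -- the right compatibility at `𝟙 ⊗ g*`, an invertible object, determines the components of `θ`
  let R (Y : C) : w ⊗ (g.obj ⊗ (Y ⊗ g.objᘁ)) ≅ w ⊗ F.obj Y :=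
    asIso (g.conjAct (𝟙_ C) Y) ≪≫ κ (𝟙_ C ⊗ Y) ≪≫ r (𝟙_ C) Y ≪≫
      (whiskerRightIso (κ (𝟙_ C)) (F.obj Y)).symm
  let t (Y : C) : g.obj ⊗ (Y ⊗ g.objᘁ) ≅ F.obj Y := (tensorLeft w).preimageIso (R Y)
  have ht (Y : C) : w ◁ (t Y).hom = (R Y).hom := (tensorLeft w).map_preimage (R Y).hom
  have h₁ (Y : C) : g.conjAct (𝟙_ C) Y ≫ (κ (𝟙_ C ⊗ Y)).hom ≫ (r (𝟙_ C) Y).hom =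
      w ◁ (t Y).hom ≫ (κ (𝟙_ C)).hom ▷ F.obj Y := by
    rw [ht]; simp [R, ← comp_whiskerRight]
  have h_left (X m Y : C) (h : g.conjAct m Y ≫ (κ (m ⊗ Y)).hom ≫ (r m Y).hom =
      (m ⊗ g.objᘁ) ◁ (t Y).hom ≫ (κ m).hom ▷ F.obj Y) :
      g.conjAct (X ⊗ m) Y ≫ (κ ((X ⊗ m) ⊗ Y)).hom ≫ (r (X ⊗ m) Y).hom =
        ((X ⊗ m) ⊗ g.objᘁ) ◁ (t Y).hom ≫ (κ (X ⊗ m)).hom ▷ F.obj Y := by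
    rw [← cancel_mono ((l X m).hom ▷ F.obj Y ≫ (α_ _ _ _).hom)]
    simp only [Category.assoc]
    rw [← middle, ← comp_whiskerRight_assoc, κ_left, ← reassoc_of% κ_natural (α_ X m Y).hom,
      reassoc_of% κ_left X (m ⊗ Y), ← reassoc_of% g.conjAct_left X m Y,
      ← MonoidalCategory.whiskerLeft_comp, ← MonoidalCategory.whiskerLeft_comp, h]
    monoidal
  -- the left compatibility propagates the defining equation of `θ` from `𝟙` to all objects
  have h_all (m Y : C) : g.conjAct m Y ≫ (κ (m ⊗ Y)).hom ≫ (r m Y).hom =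
      (m ⊗ g.objᘁ) ◁ (t Y).hom ≫ (κ m).hom ▷ F.obj Y := by
    have h := h_left m (𝟙_ C) Y (h₁ Y)
    rw [← cancel_epi (((ρ_ m).hom ▷ g.objᘁ) ▷ (g.obj ⊗ (Y ⊗ g.objᘁ))),
      reassoc_of% g.conjAct_natural_left (ρ_ m).hom Y, reassoc_of% κ_natural, r_natural,
      reassoc_of% h, ← whisker_exchange_assoc, ← comp_whiskerRight, ← comp_whiskerRight, κ_natural]
  refine ⟨NatIso.ofComponents t ?_, { unit := ?_, tensor := ?_ }, h_all⟩
  · intro X Y f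
    refine cancel ?_
    change w ◁ (g.obj ◁ (f ▷ g.objᘁ) ≫ (t Y).hom) = w ◁ ((t X).hom ≫ F.map f)
    rw [← cancel_mono ((κ (𝟙_ C)).hom ▷ F.obj Y), MonoidalCategory.whiskerLeft_comp,
      MonoidalCategory.whiskerLeft_comp, Category.assoc, Category.assoc, ← h₁,
      reassoc_of% g.conjAct_natural_right (𝟙_ C) f, whisker_exchange, ← reassoc_of% h₁ X,
      reassoc_of% κ_natural, r_natural_right]
  · refine cancel ?_
    change w ◁ (g.conjEps ≫ (t (𝟙_ C)).hom) = w ◁ ε F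
    have e : w ◁ g.conjEps ≫ g.conjAct (𝟙_ C) (𝟙_ C) =
        (ρ_ w).hom ≫ (ρ_ (𝟙_ C)).inv ▷ g.objᘁ := by
      rw [g.conjAct_unit]; simp [← comp_whiskerRight, w]
    have e' : φ.map (ρ_ (𝟙_ C)).inv ≫ (r (𝟙_ C) (𝟙_ C)).hom =
        (ρ_ _).inv ≫ φ.obj (𝟙_ C) ◁ ε F := by
      rw [← cancel_epi (φ.map (ρ_ (𝟙_ C)).hom), ← Functor.map_comp_assoc, Iso.hom_inv_id,
        CategoryTheory.Functor.map_id, Category.id_comp, ← r_unit]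
      simp [← MonoidalCategory.whiskerLeft_comp]
    rw [← cancel_mono ((κ (𝟙_ C)).hom ▷ F.obj (𝟙_ C)), MonoidalCategory.whiskerLeft_comp,
      Category.assoc, ← h₁, reassoc_of% e, reassoc_of% κ_natural, e', whisker_exchange]
    simp
  · intro X Y
    refine cancel ?_
    change w ◁ (g.conjMu X Y ≫ (t (X ⊗ Y)).hom) = w ◁ (((t X).hom ⊗ₘ (t Y).hom) ≫ μ F X Y)
    have e : w ◁ g.conjMu X Y ≫ g.conjAct (𝟙_ C) (X ⊗ Y) =
        (α_ _ _ _).inv ≫ g.conjAct (𝟙_ C) X ▷ _ ≫ g.conjAct (𝟙_ C ⊗ X) Y ≫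
          (α_ _ _ _).hom ▷ g.objᘁ := by
      rw [g.conjAct_assoc, Iso.inv_hom_id_assoc]
    have e' : φ.map (α_ (𝟙_ C) X Y).hom ≫ (r (𝟙_ C) (X ⊗ Y)).hom =
        (r (𝟙_ C ⊗ X) Y).hom ≫ (r (𝟙_ C) X).hom ▷ F.obj Y ≫ (α_ _ _ _).hom ≫ _ ◁ μ F X Y := by
      rw [← cancel_epi (φ.map (α_ (𝟙_ C) X Y).inv), ← Functor.map_comp_assoc, Iso.inv_hom_id,
        CategoryTheory.Functor.map_id, Category.id_comp, reassoc_of% r_assoc]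
      simp [← MonoidalCategory.whiskerLeft_comp]
    rw [← cancel_mono ((κ (𝟙_ C)).hom ▷ F.obj (X ⊗ Y)), MonoidalCategory.whiskerLeft_comp,
      Category.assoc, ← h₁, reassoc_of% e, reassoc_of% κ_natural, e',
      reassoc_of% h_all (𝟙_ C ⊗ X) Y, ← whisker_exchange_assoc, ← comp_whiskerRight_assoc, ← comp_whiskerRight_assoc]
    simp only [Category.assoc]
    rw [h₁, MonoidalCategory.tensorHom_def', MonoidalCategory.whiskerLeft_comp, Category.assoc,
      whisker_exchange (κ (𝟙_ C)).hom (μ F X Y)]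
    monoidal

/-- An autoequivalence of the left module category `C` which intertwines the right actions of `Y`
and `F Y` is isomorphic to `X ↦ X ⊗ g*` for some invertible object `g`. -/
theorem exists_trivialization (F : C → C) (φ : C ⥤ C) [φ.IsEquivalence]
    (l : ∀ X m : C, φ.obj (X ⊗ m) ≅ X ⊗ φ.obj m)
    (r : ∀ m Y : C, φ.obj (m ⊗ Y) ≅ φ.obj m ⊗ F Y)
    (l_natural_left : ∀ {X X' : C} (f : X ⟶ X') (m : C),
      φ.map (f ▷ m) ≫ (l X' m).hom = (l X m).hom ≫ f ▷ φ.obj m)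
    (l_natural : ∀ (X : C) {m m' : C} (f : m ⟶ m'),
      φ.map (X ◁ f) ≫ (l X m').hom = (l X m).hom ≫ X ◁ φ.map f)
    (l_assoc : ∀ X X' m : C, φ.map (α_ X X' m).hom ≫ (l X (X' ⊗ m)).hom ≫ X ◁ (l X' m).hom =
      (l (X ⊗ X') m).hom ≫ (α_ X X' (φ.obj m)).hom) :
    ∃ (g : InvObj C) (κ : ∀ X : C, X ⊗ g.objᘁ ≅ φ.obj X),
      (∀ {X X' : C} (f : X ⟶ X'), f ▷ g.objᘁ ≫ (κ X').hom = (κ X).hom ≫ φ.map f) ∧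
      ∀ X m : C, (κ (X ⊗ m)).hom ≫ (l X m).hom = (α_ X m g.objᘁ).hom ≫ X ◁ (κ m).hom := by
  let d := φ.obj (𝟙_ C)
  -- since `φ Y ≅ Y ⊗ d ≅ d ⊗ F Y`, an object `Y` with `φ Y ≅ 𝟙` gives one-sided inverses of `d`
  let Y := φ.objPreimage (𝟙_ C)
  let y : φ.obj Y ≅ 𝟙_ C := φ.objObjPreimageIso (𝟙_ C)
  obtain ⟨g, -, ⟨i⟩⟩ := exists_of_iso
    ((l Y (𝟙_ C)).symm ≪≫ φ.mapIso (ρ_ Y) ≪≫ y) ((r (𝟙_ C) Y).symm ≪≫ φ.mapIso (λ_ Y) ≪≫ y)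
  let e : g.objᘁ ≅ d := (λ_ _).symm ≪≫ whiskerRightIso i.symm _ ≪≫ α_ _ _ _ ≪≫
    whiskerLeftIso d (asIso (η_ g.obj g.objᘁ)).symm ≪≫ ρ_ d
  refine ⟨g, fun X => whiskerLeftIso X e ≪≫ (l X (𝟙_ C)).symm ≪≫ φ.mapIso (ρ_ X), ?_, ?_⟩
  · intro X X' f
    have h := l_natural_left f (𝟙_ C)
    have h' : f ▷ d ≫ (l X' (𝟙_ C)).inv = (l X (𝟙_ C)).inv ≫ φ.map (f ▷ 𝟙_ C) := by
      rw [Iso.comp_inv_eq, Category.assoc, h, Iso.inv_hom_id_assoc]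
    simp only [Iso.trans_hom, whiskerLeftIso_hom, Iso.symm_hom, Functor.mapIso_hom,
      Category.assoc]
    rw [← whisker_exchange_assoc, reassoc_of% h', ← Functor.map_comp, ← Functor.map_comp,
      rightUnitor_naturality]
  · intro X m
    have h := l_assoc X m (𝟙_ C)
    have h' := l_natural X (ρ_ m).hom
    have h'' : (l (X ⊗ m) (𝟙_ C)).inv ≫ φ.map (ρ_ (X ⊗ m)).hom ≫ (l X m).hom =
        (α_ X m d).hom ≫ X ◁ (l m (𝟙_ C)).inv ≫ X ◁ φ.map (ρ_ m).hom := by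
      rw [Iso.inv_comp_eq, ← reassoc_of% h, rightUnitor_tensor_hom, Functor.map_comp,
        Category.assoc, h']
      simp
    simp only [Iso.trans_hom, whiskerLeftIso_hom, Iso.symm_hom, Functor.mapIso_hom,
      Category.assoc, h'', MonoidalCategory.whiskerLeft_comp]
    simp

end InvObj

end ConjugationRecognition

end FusionFiber

/-! ### The homotopy fiber of `M_-` -/

namespace FusionFiber

open scoped MonoidalLeftAction MonoidalRightAction

section TwistFiber

open Functor.LaxMonoidal Functor.OplaxMonoidal Functor.Monoidal Family

variable {C : Type u} [Category.{v} C] [Abelian C] [Linear ℂ C] [MonoidalCategory C]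
  [MonoidalPreadditive C] [MonoidalLinear ℂ C] [FiniteSemisimple C]

namespace HomotopyFiber

/-- The functor underlying the equivalence of an object of the homotopy fiber of `M_-`, as a functor
from `C` to itself. -/
abbrev fiberFunctor (A : HomotopyFiber (twistPseudofunctor C) (regular C)) : C ⥤ C :=
  Bimod.Hom.functor A.equiv

/-- The natural isomorphism underlying the 2-cell of a morphism in the homotopy fiber of `M_-`. -/
def cellIso {A B : HomotopyFiber (twistPseudofunctor C) (regular C)} (a : A ⟶ B) :
    A.fiberFunctor ≅ B.fiberFunctor :=
  Bimod.Hom₂.iso (Hom.cell a)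

/-- The components of the 2-cell of a morphism in the homotopy fiber of `M_-`, as morphisms of
`C`. -/
abbrev cellApp {A B : HomotopyFiber (twistPseudofunctor C) (regular C)} (a : A ⟶ B) (X : C) :
    A.fiberFunctor.obj X ⟶ B.fiberFunctor.obj X :=
  (cellIso a).hom.app X

/-- The left compatibility isomorphism of an object of the homotopy fiber of `M_-`. -/
def fiberLeft (A : HomotopyFiber (twistPseudofunctor C) (regular C)) (X m : C) :
    A.fiberFunctor.obj (X ⊗ m) ≅ X ⊗ A.fiberFunctor.obj m :=
  Bimod.Hom.left A.equiv X m

/-- The right compatibility isomorphism of an object of the homotopy fiber of `M_-`. -/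
def fiberRight (A : HomotopyFiber (twistPseudofunctor C) (regular C)) (m Y : C) :
    A.fiberFunctor.obj (m ⊗ Y) ≅ A.fiberFunctor.obj m ⊗ A.base.functor.obj Y :=
  Bimod.Hom.right A.equiv m Y

lemma cellApp_left {A B : HomotopyFiber (twistPseudofunctor C) (regular C)} (a : A ⟶ B)
    (X m : C) :
    cellApp a (X ⊗ m) ≫ (B.fiberLeft X m).hom = (A.fiberLeft X m).hom ≫ X ◁ cellApp a m :=
  ((Hom.cell a).left X m).trans (congrArg (· ≫ _) (Category.comp_id _))

lemma cellApp_right {A B : HomotopyFiber (twistPseudofunctor C) (regular C)} (a : A ⟶ B)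
    (m Y : C) :
    cellApp a (m ⊗ Y) ≫ (B.fiberRight m Y).hom =
      ((A.fiberRight m Y).hom ≫ _ ◁ (TensorAut.Hom.iso (Hom.base a)).hom.app Y) ≫
        cellApp a m ▷ B.base.functor.obj Y :=
  (Hom.cell a).right m Y

lemma cellApp_comp {A B D : HomotopyFiber (twistPseudofunctor C) (regular C)} (a : A ⟶ B)
    (b : B ⟶ D) (X : C) : cellApp (a ≫ b) X = cellApp a X ≫ cellApp b X :=
  (Category.id_comp _).trans (Category.id_comp _)

lemma cellApp_id (A : HomotopyFiber (twistPseudofunctor C) (regular C)) (X : C) :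
    cellApp (𝟙 A) X = 𝟙 _ :=
  Category.id_comp _

lemma hom_ext_cellApp {A B : HomotopyFiber (twistPseudofunctor C) (regular C)} {a b : A ⟶ B}
    (h : Hom.base a = Hom.base b) (w : ∀ X : C, cellApp a X = cellApp b X) : a = b := by
  obtain ⟨θ, κ⟩ := a
  obtain ⟨θ', κ'⟩ := b
  obtain rfl : θ = θ' := h
  obtain rfl : κ = κ' := Bimod.hom₂_ext fun X => w X
  rfl

/-- A morphism in the homotopy fiber of `M_-`, given by components of its 2-cell. -/
def mkHom {A B : HomotopyFiber (twistPseudofunctor C) (regular C)} (θ : A.base ⟶ B.base)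
    (κ : A.fiberFunctor ≅ B.fiberFunctor)
    (left : ∀ X m : C, κ.hom.app (X ⊗ m) ≫ (B.fiberLeft X m).hom =
      (A.fiberLeft X m).hom ≫ X ◁ κ.hom.app m)
    (right : ∀ m Y : C, κ.hom.app (m ⊗ Y) ≫ (B.fiberRight m Y).hom =
      ((A.fiberRight m Y).hom ≫ _ ◁ (TensorAut.Hom.iso θ).hom.app Y) ≫
        κ.hom.app m ▷ B.base.functor.obj Y) : A ⟶ B where
  base := θ
  cell := Bimod.Hom₂.mk κ (fun X m => (left X m).trans (congrArg (· ≫ _) (Category.comp_id _).symm))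
    right

/-- The homotopy fiber of `M_-` is a groupoid. -/
lemma isIso_of_twist {A B : HomotopyFiber (twistPseudofunctor C) (regular C)} (a : A ⟶ B) :
    IsIso a := by
  let θ := Hom.base a
  let θ' : B.base ⟶ A.base := (TensorAut.mkIso (TensorAut.Hom.iso θ) inferInstance).inv
  let b : B ⟶ A := mkHom θ' (cellIso a).symm
    (fun X m => by
      have h := cellApp_left a X m
      change (cellIso a).inv.app _ ≫ _ = _ ≫ X ◁ (cellIso a).inv.app m
      rw [← cancel_epi ((cellIso a).hom.app (X ⊗ m)), reassoc_of% h,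
        ← MonoidalCategory.whiskerLeft_comp]
      simp)
    (fun m Y => by
      have h := cellApp_right a m Y
      change (cellIso a).inv.app _ ≫ _ = (_ ≫ _ ◁ (TensorAut.Hom.iso θ).inv.app Y) ≫
        (cellIso a).inv.app m ▷ _
      rw [← cancel_epi ((cellIso a).hom.app (m ⊗ Y)), Category.assoc, reassoc_of% h,
        Iso.hom_inv_id_app_assoc, ← whisker_exchange_assoc, ← comp_whiskerRight,
        ← MonoidalCategory.whiskerLeft_comp_assoc]
      simp [θ])
  refine ⟨b, hom_ext_cellApp ?_ fun X => ?_, hom_ext_cellApp ?_ fun X => ?_⟩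
  · exact TensorAut.hom_ext fun X => (TensorAut.Hom.iso θ).hom_inv_id_app X
  · rw [cellApp_comp, cellApp_id]
    exact (cellIso a).hom_inv_id_app X
  · exact TensorAut.hom_ext fun X => (TensorAut.Hom.iso θ).inv_hom_id_app X
  · rw [cellApp_comp, cellApp_id]
    exact (cellIso a).inv_hom_id_app X

end HomotopyFiber

end TwistFiber

section Lift

open Functor.LaxMonoidal Functor.OplaxMonoidal Functor.Monoidal Family HomotopyFiber

variable {C : Type u} [Category.{v} C] [Abelian C] [Linear ℂ C] [MonoidalCategory C]
  [MonoidalPreadditive C] [MonoidalLinear ℂ C] [RightRigidCategory C] [FiniteSemisimple C]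

attribute [local instance] conjugationMonoidal

/-- A morphism of the homotopy fiber with source `(F_g, Φ_g)` is determined by its 2-cell. -/
lemma lift_hom_ext {g : InvObj C} {B : HomotopyFiber (twistPseudofunctor C) (regular C)}
    {a b : (conjugationNullHomotopy C).lift.obj g ⟶ B} (w : ∀ X : C, cellApp a X = cellApp b X) :
    a = b := by
  refine hom_ext_cellApp (TensorAut.hom_ext fun Y => ?_) w
  have ha := cellApp_right a (𝟙_ C) Y
  have hb := cellApp_right b (𝟙_ C) Y
  rw [w, w] at ha
  have h := ha.symm.trans hb
  rw [cancel_mono, cancel_epi] at h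
  have : (tensorLeft (𝟙_ C ⊗ g.objᘁ)).IsEquivalence :=
    (InvObj.unit.tensor g.dual).isEquivalence_tensorLeft
  exact (tensorLeft (𝟙_ C ⊗ g.objᘁ)).map_injective h

instance : (conjugationNullHomotopy C).lift.Faithful where
  map_injective {g h} f f' w := by
    have e : 𝟙_ C ◁ ((InvObj.Hom.iso f).inv)ᘁ = 𝟙_ C ◁ ((InvObj.Hom.iso f').inv)ᘁ :=
      congrArg (fun a => cellApp a (𝟙_ C)) w
    have e' : (InvObj.Hom.iso f).inv = (InvObj.Hom.iso f').inv :=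
      InvObj.rightAdjointMate_injective (by simpa using e)
    exact InvObj.Hom.ext (Iso.ext (Iso.inv_eq_inv _ _ |>.1 e'))

instance : (conjugationNullHomotopy C).lift.Full where
  map_surjective {g h} a := by
    let κ := cellIso a
    -- the 2-cell is `X ⊗ u` by left linearity, and `u` is the dual of an isomorphism
    let u : g.objᘁ ≅ h.objᘁ := (λ_ _).symm ≪≫ κ.app (𝟙_ C) ≪≫ λ_ _
    obtain ⟨f, hf⟩ := InvObj.exists_rightAdjointMate_eq u
    refine ⟨⟨f⟩, lift_hom_ext fun X => ?_⟩
    have key (p : (X ⊗ 𝟙_ C) ⊗ g.objᘁ ⟶ (X ⊗ 𝟙_ C) ⊗ h.objᘁ) (q : X ⊗ g.objᘁ ⟶ X ⊗ h.objᘁ)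
        (s : 𝟙_ C ⊗ g.objᘁ ⟶ 𝟙_ C ⊗ h.objᘁ)
        (h₁ : p ≫ (α_ X (𝟙_ C) h.objᘁ).hom = (α_ X (𝟙_ C) g.objᘁ).hom ≫ X ◁ s)
        (h₂ : (ρ_ X).hom ▷ g.objᘁ ≫ q = p ≫ (ρ_ X).hom ▷ h.objᘁ) :
        X ◁ ((λ_ _).inv ≫ s ≫ (λ_ _).hom) = q := by
      rw [← cancel_epi ((ρ_ X).hom ▷ g.objᘁ), h₂, ← triangle X h.objᘁ, reassoc_of% h₁]
      monoidal
    refine Eq.trans ?_ (key _ _ _ (cellApp_left a X (𝟙_ C)) (κ.hom.naturality (ρ_ X).hom))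
    exact congrArg (X ◁ ·) hf

instance : (conjugationNullHomotopy C).lift.EssSurj where
  mem_essImage A := by
    have : A.fiberFunctor.IsEquivalence := Bimod.Hom.isEquivalence A.equiv
    obtain ⟨g, κ, hκ, hl⟩ := InvObj.exists_trivialization A.base.functor.obj A.fiberFunctor
      A.fiberLeft A.fiberRight (Bimod.Hom.left_natural_left A.equiv)
      (Bimod.Hom.left_natural A.equiv) (Bimod.Hom.left_assoc A.equiv)
    obtain ⟨θ, hθ, hr⟩ := g.exists_conj_iso A.base.functor A.fiberFunctor A.fiberLeft A.fiberRight
      (Bimod.Hom.right_natural A.equiv) (Bimod.Hom.right_natural_right A.equiv)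
      (Bimod.Hom.right_assoc A.equiv) (Bimod.Hom.right_unit A.equiv)
      (Bimod.Hom.middle A.equiv) κ hκ hl
    let a : (conjugationNullHomotopy C).lift.obj g ⟶ A :=
      mkHom (TensorAut.Hom.mk (F := g.conj) θ (isMonoidal := hθ)) (NatIso.ofComponents κ hκ) hl
        (fun m Y => by
          have key {P Q R S : C} (c : P ⟶ Q) [IsIso c] {x : Q ⟶ S} {y : P ⟶ R} {z : R ⟶ S}
              (h : c ≫ x = y ≫ z) : x = (inv c ≫ y) ≫ z := by
            rw [Category.assoc, ← h, IsIso.inv_hom_id_assoc]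
          exact key (g.conjAct m Y) (hr m Y))
    exact ⟨g, ⟨@asIso _ _ _ _ a (isIso_of_twist a)⟩⟩

end Lift

end FusionFiber

theorem theorem3 (C : Type u) [Category.{v} C] [Abelian C] [Linear ℂ C] [MonoidalCategory C]
    [MonoidalPreadditive C] [MonoidalLinear ℂ C] [RigidCategory C] [FusionCategory C] :
    IsCategoricalGroup (InvObj C) ∧ IsCategoricalGroup (TensorAut C) ∧
      (regular C).IsOuter ∧ (∀ F : TensorAut C, (twist F).IsOuter) ∧
      ∃ (_ : (conjugation C).Monoidal) (M : MonoidalStructure (twistPseudofunctor C))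
        (N : NullHomotopy (conjugation C) (twistPseudofunctor C) M),
        (∀ (g h : InvObj C) (X : C),
          (TensorAut.Hom.iso (Functor.OplaxMonoidal.δ (conjugation C) g h)).hom.app X =
            g.conjTensor h X) ∧
        (∀ F G : TensorAut C, M.ι F G = twistPairing F G) ∧
        (∀ g : InvObj C, N.Φ g = conjEquiv g) ∧
        N.lift.IsEquivalence :=
  ⟨InvObj.isCategoricalGroup C, TensorAut.isCategoricalGroup, regular_isOuter C, twist_isOuter,
    conjugationMonoidal C, twistMonoidal C, conjugationNullHomotopy C, conjugation_δ_app,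
    fun _ _ => rfl, fun _ => rfl, {}⟩
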